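/- A *PEL-datum* is a tuple $(B,*,V,\langle\ ,\ \rangle,h)$ consisting of a finite-dimensional semisimple $\mathbb{Q}$-algebra $B$ with a $\mathbb{Q}$-linear anti-involution $*$ that is positive (i.e. $\operatorname{tr}_{B_\mathbb{R}/\mathbb{R}}(bb^*)>0$ for all $0\neq b\in B_\mathbb{R}$), a finite-dimensional $B$-module $V$ with a non-degenerate alternating $\mathbb{Q}$-bilinear form satisfying $\langle bu,v\rangle=\langle u,b^*v\rangle$, and an $\mathbb{R}$-algebra homomorphism $h\colon\mathbb{C}\to\operatorname{End}_{B_\mathbb{R}}(V_\mathbb{R})$ such that $\langle h(z)u,v\rangle=\langle u,h(\bar z)v\rangle$ for all $z\in\mathbb{C}$ and $\langle u,h(i)u\rangle$ is positive definite on $V_\mathbb{R}$. It defines the algebraic group $G$ over $\mathbb{Q}$ with $$G(R)=\{g\in\operatorname{Aut}_{B_R}(V_R)\mid \exists\,\mu(g)\in R^\times:\ \langle gu,gv\rangle=\mu(g)\langle u,v\rangle\ \text{for all } u,v\in V_R\}$$ for every commutative $\mathbb{Q}$-algebra $R$. The restriction of $h$ to $\mathbb{C}^\times$ is the map on real points of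 a homomorphism $h\colon\mathbb{S}\to G_\mathbb{R}$, where $\mathbb{S}=\operatorname{Res}_{\mathbb{C}/\mathbb{R}}\mathbb{G}_m$; let $\mathfrak{X}$ be its $G(\mathbb{R})$-conjugacy class. The *standard representation* of $G$ is the tautological representation on $V$. A morphism $f\colon(G',h')\to(G,h)$ between the data attached to two PEL-data is a homomorphism $f\colon G'\to G$ of algebraic groups over $\mathbb{Q}$ such that $f_{\mathbb{R}}\circ x\in\mathfrak{X}$ for all $x\in\mathfrak{X}'$. **Corollary 11.3.** Let $(B',*',V',\langle\ ,\ \rangle',h')$ be a PEL-datum all of whose real factors are of symplectic type, that is, $(B'_\mathbb{R},*')$ is isomorphic to a finite product of algebras with involution of the form $(M_n(\mathbb{R}),A\mapsto A^t)$, and let $(B,*,V,\langle\ ,\ \rangle,h)$ be any PEL-datum. Then every morphism $f\colon(G',h')\to(G,h)$ is admissible: there are an $n\in\mathbb{N}$ and an idempotent endomorphism $e$ of the $G'$-representation $V'^{\oplus n}$ such that $f^*V\cong e\cdot V'^{\oplus n}$ as representations of $G'$ over $\mathbb{Q}$. -/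

import Mathlib

open CategoryTheory
open scoped TensorProduct

universe u v w

noncomputable section

namespace PEL

/-! ### Group functors over `ℚ`, general linear groups, representations -/

/-- Group-valued functors on commutative `ℚ`-algebras. Algebraic groups over `ℚ` are regarded
as such functors through their functors of points, and morphisms of algebraic groups are natural
transformations. -/
abbrev GroupFunctor := CommAlgCat.{0} ℚ ⥤ GrpCat.{v}

section BaseChange

variable {W : Type v} [AddCommGroup W] [Module ℚ W]
variable {W' : Type w} [AddCommGroup W'] [Module ℚ W']
variable {R S T : Type} [CommRing R] [Algebra ℚ R] [CommRing S] [Algebra ℚ S]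
  [CommRing T] [Algebra ℚ T]

/-- The map `φ ⊗ id : R ⊗ W → S ⊗ W` for a homomorphism `φ : R → S` of `ℚ`-algebras. -/
def changeScalars (W : Type v) [AddCommGroup W] [Module ℚ W] (φ : R →ₐ[ℚ] S) :
    R ⊗[ℚ] W →ₗ[ℚ] S ⊗[ℚ] W :=
  TensorProduct.map φ.toLinearMap LinearMap.id

@[simp] lemma changeScalars_tmul (φ : R →ₐ[ℚ] S) (r : R) (x : W) :
    changeScalars W φ (r ⊗ₜ x) = φ r ⊗ₜ x := rfl

lemma changeScalars_smul (φ : R →ₐ[ℚ] S) (r : R) (x : R ⊗[ℚ] W) :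
    changeScalars W φ (r • x) = φ r • changeScalars W φ x := by
  induction x with
  | zero => simp
  | tmul a b => simp [TensorProduct.smul_tmul']
  | add a b ha hb => simp [ha, hb]

/-- The extension of scalars along `φ : R → S` of an `R`-linear endomorphism of `R ⊗ W`. -/
def extendEnd (φ : R →ₐ[ℚ] S) (a : Module.End R (R ⊗[ℚ] W)) : Module.End S (S ⊗[ℚ] W) :=
  LinearMap.liftBaseChange S
    (changeScalars W φ ∘ₗ a.restrictScalars ℚ ∘ₗ TensorProduct.mk ℚ R W 1)

/-- The extension of scalars is compatible with the original endomorphism. -/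
lemma extendEnd_changeScalars (φ : R →ₐ[ℚ] S) (a : Module.End R (R ⊗[ℚ] W)) (x : R ⊗[ℚ] W) :
    extendEnd φ a (changeScalars W φ x) = changeScalars W φ (a x) := by
  induction x with
  | zero => simp
  | tmul r x =>
    have h : (r ⊗ₜ[ℚ] x : R ⊗[ℚ] W) = r • ((1 : R) ⊗ₜ[ℚ] x) := by
      simp [TensorProduct.smul_tmul']
    rw [h, changeScalars_smul, LinearMap.map_smul, LinearMap.map_smul, changeScalars_smul]
    simp [extendEnd]
  | add a b ha hb => simp [ha, hb]

/-- ... and it is characterized by this. -/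
lemma eq_extendEnd (φ : R →ₐ[ℚ] S) (a : Module.End R (R ⊗[ℚ] W)) (b : Module.End S (S ⊗[ℚ] W))
    (h : ∀ x, b (changeScalars W φ x) = changeScalars W φ (a x)) : extendEnd φ a = b := by
  apply TensorProduct.AlgebraTensorModule.curry_injective
  ext x
  have h1 := h ((1 : R) ⊗ₜ x)
  have h2 := extendEnd_changeScalars φ a ((1 : R) ⊗ₜ x)
  rw [changeScalars_tmul, map_one] at h1 h2
  simpa using h2.trans h1.symm

/-- `extendEnd` as a homomorphism of multiplicative monoids. -/
def extendEndHom (W : Type v) [AddCommGroup W] [Module ℚ W] (φ : R →ₐ[ℚ] S) :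
    Module.End R (R ⊗[ℚ] W) →* Module.End S (S ⊗[ℚ] W) where
  toFun := extendEnd φ
  map_one' := eq_extendEnd _ _ _ fun _ => rfl
  map_mul' a b := eq_extendEnd _ _ _ fun x => by
    simp [Module.End.mul_apply, extendEnd_changeScalars]

lemma extendEndHom_apply (φ : R →ₐ[ℚ] S) (a : Module.End R (R ⊗[ℚ] W)) :
    extendEndHom W φ a = extendEnd φ a := rfl

lemma extendEnd_id (a : Module.End R (R ⊗[ℚ] W)) : extendEnd (AlgHom.id ℚ R) a = a := by
  have h (x : R ⊗[ℚ] W) : changeScalars W (AlgHom.id ℚ R) x = x := by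
    induction x with
    | zero => simp
    | tmul r x => simp
    | add a b ha hb => simp [ha, hb]
  exact eq_extendEnd _ _ _ fun x => by rw [h, h]

lemma extendEnd_comp (φ : R →ₐ[ℚ] S) (ψ : S →ₐ[ℚ] T) (a : Module.End R (R ⊗[ℚ] W)) :
    extendEnd (ψ.comp φ) a = extendEnd ψ (extendEnd φ a) := by
  have h (x : R ⊗[ℚ] W) :
      changeScalars W (ψ.comp φ) x = changeScalars W ψ (changeScalars W φ x) := by
    induction x with
    | zero => simp
    | tmul r x => simp
    | add a b ha hb => simp [ha, hb]
  exact eq_extendEnd _ _ _ fun x => by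
    rw [h, h, extendEnd_changeScalars, extendEnd_changeScalars]

lemma baseChange_changeScalars (φ : R →ₐ[ℚ] S) (l : W →ₗ[ℚ] W') (x : R ⊗[ℚ] W) :
    l.baseChange S (changeScalars W φ x) = changeScalars W' φ (l.baseChange R x) := by
  induction x with
  | zero => simp
  | tmul r x => simp
  | add a b ha hb => simp [ha, hb]

end BaseChange

/-- The algebraic group `GL(W)`, with `GL(W)(R) = Aut_R (R ⊗ W)`. -/
def GLFunctor (W : Type v) [AddCommGroup W] [Module ℚ W] : GroupFunctor.{v} where
  obj R := GrpCat.of (Module.End R (R ⊗[ℚ] W))ˣ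
  map φ := GrpCat.ofHom (Units.map (extendEndHom W φ.hom))
  map_id R := by
    ext1
    refine MonoidHom.ext fun g => Units.ext ?_
    exact extendEnd_id _
  map_comp φ ψ := by
    ext1
    refine MonoidHom.ext fun g => Units.ext ?_
    exact extendEnd_comp _ _ _

/-- A representation over `ℚ` of the algebraic group `G` on the vector space `W`: a morphism
`G → GL(W)`. -/
abbrev AlgRep (G : GroupFunctor.{v}) (W : Type v) [AddCommGroup W] [Module ℚ W] := G ⟶ GLFunctor W

namespace AlgRep

variable {G G' : GroupFunctor.{v}}
variable {W : Type v} [AddCommGroup W] [Module ℚ W]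
variable {W' : Type v} [AddCommGroup W'] [Module ℚ W']

/-- The operator on `R ⊗ W` by which `g ∈ G(R)` acts. -/
def act (ρ : AlgRep G W) (R : CommAlgCat.{0} ℚ) : G.obj R →* Module.End R (R ⊗[ℚ] W) :=
  (Units.coeHom _).comp (ρ.app R).hom

lemma act_map (ρ : AlgRep G W) {R S : CommAlgCat.{0} ℚ} (φ : R ⟶ S) (g : G.obj R) :
    ρ.act S ((G.map φ).hom g) = extendEnd φ.hom (ρ.act R g) := by
  have h := congrArg (fun k => (k.hom g : (Module.End S (S ⊗[ℚ] W))ˣ)) (ρ.naturality φ)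
  exact congrArg Units.val h

/-- A representation from a compatible family of actions. -/
def ofAct (a : ∀ R : CommAlgCat.{0} ℚ, G.obj R →* Module.End R (R ⊗[ℚ] W))
    (ha : ∀ {R S : CommAlgCat.{0} ℚ} (φ : R ⟶ S) (g : G.obj R) (x : R ⊗[ℚ] W),
      a S ((G.map φ).hom g) (changeScalars W φ.hom x) = changeScalars W φ.hom (a R g x)) :
    AlgRep G W where
  app R := GrpCat.ofHom (a R).toHomUnits
  naturality R S φ := by
    ext1
    refine MonoidHom.ext fun g => Units.ext ?_
    exact (eq_extendEnd φ.hom (a R g) _ (ha φ g)).symm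

@[simp] lemma ofAct_act (a : ∀ R : CommAlgCat.{0} ℚ, G.obj R →* Module.End R (R ⊗[ℚ] W)) (ha)
    (R : CommAlgCat.{0} ℚ) (g : G.obj R) : (ofAct (W := W) a ha).act R g = a R g := rfl

/-- The pullback `f^* ρ` of a representation along a morphism `f` of algebraic groups. -/
def pullback (f : G' ⟶ G) (ρ : AlgRep G W) : AlgRep G' W := f ≫ ρ

/-- `l : W → W'` is a morphism in the category of representations of `G`. -/
def IsHom (ρ : AlgRep G W) (ρ' : AlgRep G W') (l : W →ₗ[ℚ] W') : Prop :=
  ∀ (R : CommAlgCat.{0} ℚ) (g : G.obj R) (x : R ⊗[ℚ] W),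
    l.baseChange R (ρ.act R g x) = ρ'.act R g (l.baseChange R x)

/-- Two representations of `G` are isomorphic. -/
def IsIsoTo (ρ : AlgRep G W) (ρ' : AlgRep G W') : Prop :=
  ∃ l : W ≃ₗ[ℚ] W', IsHom ρ ρ' l.toLinearMap

/-- The direct sum `ρ^{⊕ n}`, on `W^n = (Fin n → W)`, where `G` acts on each summand by `ρ`. -/
def power (ρ : AlgRep G W) (n : ℕ) : AlgRep G (Fin n → W) :=
  ofAct
    (fun R =>
      { toFun := fun g => ∑ i : Fin n,
          (LinearMap.single ℚ (fun _ : Fin n => W) i).baseChange R ∘ₗ ρ.act R g ∘ₗ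
            (LinearMap.proj (R := ℚ) (φ := fun _ : Fin n => W) i).baseChange R
        map_one' := by
          have h : (∑ i : Fin n, LinearMap.single ℚ (fun _ : Fin n => W) i ∘ₗ
              LinearMap.proj (R := ℚ) (φ := fun _ : Fin n => W) i) = LinearMap.id := by
            ext i x j
            simp [Pi.single_apply]
          have h' := congrArg (LinearMap.baseChange (R : Type)) h
          rw [LinearMap.baseChange_id] at h'
          rw [map_one]
          refine Eq.trans ?_ h'
          change _ = (LinearMap.baseChangeHom ℚ (R : Type) (Fin n → W) (Fin n → W)) _
          rw [map_sum]
          refine Finset.sum_congr rfl fun i _ => ?_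
          exact (LinearMap.baseChange_comp ..).symm
        map_mul' := fun g k => by
          have h (i j : Fin n) (x : R ⊗[ℚ] W) :
              (LinearMap.proj (R := ℚ) (φ := fun _ : Fin n => W) i).baseChange R
                ((LinearMap.single ℚ (fun _ : Fin n => W) j).baseChange R x) =
              if i = j then x else 0 := by
            rw [← LinearMap.comp_apply, ← LinearMap.baseChange_comp]
            split_ifs with hij
            · subst hij
              rw [LinearMap.proj_comp_single_same, LinearMap.baseChange_id]
              rfl
            · rw [LinearMap.proj_comp_single_ne _ _ _ _ hij]
              simp
          ext x
          simp [LinearMap.sum_apply, Module.End.mul_apply, h, apply_ite] })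
    (fun φ g x => by
      simp [LinearMap.sum_apply, baseChange_changeScalars, act_map, extendEnd_changeScalars])

/-- For an idempotent endomorphism `e` of the representation `ρ`, the representation
`e · ρ` on the image of `e`, on which `G` acts by restricting its action. -/
def summand (ρ : AlgRep G W) (e : Module.End ℚ W) (hρ : IsHom ρ ρ e) (he : IsIdempotentElem e) :
    AlgRep G (LinearMap.range e) :=
  ofAct
    (fun R =>
      { toFun := fun g => e.rangeRestrict.baseChange R ∘ₗ ρ.act R g ∘ₗ
          (LinearMap.range e).subtype.baseChange R
        map_one' := by
          have h : e.rangeRestrict ∘ₗ (LinearMap.range e).subtype = LinearMap.id := by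
            ext ⟨x, y, rfl⟩
            exact congrArg (fun k : Module.End ℚ W => k y) he
          have h' := congrArg (LinearMap.baseChange (R : Type)) h
          rw [LinearMap.baseChange_id, LinearMap.baseChange_comp] at h'
          rw [map_one]
          exact h'
        map_mul' := fun g k => by
          have h1 (x : R ⊗[ℚ] W) : (LinearMap.range e).subtype.baseChange R
              (e.rangeRestrict.baseChange R x) = e.baseChange R x := by
            rw [← LinearMap.comp_apply, ← LinearMap.baseChange_comp]
            rfl
          have h2 (x : R ⊗[ℚ] LinearMap.range e) :
              e.baseChange R ((LinearMap.range e).subtype.baseChange R x) =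
              (LinearMap.range e).subtype.baseChange R x := by
            rw [← LinearMap.comp_apply, ← LinearMap.baseChange_comp]
            congr 2
            ext ⟨x, y, rfl⟩
            exact congrArg (fun k : Module.End ℚ W => k y) he
          refine LinearMap.ext fun x => ?_
          simp [Module.End.mul_apply, h1, h2, hρ R k] })
    (fun φ g x => by
      simp [baseChange_changeScalars, act_map, extendEnd_changeScalars])

end AlgRep

/-! ### PEL-data -/

/-- The action of `b ∈ B` on a `B`-module `V`, as a `ℚ`-linear map. -/
def actBy {B : Type u} [Ring B] [Algebra ℚ B] {V : Type v} [AddCommGroup V] [Module ℚ V]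
    [Module B V] [IsScalarTower ℚ B V] (b : B) : V →ₗ[ℚ] V :=
  Algebra.lsmul ℚ ℚ V b

/-- A PEL-datum `(B, *, V, ⟨ , ⟩, h)`. -/
structure PELDatum where
  /-- the algebra `B`: a finite-dimensional semisimple `ℚ`-algebra -/
  B : Type u
  [ringB : Ring B]
  [algebraB : Algebra ℚ B]
  [finiteB : Module.Finite ℚ B]
  [semisimpleB : IsSemisimpleRing B]
  /-- the involution `*` -/
  inv : B →ₗ[ℚ] B
  inv_mul : ∀ a b, inv (a * b) = inv b * inv a
  inv_inv : ∀ b, inv (inv b) = b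
  /-- the involution is positive on `B_ℝ`: the trace of multiplication by `b b^*` on `B_ℝ` is
  positive for `b ≠ 0` -/
  inv_pos : ∀ b : ℝ ⊗[ℚ] B, b ≠ 0 →
    0 < LinearMap.trace ℝ (ℝ ⊗[ℚ] B) (LinearMap.mulLeft ℝ (b * inv.baseChange ℝ b))
  /-- the finite-dimensional `B`-module `V` -/
  V : Type v
  [addCommGroupV : AddCommGroup V]
  [moduleV : Module ℚ V]
  [finiteV : Module.Finite ℚ V]
  [moduleBV : Module B V]
  [towerV : IsScalarTower ℚ B V]
  /-- the alternating non-degenerate pairing `⟨ , ⟩` -/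
  form : LinearMap.BilinForm ℚ V
  form_alt : form.IsAlt
  form_nondegenerate : form.Nondegenerate
  form_smul : ∀ (b : B) (x y : V), form (b • x) y = form x (inv b • y)
  /-- the homomorphism `h : ℂ → End (V_ℝ)`, which takes values in `End_{B_ℝ} (V_ℝ)` -/
  h : ℂ →ₐ[ℝ] Module.End ℝ (ℝ ⊗[ℚ] V)
  h_comm : ∀ (z : ℂ) (b : B) (x : ℝ ⊗[ℚ] V),
    h z ((actBy b).baseChange ℝ x) = (actBy b).baseChange ℝ (h z x)
  h_adjoint : ∀ (z : ℂ) (x y : ℝ ⊗[ℚ] V),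
    form.baseChange ℝ (h z x) y = form.baseChange ℝ x (h (starRingEnd ℂ z) y)
  h_pos : ∀ x : ℝ ⊗[ℚ] V, x ≠ 0 → 0 < form.baseChange ℝ x (h Complex.I x)

namespace PELDatum

attribute [instance] ringB algebraB finiteB semisimpleB addCommGroupV moduleV finiteV moduleBV
  towerV

/-- `G(R)`: the `B_R`-linear automorphisms `g` of `V_R` which preserve the pairing up to a
scalar `μ(g) ∈ Rˣ`. (An `R`-linear map is `B_R`-linear if it commutes with all `b ∈ B`.) -/
def points (D : PELDatum.{u, v}) (R : Type) [CommRing R] [Algebra ℚ R] :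
    Subgroup (Module.End R (R ⊗[ℚ] D.V))ˣ where
  carrier := {g | (∀ (b : D.B) (x : R ⊗[ℚ] D.V),
      g.val ((actBy b).baseChange R x) = (actBy b).baseChange R (g.val x)) ∧
    ∃ μ : Rˣ, ∀ x y : R ⊗[ℚ] D.V,
      D.form.baseChange R (g.val x) (g.val y) = μ * D.form.baseChange R x y}
  one_mem' := ⟨fun _ _ => rfl, 1, fun _ _ => by simp⟩
  mul_mem' := by
    rintro g k ⟨hg, μ, hμ⟩ ⟨hk, ν, hν⟩
    refine ⟨fun b x => ?_, μ * ν, fun x y => ?_⟩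
    · simp [Module.End.mul_apply, hg, hk]
    · simp [Module.End.mul_apply, hμ, hν, mul_assoc]
  inv_mem' := by
    rintro g ⟨hg, μ, hμ⟩
    have h1 (x) : g.val ((g⁻¹).val x) = x := by
      rw [← Module.End.mul_apply, Units.mul_inv]; rfl
    have h2 (x) : (g⁻¹).val (g.val x) = x := by
      rw [← Module.End.mul_apply, Units.inv_mul]; rfl
    refine ⟨fun b x => ?_, μ⁻¹, fun x y => ?_⟩
    · have h := congrArg (fun k => (g⁻¹).val k) (hg b ((g⁻¹).val x))
      simp only [h1, h2] at h
      exact h.symm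
    · have h := hμ ((g⁻¹).val x) ((g⁻¹).val y)
      rw [h1, h1] at h
      rw [h, Units.inv_mul_cancel_left]

lemma form_changeScalars (D : PELDatum.{u, v}) {R S : Type} [CommRing R] [Algebra ℚ R]
    [CommRing S] [Algebra ℚ S] (φ : R →ₐ[ℚ] S) (x y : R ⊗[ℚ] D.V) :
    D.form.baseChange S (changeScalars D.V φ x) (changeScalars D.V φ y) =
      φ (D.form.baseChange R x y) := by
  induction x with
  | zero => simp
  | tmul a x =>
    induction y with
    | zero => simp
    | tmul b y => simp
    | add a b ha hb => simp only [map_add, ha, hb]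
  | add a b ha hb => simp only [map_add, LinearMap.add_apply, ha, hb]

lemma extend_mem_points (D : PELDatum.{u, v}) {R S : Type} [CommRing R] [Algebra ℚ R]
    [CommRing S] [Algebra ℚ S] (φ : R →ₐ[ℚ] S) (g : (Module.End R (R ⊗[ℚ] D.V))ˣ)
    (hg : g ∈ D.points R) : Units.map (extendEndHom D.V φ) g ∈ D.points S := by
  obtain ⟨hg, μ, hμ⟩ := hg
  have key (r : S) (x : D.V) :
      (r ⊗ₜ[ℚ] x : S ⊗[ℚ] D.V) = r • changeScalars D.V φ ((1 : R) ⊗ₜ[ℚ] x) := by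
    simp [TensorProduct.smul_tmul']
  refine ⟨fun b x => ?_, Units.map (φ : R →* S) μ, fun x y => ?_⟩
  · change extendEnd φ g.val _ = (actBy b).baseChange S (extendEnd φ g.val _)
    induction x with
    | zero => simp
    | tmul r x =>
      rw [key]
      simp only [LinearMap.map_smul, baseChange_changeScalars, extendEnd_changeScalars, hg]
    | add a b ha hb => simp only [map_add, ha, hb]
  · change D.form.baseChange S (extendEnd φ g.val _) (extendEnd φ g.val _) = φ μ * _
    induction x with
    | zero => simp
    | tmul a x =>
      induction y with
      | zero => simp
      | tmul b y =>
        rw [key, key]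
        simp only [LinearMap.map_smul, LinearMap.smul_apply, extendEnd_changeScalars,
          form_changeScalars, hμ, map_mul, smul_eq_mul]
        ring
      | add a b ha hb => simp only [map_add, ha, hb, mul_add]
    | add a b ha hb => simp only [map_add, LinearMap.add_apply, ha, hb, mul_add]

/-- The algebraic group `G` over `ℚ` defined by a PEL-datum. -/
def G (D : PELDatum.{u, v}) : GroupFunctor.{v} where
  obj R := GrpCat.of (D.points R)
  map φ := GrpCat.ofHom (((Units.map (extendEndHom D.V φ.hom)).comp
    (D.points _).subtype).codRestrict (D.points _)
      fun g => D.extend_mem_points φ.hom g.val g.property)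
  map_id R := by
    ext1
    refine MonoidHom.ext fun g => Subtype.ext (Units.ext ?_)
    exact extendEnd_id _
  map_comp φ ψ := by
    ext1
    refine MonoidHom.ext fun g => Subtype.ext (Units.ext ?_)
    exact extendEnd_comp _ _ _

/-- The standard representation of `G` on `V`: the inclusion `G ⊆ GL(V)`. -/
def standard (D : PELDatum.{u, v}) : AlgRep D.G D.V where
  app R := GrpCat.ofHom (D.points R).subtype
  naturality _ _ _ := rfl

/-- The group `G(ℝ)`. -/
abbrev realPoints (D : PELDatum.{u, v}) : Type v := D.G.obj (CommAlgCat.of ℚ ℝ)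

lemma h_mem_points (D : PELDatum.{u, v}) (z : ℂˣ) :
    Units.map (D.h : ℂ →* Module.End ℝ (ℝ ⊗[ℚ] D.V)) z ∈ D.points ℝ := by
  refine ⟨fun b x => D.h_comm z b x,
    Units.mk0 (Complex.normSq z) (Complex.normSq_pos.mpr z.ne_zero).ne', fun x y => ?_⟩
  change D.form.baseChange ℝ (D.h z x) (D.h z y) = Complex.normSq z * _
  rw [D.h_adjoint, ← Module.End.mul_apply, ← map_mul, ← Complex.normSq_eq_conj_mul_self]
  have h : D.h (Complex.normSq z : ℂ) = algebraMap ℝ _ (Complex.normSq z) :=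
    D.h.commutes (Complex.normSq z)
  rw [h, Module.algebraMap_end_apply, LinearMap.map_smul, smul_eq_mul]

/-- The homomorphism `𝕊 → G_ℝ` induced by `h`, where `𝕊 = Res_{ℂ/ℝ} 𝔾_m`. As `𝕊` is a real torus,
in which `𝕊(ℝ) = ℂˣ` is Zariski dense, a homomorphism from `𝕊` is recorded by its effect
`ℂˣ → G(ℝ)` on real points. -/
def hReal (D : PELDatum.{u, v}) : ℂˣ →* D.realPoints :=
  (Units.map (D.h : ℂ →* Module.End ℝ (ℝ ⊗[ℚ] D.V))).codRestrict (D.points ℝ) D.h_mem_points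

/-- `𝔛`: the `G(ℝ)`-conjugacy class of `h`. -/
def X (D : PELDatum.{u, v}) : Set (ℂˣ →* D.realPoints) :=
  {x | ∃ g : D.realPoints, ∀ z, x z = g * D.hReal z * g⁻¹}

/-- A morphism `f : G' → G` of algebraic groups over `ℚ` is a morphism `(G', 𝔛') → (G, 𝔛)` of
Shimura data if `f ∘ x ∈ 𝔛` for all `x ∈ 𝔛'`. -/
def IsShimuraMorphism {D' : PELDatum.{w, v}} {D : PELDatum.{u, v}} (f : D'.G ⟶ D.G) : Prop :=
  ∀ x ∈ D'.X, (f.app (CommAlgCat.of ℚ ℝ)).hom.comp x ∈ D.X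

/-- All factors of `B_ℝ` are of symplectic type: `(B_ℝ, *)` is isomorphic to a finite product of
algebras with involution `(M_n(ℝ), A ↦ Aᵗ)`. -/
def IsSymplectic (D : PELDatum.{u, v}) : Prop :=
  ∃ (k : ℕ) (n : Fin k → ℕ) (_ : ∀ i, 0 < n i)
    (e : (ℝ ⊗[ℚ] D.B) ≃ₐ[ℝ] (∀ i, Matrix (Fin (n i)) (Fin (n i)) ℝ)),
    ∀ b i, e (D.inv.baseChange ℝ b) i = (e b i).transpose

/-- `f` is admissible: `f^* V ≅ e · V'^{⊕ n}` as representations of `G'`, for some `n` and some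
idempotent endomorphism `e` of the representation `V'^{⊕ n}`. -/
def IsAdmissible {D' : PELDatum.{w, v}} {D : PELDatum.{u, v}} (f : D'.G ⟶ D.G) : Prop :=
  ∃ (n : ℕ) (e : Module.End ℚ (Fin n → D'.V))
    (hG : AlgRep.IsHom (D'.standard.power n) (D'.standard.power n) e)
    (he : IsIdempotentElem e),
    (D.standard.pullback f).IsIsoTo ((D'.standard.power n).summand e hG he)

end PELDatum

end PEL

end

/-!
Why every morphism `f : (G', 𝔛') → (G, 𝔛)` is admissible when `B'_ℝ` is a product of matrix
algebras `M_n(ℝ)` with transposition.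

The heart is a statement over `ℝ`. By Morita equivalence `V'_ℝ` is made of symplectic spaces
`(W_c, ω_c)`, one for each factor of `B'_ℝ`, and the Lie algebra of the group of isometries is
`∏ 𝔰𝔭(W_c) = ∏ Sym² W_c`. It is generated by operators `eps c w w`, the analogues of
`y ↦ ω_c(w, y) w`, which have square zero. Let `ρ` be the representation of the Lie algebra on `V_ℝ`
defined by `f`. Put `J = h'(i)`. As `f` maps `𝔛'` to `𝔛`, the operator `ρ(J)` is a complex
structure, and so are all `ρ(g J g⁻¹)`. For `x` in the Lie algebra with `x² = 0`, the elements
`1 + t x` are isometries for all `t`, and the coefficient of `t⁴` in the resulting polynomial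
identity gives `ρ(x J x)² = 0` (`RepGraph.rho_mul_self_eq_zero`). Positivity of `J` turns this into
`N(w, w)² = 0` and `N(w, w) N(v, v) = 0` for orthogonal `w` and `v`, where `N(w, w) = ρ(eps c w w)`.
These are relations of the standard representation, and they only leave room for its constituents
and trivial ones. Concretely, `w ↦ N(w, u) N(u', u') - …` (`rankOneOp`) intertwines the standard
representation with `ρ` (`mul_rankOneOp`), no highest weight theory being needed, and the images of
these intertwiners contain the images of all `ρ(X)`, hence everything, since `ρ(J)` is invertible
(`eq_zero_of_forall_intertwiner`).

An intertwiner for the Lie algebra is one for the group over every real algebra `R`. Isometries at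
the end of a rational path `(1 + t X) (1 - t X)⁻¹` are treated by uniqueness of solutions of
differential equations in `R⟦t⟧` (`intertwinesAt_of_powerSeries`, `intertwinesAt_cayley`); over a
local ring every isometry is a product of such elements, and a general ring embeds into the product
of its localizations; a similitude becomes a scalar times an isometry after adjoining the square
root of its multiplier. So the functionals on `V_ℝ` killing the images of all equivariant maps
`V'_ℝ → V_ℝ` vanish (`eq_zero_of_forall_intertwinesAt`). Applying `ℚ`-linear maps `ℝ → ℚ` to the
entries of real intertwiners gives rational ones, whose images therefore span `V`
(`eq_zero_of_forall_homs`): there is an equivariant surjection `V'^k → V`.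

Finally, its kernel `M` is stable under `h'(i)`, so the pairing on `V'^k` is nondegenerate on `M` by
positivity. The orthogonal complement of `M` is a stable complement, since `G'` acts by similitudes,
and the corresponding section makes `V` a direct summand of `V'^k`
(`exists_equivariant_section`).
-/

/-! ### Quadratic relations between operators -/

namespace PEL

section QuadraticOperators

variable {W A : Type*} [AddCommGroup W] [Module ℝ W] [Ring A] [Algebra ℝ A]
  {ω : LinearMap.BilinForm ℝ W} {N : W →ₗ[ℝ] W →ₗ[ℝ] A}

/-- Polarization of `N z z ^ 2 = 0`: the coefficient of `t` in `N (z + t v) (z + t v) ^ 2 = 0`. -/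
lemma mul_polar_add_polar_mul (hN : ∀ z, N z z * N z z = 0) (hs : ∀ a b, N a b = N b a)
    (z v : W) :
    N z z * N z v + N z v * N z z = 0 := by
  have e (t : ℝ) : N (z + t • v) (z + t • v) = N z z + (2 * t) • N z v + (t * t) • N v v := by
    simp only [map_add, map_smul, LinearMap.add_apply, LinearMap.smul_apply, hs v z]
    module
  -- the polynomial has degree four; its values at `±1` and `±2` isolate the linear coefficient
  have h1 := hN (z + (1 : ℝ) • v)
  have h2 := hN (z + (-1 : ℝ) • v)
  have h3 := hN (z + (2 : ℝ) • v)
  have h4 := hN (z + (-2 : ℝ) • v)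
  rw [e] at h1 h2 h3 h4
  simp only [mul_add, add_mul, smul_mul_assoc, mul_smul_comm, hN, smul_zero] at h1 h2 h3 h4
  linear_combination (norm := module) (1 / 3 : ℝ) • h1 - (1 / 3 : ℝ) • h2 - (1 / 24 : ℝ) • h3
    + (1 / 24 : ℝ) • h4

/-- The bracket relation of the operators `N a b`, modelled on `y ↦ ω a y • b + ω b y • a`. -/
def BracketRel (ω : LinearMap.BilinForm ℝ W) (N : W →ₗ[ℝ] W →ₗ[ℝ] A) : Prop :=
  ∀ z w u, N z z * N w u - N w u * N z z = (2 * ω z w) • N z u + (2 * ω z u) • N w z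

lemma mul_polar (hN : ∀ z, N z z * N z z = 0) (hs : ∀ a b, N a b = N b a) (hω : ω.IsAlt)
    (hb : BracketRel ω N) (z v : W) : N z z * N z v = ω z v • N z z := by
  have h1 := mul_polar_add_polar_mul hN hs z v
  have h2 := hb z z v
  rw [hω z] at h2
  linear_combination (norm := module) (1 / 2 : ℝ) • h1 + (1 / 2 : ℝ) • h2

/-- An operator depending linearly on `w`. For `N a b = (y ↦ ω a y • b + ω b y • a)` and
`ω u u' = 1` it is the rank one map `y ↦ 4 ω u' y • w`. -/
def rankOneOp (ω : LinearMap.BilinForm ℝ W) (N : W →ₗ[ℝ] W →ₗ[ℝ] A) (u u' : W) : W →ₗ[ℝ] A :=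
  LinearMap.mulRight ℝ (N u' u') ∘ₗ ((2 : ℝ) • N.flip u - (ω.flip u').smulRight (N u u))

lemma rankOneOp_apply (u u' w : W) :
    rankOneOp ω N u u' w = ((2 : ℝ) • N w u - ω w u' • N u u) * N u' u' := by
  simp [rankOneOp]

/-- Polarization of `N z z * N v v = 0` in `z`, on the orthogonal complement of `v`. -/
lemma polar_mul_eq_zero (hs : ∀ a b, N a b = N b a)
    (h0 : ∀ z v, ω z v = 0 → N z z * N v v = 0) {a b v : W} (ha : ω a v = 0) (hb : ω b v = 0) :
    N a b * N v v = 0 := by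
  have h1 := h0 (a + b) v (by simp [ha, hb])
  have h2 := h0 a v ha
  have h3 := h0 b v hb
  simp only [map_add, LinearMap.add_apply, add_mul, hs b a] at h1
  linear_combination (norm := module) (1 / 2 : ℝ) • h1 - (1 / 2 : ℝ) • h2 - (1 / 2 : ℝ) • h3

/-- The products `N a b * N u' u'` in terms of `rankOneOp`: project `a` and `b` to the orthogonal
complement of `u'` along `u`. -/
lemma polar_mul_eq (hs : ∀ a b, N a b = N b a)
    (h0 : ∀ z v, ω z v = 0 → N z z * N v v = 0) {u u' : W} (hu : ω u u' = 1) (a b : W) :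
    N a b * N u' u' = (1 / 2 * ω a u') • rankOneOp ω N u u' b
      + (1 / 2 * ω b u') • rankOneOp ω N u u' a := by
  have h := polar_mul_eq_zero hs h0 (a := a - ω a u' • u) (b := b - ω b u' • u) (v := u')
    (by simp [hu]) (by simp [hu])
  simp only [map_sub, map_smul, LinearMap.sub_apply, LinearMap.smul_apply, sub_mul,
    smul_mul_assoc, smul_sub, smul_smul, hs u b] at h
  simp only [rankOneOp_apply, sub_mul, smul_mul_assoc, smul_sub, smul_smul]
  linear_combination (norm := module) h

/-- The operators `rankOneOp` behave like rank one maps: they intertwine the action of the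
`N z z` with `w ↦ 2 ω z w • z`. -/
lemma mul_rankOneOp (hs : ∀ a b, N a b = N b a) (hω : ω.IsAlt) (hb : BracketRel ω N)
    (h0 : ∀ z v, ω z v = 0 → N z z * N v v = 0) {u u' : W} (hu : ω u u' = 1) (z w : W) :
    N z z * rankOneOp ω N u u' w = (2 * ω z w) • rankOneOp ω N u u' z := by
  have hN (z : W) : N z z * N z z = 0 := h0 z z (hω z)
  have hzw := polar_mul_eq hs h0 hu w z
  have hzz := polar_mul_eq hs h0 hu z z
  -- if `ω z u' = 0`, use the bracket relation; otherwise `N z w * N u' u'` involves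
  -- `rankOneOp ω N u u' w` with the nonzero coefficient `ω z u' / 2`, and `mul_polar` applies
  by_cases hz : ω z u' = 0
  · have hzu := polar_mul_eq hs h0 hu z u
    have h1 := congrArg (· * N u' u') (hb z w u)
    have h2 := congrArg (· * N u' u') (hb z u u)
    have h3 := h0 z u' hz
    simp only [sub_mul, add_mul, smul_mul_assoc, mul_assoc, h3, mul_zero, sub_zero, hs u z]
      at h1 h2
    rw [hzu, hz, hu] at h1 h2
    rw [hzw, hz] at h1
    rw [rankOneOp_apply u u' w]
    simp only [sub_mul, mul_sub, smul_mul_assoc, mul_smul_comm, h1, h2]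
    module
  · have h1 := congrArg (N z z * ·) hzw
    have h2 := mul_polar hN hs hω hb z w
    simp only [mul_add, mul_smul_comm, ← mul_assoc, hs w z, h2] at h1
    have h3 := congrArg (N z z * ·) hzz
    simp only [mul_add, mul_smul_comm, ← mul_assoc, hN, zero_mul] at h3
    have h4 : N z z * rankOneOp ω N u u' z = 0 := by
      rw [← add_smul] at h3
      refine (smul_eq_zero.mp h3.symm).resolve_left ?_
      intro h; apply hz; linarith
    rw [h4, smul_zero, zero_add, smul_mul_assoc, hzz] at h1
    have : (1 / 2 * ω z u') •
        (N z z * rankOneOp ω N u u' w - (2 * ω z w) • rankOneOp ω N u u' z) = 0 := by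
      linear_combination (norm := module) -h1
    exact sub_eq_zero.mp ((smul_eq_zero.mp this).resolve_left (by simpa using hz))

lemma rankOneOp_self (hs : ∀ a b, N a b = N b a) (hω : ω.IsAlt) (hb : BracketRel ω N)
    (h0 : ∀ z v, ω z v = 0 → N z z * N v v = 0) {u u' : W} (hu : ω u u' = 1) :
    rankOneOp ω N u u' u' = (2 : ℝ) • N u' u' := by
  have hN (z : W) : N z z * N z z = 0 := h0 z z (hω z)
  have h1 := mul_polar_add_polar_mul hN hs u' u
  have h2 := mul_polar hN hs hω hb u' u
  rw [rankOneOp_apply, hω u', zero_smul, sub_zero, smul_mul_assoc]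
  rw [h2, ← LinearMap.IsAlt.neg hω u u', hu] at h1
  linear_combination (norm := module) (2 : ℝ) • h1

end QuadraticOperators
end PEL

/-! ### Symplectic representations of split algebras in coordinates -/

namespace PEL

open Matrix

/-- A real alternating nondegenerate form on `ℝⁿ` (with Gram matrix `Ω`) together with a
representation on `ℝⁿ` of a product of matrix algebras, given by its matrix units
`E c p q` (`c` numbering the factors), for which the transposition is the adjunction. -/
structure RealModel (n : Type) [Fintype n] [DecidableEq n] where
  blocks : ℕ
  size : Fin blocks → ℕ
  size_pos : ∀ c, 0 < size c
  Ω : Matrix n n ℝ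
  E : ∀ c, Fin (size c) → Fin (size c) → Matrix n n ℝ
  Ω_transpose : Ωᵀ = -Ω
  Ω_det : IsUnit Ω.det
  E_mul : ∀ c p q r s, E c p q * E c r s = if q = r then E c p s else 0
  E_mul_ne : ∀ c d p q r s, c ≠ d → E c p q * E d r s = 0
  E_sum : ∑ c, ∑ p, E c p p = 1
  E_transpose : ∀ c p q, (E c p q)ᵀ * Ω = Ω * E c q p

namespace RealModel

variable {n : Type} [Fintype n] [DecidableEq n] (S : RealModel n)
variable (R : Type) [CommRing R] [Algebra ℝ R] {R' : Type} [CommRing R'] [Algebra ℝ R']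

/-- The distinguished index of each factor. -/
def base (c : Fin S.blocks) : Fin (S.size c) := ⟨0, S.size_pos c⟩

/-- The Gram matrix over the real algebra `R`. -/
def form : Matrix n n R := S.Ω.map (algebraMap ℝ R)

/-- The matrix units over the real algebra `R`. -/
def unit (c : Fin S.blocks) (p q : Fin (S.size c)) : Matrix n n R :=
  (S.E c p q).map (algebraMap ℝ R)

lemma form_map (φ : R →ₐ[ℝ] R') : (S.form R).map φ = S.form R' := by
  ext i j; simp [form]

lemma unit_map (φ : R →ₐ[ℝ] R') (c p q) : (S.unit R c p q).map φ = S.unit R' c p q := by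
  ext i j; simp [unit]

lemma form_transpose : (S.form R)ᵀ = -S.form R := by
  rw [form, ← transpose_map, S.Ω_transpose]
  ext i j; simp

lemma form_det : IsUnit (S.form R).det := by
  have h : (S.form R).det = algebraMap ℝ R S.Ω.det := by
    rw [form, RingHom.map_det]; rfl
  rw [h]; exact S.Ω_det.map _

lemma unit_mul (c p q r s) :
    S.unit R c p q * S.unit R c r s = if q = r then S.unit R c p s else 0 := by
  rw [unit, unit, ← Matrix.map_mul, S.E_mul]
  split_ifs
  · rfl
  · ext i j; simp

lemma unit_mul_same (c p q s) : S.unit R c p q * S.unit R c q s = S.unit R c p s := by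
  simp [unit_mul]

lemma unit_mul_ne {c d} (h : c ≠ d) (p q r s) : S.unit R c p q * S.unit R d r s = 0 := by
  rw [unit, unit, ← Matrix.map_mul, S.E_mul_ne _ _ _ _ _ _ h]
  ext i j; simp

lemma unit_sum : ∑ c, ∑ p, S.unit R c p p = 1 := by
  have h := congrArg (algebraMap ℝ R).mapMatrix S.E_sum
  rw [map_sum, map_one] at h
  rw [← h]
  exact Finset.sum_congr rfl fun c _ => by rw [map_sum]; rfl

lemma unit_transpose (c p q) : (S.unit R c p q)ᵀ * S.form R = S.form R * S.unit R c q p := by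
  rw [unit, unit, form, ← transpose_map, ← Matrix.map_mul, ← Matrix.map_mul, S.E_transpose]

/-- `X` commutes with the matrix units. -/
def Commutes (X : Matrix n n R) : Prop :=
  ∀ c p q, X * S.unit R c p q = S.unit R c p q * X

/-- The matrices commuting with the matrix units and skew for the form: the Lie algebra of the
group of isometries. -/
def skew : Submodule R (Matrix n n R) where
  carrier := {X | S.Commutes R X ∧ Xᵀ * S.form R = -(S.form R * X)}
  zero_mem' := ⟨fun _ _ _ => by simp, by simp⟩
  add_mem' := by
    rintro X Y ⟨hX, hX'⟩ ⟨hY, hY'⟩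
    refine ⟨fun c p q => by rw [add_mul, mul_add, hX, hY], ?_⟩
    rw [transpose_add, add_mul, hX', hY', mul_add, neg_add]
  smul_mem' := by
    rintro r X ⟨hX, hX'⟩
    refine ⟨fun c p q => by rw [smul_mul_assoc, mul_smul_comm, hX], ?_⟩
    rw [transpose_smul, smul_mul_assoc, hX', mul_smul_comm, smul_neg]

/-- `g` commutes with the matrix units and multiplies the form by `μ`. -/
def IsSimilitude (μ : R) (g : Matrix n n R) : Prop :=
  S.Commutes R g ∧ gᵀ * S.form R * g = μ • S.form R

variable {R}

lemma Commutes.mul {X Y : Matrix n n R} (hX : S.Commutes R X) (hY : S.Commutes R Y) :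
    S.Commutes R (X * Y) := fun c p q => by
  rw [mul_assoc, hY, ← mul_assoc, hX, mul_assoc]

lemma Commutes.map {X : Matrix n n R} (hX : S.Commutes R X) (φ : R →ₐ[ℝ] R') :
    S.Commutes R' (X.map φ) := fun c p q => by
  rw [← S.unit_map R φ, ← Matrix.map_mul, ← Matrix.map_mul, hX]

lemma map_mem_skew {X : Matrix n n R} (hX : X ∈ S.skew R) (φ : R →ₐ[ℝ] R') :
    X.map φ ∈ S.skew R' := by
  refine ⟨hX.1.map S φ, ?_⟩
  have h := congrArg (fun M : Matrix n n R => M.map φ) hX.2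
  rw [← S.form_map R φ, ← transpose_map, ← Matrix.map_mul, ← Matrix.map_mul, h,
    Matrix.map_neg _ (map_neg φ)]

lemma IsSimilitude.mul {μ ν : R} {g k : Matrix n n R} (hg : S.IsSimilitude R μ g)
    (hk : S.IsSimilitude R ν k) : S.IsSimilitude R (μ * ν) (g * k) := by
  refine ⟨hg.1.mul S hk.1, ?_⟩
  calc (g * k)ᵀ * S.form R * (g * k) = kᵀ * (gᵀ * S.form R * g) * k := by
        rw [transpose_mul]; simp only [mul_assoc]
    _ = _ := by rw [hg.2, mul_smul_comm, smul_mul_assoc, hk.2, smul_smul]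

lemma IsSimilitude.map {μ : R} {g : Matrix n n R} (hg : S.IsSimilitude R μ g) (φ : R →ₐ[ℝ] R') :
    S.IsSimilitude R' (φ μ) (g.map φ) := by
  refine ⟨hg.1.map S φ, ?_⟩
  have h := congrArg (fun M : Matrix n n R => M.map φ) hg.2
  rw [← S.form_map R φ, ← transpose_map, ← Matrix.map_mul, ← Matrix.map_mul, h]
  ext i j; simp

lemma isSimilitude_smul {μ a : R} {g : Matrix n n R} (hg : S.IsSimilitude R μ g) :
    S.IsSimilitude R (a * a * μ) (a • g) := by
  refine ⟨fun c p q => by rw [smul_mul_assoc, mul_smul_comm, hg.1], ?_⟩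
  rw [transpose_smul, smul_mul_assoc, smul_mul_assoc, mul_smul_comm, hg.2, smul_smul, smul_smul]

/-- A similitude is invertible. -/
lemma IsSimilitude.isUnit_det {μ : R} {g : Matrix n n R} (hg : S.IsSimilitude R μ g)
    (hμ : IsUnit μ) : IsUnit g.det := by
  have h := congrArg Matrix.det hg.2
  rw [det_mul, det_mul, det_smul, det_transpose] at h
  have h' : IsUnit (g.det * (S.form R).det * g.det) := by
    rw [h]; exact (hμ.pow _).mul (S.form_det R)
  exact isUnit_of_mul_isUnit_right h'

lemma IsSimilitude.inv {μ ν : R} {g k : Matrix n n R} (hg : S.IsSimilitude R μ g) (h : g * k = 1)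
    (hν : ν * μ = 1) : S.IsSimilitude R ν k := by
  have h' : k * g = 1 := mul_eq_one_comm.mp h
  refine ⟨fun c p q => ?_, ?_⟩
  · calc k * S.unit R c p q = k * (S.unit R c p q * g) * k := by
          simp only [mul_assoc, h, mul_one]
      _ = k * g * S.unit R c p q * k := by rw [← hg.1]; simp only [mul_assoc]
      _ = S.unit R c p q * k := by rw [h', one_mul]
  · have e : (ν * μ) • (kᵀ * S.form R * k) = ν • ((g * k)ᵀ * S.form R * (g * k)) := by
      rw [mul_smul]
      congr 1
      calc μ • (kᵀ * S.form R * k) = kᵀ * (gᵀ * S.form R * g) * k := by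
            rw [hg.2, mul_smul_comm, smul_mul_assoc]
        _ = _ := by rw [transpose_mul]; simp only [mul_assoc]
    rw [hν, one_smul, h] at e
    simpa using e

/-- Tangent vectors at `1` to the group of isometries, for `x² = 0` in `R`. -/
lemma isSimilitude_one_add {x : R} (hx : x * x = 0) {X : Matrix n n R} (hX : X ∈ S.skew R) :
    S.IsSimilitude R 1 (1 + x • X) := by
  refine ⟨fun c p q => by
    rw [add_mul, mul_add, smul_mul_assoc, mul_smul_comm, hX.1, one_mul, mul_one], ?_⟩
  rw [transpose_add, transpose_smul, transpose_one, add_mul, one_mul, smul_mul_assoc, hX.2]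
  simp only [mul_add, add_mul, smul_mul_assoc, mul_smul_comm, mul_one, smul_neg, neg_mul]
  simp [smul_smul, hx]

/-- Unipotent isometries, for `X² = 0`. -/
lemma isSimilitude_one_add_of_sq {X : Matrix n n R} (hX : X ∈ S.skew R) (h : X * X = 0) :
    S.IsSimilitude R 1 (1 + X) := by
  refine ⟨fun c p q => by rw [add_mul, mul_add, hX.1, one_mul, mul_one], ?_⟩
  rw [transpose_add, transpose_one, add_mul, one_mul, hX.2]
  simp only [mul_add, add_mul, mul_one, neg_mul, mul_assoc, h, mul_zero]
  simp

lemma lie_mem_skew {X Y : Matrix n n R} (hX : X ∈ S.skew R) (hY : Y ∈ S.skew R) :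
    X * Y - Y * X ∈ S.skew R := by
  refine ⟨fun c p q => ?_, ?_⟩
  · rw [sub_mul, mul_sub, hX.1.mul S hY.1, hY.1.mul S hX.1]
  · rw [transpose_sub, transpose_mul, transpose_mul, sub_mul, mul_assoc, mul_assoc, hX.2, hY.2,
      mul_neg, mul_neg, ← mul_assoc, ← mul_assoc, hX.2, hY.2]
    noncomm_ring

/-- Conjugating a skew matrix by a similitude. -/
lemma conj_mem_skew {μ : R} {g k X : Matrix n n R} (hg : S.IsSimilitude R μ g) (hμ : IsUnit μ)
    (h : g * k = 1) (hX : X ∈ S.skew R) : g * X * k ∈ S.skew R := by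
  obtain ⟨ν, hν⟩ := hμ.exists_left_inv
  have hk := hg.inv S h hν
  refine ⟨(hg.1.mul S hX.1).mul S hk.1, ?_⟩
  have e1 : gᵀ * S.form R = μ • (S.form R * k) := by
    rw [← smul_mul_assoc, ← hg.2, mul_assoc, h, mul_one]
  have e2 : kᵀ * S.form R = ν • (S.form R * g) := by
    rw [← smul_mul_assoc, ← hk.2, mul_assoc, mul_eq_one_comm.mp h, mul_one]
  calc (g * X * k)ᵀ * S.form R = kᵀ * (Xᵀ * (gᵀ * S.form R)) := by
        simp only [transpose_mul, mul_assoc]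
    _ = μ • (kᵀ * (Xᵀ * S.form R) * k) := by
        rw [e1]; simp only [mul_smul_comm, mul_assoc]
    _ = -(μ • (kᵀ * S.form R * X * k)) := by
        rw [hX.2]; simp only [mul_neg, neg_mul, smul_neg, mul_assoc]
    _ = -((ν * μ) • (S.form R * (g * X * k))) := by
        rw [e2]; simp only [smul_mul_assoc, smul_smul, mul_assoc, mul_comm]
    _ = _ := by rw [hν, one_smul]

end RealModel
end PEL

/-! ### The operators generating the Lie algebra -/

namespace PEL

open Matrix

namespace RealModel

variable {n : Type} [Fintype n] [DecidableEq n] (S : RealModel n)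
variable (R : Type) [CommRing R] [Algebra ℝ R] {R' : Type} [CommRing R'] [Algebra ℝ R']

/-- The alternating form `⟨x, E y⟩` on `Rⁿ`, where `E` is the distinguished diagonal matrix unit
of the factor `c`. It is the given form on the image of `E`, extended by zero. -/
def blockForm (c : Fin S.blocks) : LinearMap.BilinForm R (n → R) :=
  Matrix.toBilin' (S.form R * S.unit R c (S.base c) (S.base c))

/-- The analogue, commuting with the matrix units, of the rank one map `y ↦ ⟨v, y⟩ w`: the sum of
the `E r o ∘ (y ↦ ⟨v, y⟩ w) ∘ E o r`, where `o` is the distinguished index of the factor `c`. -/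
def eps (c : Fin S.blocks) (w v : n → R) : Matrix n n R :=
  ∑ r, S.unit R c r (S.base c) * vecMulVec w (v ᵥ* S.form R) * S.unit R c (S.base c) r

variable {R}

lemma blockForm_apply (c : Fin S.blocks) (w v : n → R) :
    S.blockForm R c w v = w ⬝ᵥ (S.form R *ᵥ (S.unit R c (S.base c) (S.base c) *ᵥ v)) := by
  rw [blockForm, Matrix.toBilin'_apply', ← mulVec_mulVec]

lemma vecMul_form (v : n → R) : v ᵥ* S.form R = -(S.form R *ᵥ v) := by
  rw [← mulVec_transpose, form_transpose, neg_mulVec]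

lemma form_swap (v w : n → R) : v ⬝ᵥ (S.form R *ᵥ w) = -(w ⬝ᵥ (S.form R *ᵥ v)) := by
  rw [dotProduct_mulVec, vecMul_form, neg_dotProduct, dotProduct_comm]

lemma form_unit (c : Fin S.blocks) (p q) (v w : n → R) :
    v ⬝ᵥ (S.form R *ᵥ (S.unit R c p q *ᵥ w)) = (S.unit R c q p *ᵥ v) ⬝ᵥ (S.form R *ᵥ w) := by
  rw [mulVec_mulVec, ← unit_transpose, ← mulVec_mulVec, dotProduct_mulVec, vecMul_transpose]

lemma blockForm_eq (c : Fin S.blocks) (w v : n → R) :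
    S.blockForm R c w v = (S.unit R c (S.base c) (S.base c) *ᵥ w) ⬝ᵥ (S.form R *ᵥ
      (S.unit R c (S.base c) (S.base c) *ᵥ v)) := by
  rw [blockForm_apply, form_unit, form_unit, mulVec_mulVec, unit_mul_same]

lemma form_self (v : n → R) : v ⬝ᵥ (S.form R *ᵥ v) = 0 := by
  have h := S.form_swap v v
  have h2 : (2 : ℝ) • (v ⬝ᵥ (S.form R *ᵥ v)) = 0 := by rw [two_smul]; linear_combination h
  have := congrArg ((1 / 2 : ℝ) • ·) h2
  simpa [smul_smul] using this

lemma blockForm_isAlt (c : Fin S.blocks) : (S.blockForm R c).IsAlt := fun v => by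
  rw [blockForm_eq, form_self]

lemma blockForm_swap (c : Fin S.blocks) (v w : n → R) :
    S.blockForm R c v w = -S.blockForm R c w v :=
  ((S.blockForm_isAlt c).neg_eq w v).symm

lemma unit_mulVec_mulVec {X : Matrix n n R} (hX : S.Commutes R X) (c p q) (v : n → R) :
    S.unit R c p q *ᵥ (X *ᵥ v) = X *ᵥ (S.unit R c p q *ᵥ v) := by
  rw [mulVec_mulVec, ← hX, mulVec_mulVec]

lemma form_mulVec_skew {X : Matrix n n R} (hX : X ∈ S.skew R) (v w : n → R) :
    v ⬝ᵥ (S.form R *ᵥ (X *ᵥ w)) = w ⬝ᵥ (S.form R *ᵥ (X *ᵥ v)) := by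
  rw [form_swap, mulVec_mulVec, ← neg_neg (S.form R * X), ← hX.2, neg_mulVec, dotProduct_neg,
    ← mulVec_mulVec, dotProduct_mulVec w, vecMul_transpose]

lemma eps_commutes (c : Fin S.blocks) (w v : n → R) : S.Commutes R (S.eps R c w v) := by
  intro d p q
  rw [eps, Finset.sum_mul, Finset.mul_sum]
  by_cases h : c = d
  · subst h
    simp only [mul_assoc, unit_mul]
    simp only [← mul_assoc, unit_mul]
    simp [mul_assoc, Finset.sum_ite_eq]
  · simp only [mul_assoc, S.unit_mul_ne R h]
    simp only [← mul_assoc, S.unit_mul_ne R (Ne.symm h)]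
    simp

lemma mul_eps {X : Matrix n n R} (hX : S.Commutes R X) (c : Fin S.blocks) (w v : n → R) :
    X * S.eps R c w v = S.eps R c (X *ᵥ w) v := by
  rw [eps, eps, Finset.mul_sum]
  refine Finset.sum_congr rfl fun r _ => ?_
  rw [← mul_vecMulVec, ← mul_assoc, ← mul_assoc, ← mul_assoc, hX]

lemma eps_transpose (c : Fin S.blocks) (w v : n → R) :
    (S.eps R c w v)ᵀ * S.form R = -(S.form R * S.eps R c v w) := by
  rw [eps, eps, transpose_sum, Finset.sum_mul, Finset.mul_sum, ← Finset.sum_neg_distrib]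
  refine Finset.sum_congr rfl fun r _ => ?_
  have h : (vecMulVec w (v ᵥ* S.form R))ᵀ * S.form R =
      -(S.form R * vecMulVec v (w ᵥ* S.form R)) := by
    rw [transpose_vecMulVec, vecMulVec_mul, mul_vecMulVec, S.vecMul_form v, neg_vecMulVec]
  calc _ = (S.unit R c (S.base c) r)ᵀ * ((vecMulVec w (v ᵥ* S.form R))ᵀ *
        ((S.unit R c r (S.base c))ᵀ * S.form R)) := by
        rw [transpose_mul, transpose_mul]; simp only [mul_assoc]
    _ = (S.unit R c (S.base c) r)ᵀ * ((vecMulVec w (v ᵥ* S.form R))ᵀ * S.form R) *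
        S.unit R c (S.base c) r := by rw [unit_transpose]; simp only [mul_assoc]
    _ = _ := by
        rw [h, mul_neg, neg_mul, ← mul_assoc (S.unit R c (S.base c) r)ᵀ, unit_transpose]
        simp only [mul_assoc]

lemma eps_mul {X : Matrix n n R} (hX : X ∈ S.skew R) (c : Fin S.blocks) (w v : n → R) :
    S.eps R c w v * X = -S.eps R c w (X *ᵥ v) := by
  rw [eps, eps, Finset.sum_mul, ← Finset.sum_neg_distrib]
  refine Finset.sum_congr rfl fun r _ => ?_
  have h : (v ᵥ* S.form R) ᵥ* X = -((X *ᵥ v) ᵥ* S.form R) := by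
    rw [vecMul_vecMul, ← vecMul_transpose, vecMul_vecMul, hX.2, vecMul_neg, neg_neg]
  rw [mul_assoc, ← hX.1, ← mul_assoc, mul_assoc _ _ X, vecMulVec_mul, h, vecMulVec_neg, mul_neg,
    neg_mul]

lemma eps_mul_eps (c : Fin S.blocks) (w v a b : n → R) :
    S.eps R c w v * S.eps R c a b = S.blockForm R c v a • S.eps R c w b := by
  rw [eps, eps, eps, Finset.sum_mul_sum, Finset.smul_sum]
  refine Finset.sum_congr rfl fun r _ => ?_
  rw [Finset.sum_eq_single r]
  · calc _ = S.unit R c r (S.base c) * (vecMulVec w (v ᵥ* S.form R) *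
          ((S.unit R c (S.base c) r * S.unit R c r (S.base c)) *
            vecMulVec a (b ᵥ* S.form R))) * S.unit R c (S.base c) r := by simp only [mul_assoc]
      _ = _ := by
        rw [unit_mul_same, mul_vecMulVec, vecMulVec_mul_vecMulVec, blockForm_apply,
          dotProduct_mulVec v, vecMulVec_smul, mul_smul_comm, smul_mul_assoc]
  · intro s _ hs
    rw [mul_assoc, ← mul_assoc (S.unit R c (S.base c) r), ← mul_assoc (S.unit R c (S.base c) r),
      unit_mul, if_neg hs.symm]
    simp
  · simp

lemma eps_mul_eps_ne {c d : Fin S.blocks} (h : c ≠ d) (w v a b : n → R) :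
    S.eps R c w v * S.eps R d a b = 0 := by
  rw [eps, eps, Finset.sum_mul_sum]
  refine Finset.sum_eq_zero fun r _ => Finset.sum_eq_zero fun s _ => ?_
  rw [mul_assoc, ← mul_assoc (S.unit R c (S.base c) r), ← mul_assoc (S.unit R c (S.base c) r),
    S.unit_mul_ne R h]
  simp

lemma unit_mul_eps (c : Fin S.blocks) (p) (w v : n → R) :
    S.unit R c (S.base c) p * S.eps R c w v =
      S.unit R c (S.base c) (S.base c) * vecMulVec w (v ᵥ* S.form R) * S.unit R c (S.base c) p := by
  rw [eps, Finset.mul_sum, Finset.sum_eq_single p]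
  · rw [← mul_assoc, ← mul_assoc, unit_mul_same]
  · intro s _ hs
    rw [← mul_assoc, ← mul_assoc, unit_mul, if_neg hs.symm]
    simp
  · simp

lemma unit_mulVec_eps_mulVec (c : Fin S.blocks) (p) (w v y : n → R) :
    S.unit R c (S.base c) p *ᵥ (S.eps R c w v *ᵥ y) =
      (v ⬝ᵥ (S.form R *ᵥ (S.unit R c (S.base c) p *ᵥ y))) •
        (S.unit R c (S.base c) (S.base c) *ᵥ w) := by
  rw [mulVec_mulVec, unit_mul_eps, ← mulVec_mulVec, mul_vecMulVec, vecMulVec_mulVec,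
    ← dotProduct_mulVec, op_smul_eq_smul]

lemma eps_mulVec_eq_zero (c : Fin S.blocks) (w v y : n → R)
    (h : ∀ r, v ⬝ᵥ (S.form R *ᵥ (S.unit R c (S.base c) r *ᵥ y)) = 0) :
    S.eps R c w v *ᵥ y = 0 := by
  rw [eps, sum_mulVec]
  refine Finset.sum_eq_zero fun r _ => ?_
  rw [mul_assoc, ← mulVec_mulVec, ← mulVec_mulVec, vecMulVec_mulVec, ← dotProduct_mulVec, h]
  simp

lemma unit_mul_eps_ne {c d : Fin S.blocks} (h : c ≠ d) (p q) (w v : n → R) :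
    S.unit R c p q * S.eps R d w v = 0 := by
  rw [eps, Finset.mul_sum]
  exact Finset.sum_eq_zero fun r _ => by
    rw [← mul_assoc, ← mul_assoc, S.unit_mul_ne R h]; simp

lemma blockForm_eps (c : Fin S.blocks) (w v y z : n → R) :
    S.blockForm R c z (S.eps R c w v *ᵥ y) = S.blockForm R c v y * S.blockForm R c z w := by
  rw [blockForm_apply, unit_mulVec_eps_mulVec, mulVec_smul, dotProduct_smul, ← blockForm_apply,
    ← blockForm_apply, smul_eq_mul]

lemma blockForm_eps_ne {c d : Fin S.blocks} (h : c ≠ d) (w v y z : n → R) :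
    S.blockForm R c z (S.eps R d w v *ᵥ y) = 0 := by
  rw [blockForm_apply, mulVec_mulVec _ _ (S.eps R d w v), S.unit_mul_eps_ne h]
  simp

lemma eps_eq_zero_left {c : Fin S.blocks} {w : n → R}
    (h : S.unit R c (S.base c) (S.base c) *ᵥ w = 0) (v : n → R) : S.eps R c w v = 0 := by
  refine Finset.sum_eq_zero fun r _ => ?_
  rw [← S.unit_mul_same R c r (S.base c) (S.base c), mul_assoc _ _ (vecMulVec _ _),
    mul_vecMulVec, h]
  simp

variable (R) in
/-- `eps` as a bilinear map. -/
def epsBilin (c : Fin S.blocks) : (n → R) →ₗ[R] (n → R) →ₗ[R] Matrix n n R :=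
  LinearMap.mk₂ R (S.eps R c)
    (fun a b v => by
      simp only [eps, add_vecMulVec, mul_add, add_mul, Finset.sum_add_distrib])
    (fun r a v => by
      simp only [eps, smul_vecMulVec, mul_smul_comm, smul_mul_assoc, Finset.smul_sum])
    (fun a v w => by
      simp only [eps, add_vecMul, vecMulVec_add, mul_add, add_mul, Finset.sum_add_distrib])
    (fun r a v => by
      simp only [eps, smul_vecMul, vecMulVec_smul, mul_smul_comm, smul_mul_assoc,
        Finset.smul_sum])

variable (R) in
/-- The symmetrized rank one operators, the analogues of `y ↦ ⟨v, y⟩ w + ⟨w, y⟩ v`. They lie in the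
Lie algebra. -/
def symOp (c : Fin S.blocks) : (n → R) →ₗ[R] (n → R) →ₗ[R] Matrix n n R :=
  S.epsBilin R c + (S.epsBilin R c).flip

lemma symOp_apply (c : Fin S.blocks) (w v : n → R) :
    S.symOp R c w v = S.eps R c w v + S.eps R c v w := rfl

lemma symOp_self (c : Fin S.blocks) (w : n → R) :
    S.symOp R c w w = (2 : ℝ) • S.eps R c w w := by rw [symOp_apply, two_smul]

lemma symOp_eq (c : Fin S.blocks) (w u : n → R) :
    S.symOp R c w u = S.eps R c (w + u) (w + u) - S.eps R c w w - S.eps R c u u := by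
  change S.epsBilin R c w u + S.epsBilin R c u w = S.epsBilin R c (w + u) (w + u) -
    S.epsBilin R c w w - S.epsBilin R c u u
  simp only [map_add, LinearMap.add_apply]
  abel

lemma eps_self_mem_skew (c : Fin S.blocks) (w : n → R) : S.eps R c w w ∈ S.skew R :=
  ⟨S.eps_commutes c w w, S.eps_transpose c w w⟩

lemma symOp_eps_mulVec (c : Fin S.blocks) (z y a : n → R) :
    S.symOp R c (S.eps R c z z *ᵥ y) a = S.blockForm R c z y • S.symOp R c z a := by
  have h := S.eps_mul (S.eps_self_mem_skew c z) c a y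
  rw [symOp_apply, ← S.mul_eps (S.eps_commutes c z z), eps_mul_eps, ← neg_eq_iff_eq_neg.mpr h,
    eps_mul_eps, S.blockForm_swap c y z, symOp_apply, smul_add, neg_smul, neg_neg]

lemma symOp_eps_mulVec_ne {c d : Fin S.blocks} (h : d ≠ c) (z y a : n → R) :
    S.symOp R c (S.eps R d z z *ᵥ y) a = 0 := by
  have h' := S.eps_mul (S.eps_self_mem_skew d z) c a y
  rw [symOp_apply, ← S.mul_eps (S.eps_commutes d z z), S.eps_mul_eps_ne h,
    ← neg_eq_iff_eq_neg.mpr h', S.eps_mul_eps_ne h.symm, neg_zero, add_zero]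

lemma symOp_mem_skew (c : Fin S.blocks) (w v : n → R) : S.symOp R c w v ∈ S.skew R := by
  refine ⟨fun d p q => ?_, ?_⟩
  · rw [symOp_apply, add_mul, mul_add, S.eps_commutes, S.eps_commutes]
  · rw [symOp_apply, transpose_add, add_mul, eps_transpose, eps_transpose, mul_add]
    abel

lemma eps_self_mul_self (c : Fin S.blocks) (w : n → R) :
    S.eps R c w w * S.eps R c w w = 0 := by
  rw [eps_mul_eps, S.blockForm_isAlt c w, zero_smul]

/-- The Lie algebra is spanned by the operators `eps c w w`. -/
lemma mem_span_eps {X : Matrix n n R} (hX : X ∈ S.skew R) :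
    X ∈ Submodule.span R {Y | ∃ c w, Y = S.eps R c w w} := by
  -- the columns `X e_a` and the dual basis `v` of the standard basis for the form give two
  -- expressions for `X`, the second one by taking adjoints; their mean is symmetrized
  set v : n → n → R := fun a => Pi.single a 1 ᵥ* (S.form R)⁻¹ with hv
  have hv' (a) : v a ᵥ* S.form R = Pi.single a 1 := by
    rw [hv, vecMul_vecMul, nonsing_inv_mul _ (S.form_det R), vecMul_one]
  have h1 : X = ∑ c, ∑ a, S.eps R c (X *ᵥ Pi.single a 1) (v a) := by
    have e : ∑ a : n, vecMulVec (X *ᵥ Pi.single a (1 : R)) (Pi.single a 1) = X := by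
      ext i j
      simp [Matrix.sum_apply, vecMulVec_apply, Pi.single_apply]
    simp only [eps, hv']
    have h0 (c) : ∑ a, ∑ r, S.unit R c r (S.base c) *
        vecMulVec (X *ᵥ Pi.single a 1) (Pi.single a 1) * S.unit R c (S.base c) r =
        X * ∑ r, S.unit R c r r := by
      rw [Finset.sum_comm, Finset.mul_sum]
      refine Finset.sum_congr rfl fun r _ => ?_
      rw [← Finset.sum_mul, ← Finset.mul_sum, e, ← hX.1, mul_assoc, unit_mul_same]
    simp only [h0]
    rw [← Finset.mul_sum, unit_sum, mul_one]
  have h2 : X = ∑ c, ∑ a, S.eps R c (v a) (X *ᵥ Pi.single a 1) := by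
    have e : S.form R * X = S.form R * ∑ c, ∑ a, S.eps R c (v a) (X *ᵥ Pi.single a 1) := by
      rw [← neg_inj, ← hX.2]
      conv_lhs => rw [h1]
      simp only [transpose_sum, Finset.sum_mul, eps_transpose, Finset.mul_sum,
        Finset.sum_neg_distrib]
    have := congrArg ((S.form R)⁻¹ * ·) e
    simpa only [← mul_assoc, nonsing_inv_mul _ (S.form_det R), one_mul] using this
  have h3 (c w u) : S.symOp R c w u ∈ Submodule.span R {Y | ∃ c w, Y = S.eps R c w w} := by
    rw [symOp_eq]
    exact sub_mem (sub_mem (Submodule.subset_span ⟨c, _, rfl⟩) (Submodule.subset_span ⟨c, _, rfl⟩))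
      (Submodule.subset_span ⟨c, _, rfl⟩)
  have h4 : X = algebraMap ℝ R (1 / 2) • ∑ c, ∑ a, S.symOp R c (X *ᵥ Pi.single a 1) (v a) := by
    simp only [symOp_apply, Finset.sum_add_distrib]
    rw [← h1, ← h2, ← two_smul R X, smul_smul, ← map_ofNat (algebraMap ℝ R) 2, ← map_mul]
    norm_num
  rw [h4]
  exact Submodule.smul_mem _ _ (sum_mem fun c _ => sum_mem fun a _ => h3 _ _ _)

/-- A linear property of matrices holds on the Lie algebra if it holds for the `eps c w w`. -/
lemma skew_le {p : Submodule R (Matrix n n R)} (h : ∀ c w, S.eps R c w w ∈ p) : S.skew R ≤ p :=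
  fun _ hX => Submodule.span_le.mpr (by rintro _ ⟨c, w, rfl⟩; exact h c w) (S.mem_span_eps hX)

end RealModel
end PEL

/-! ### Intertwiners of the Lie algebra -/

namespace PEL

open Matrix

namespace RealModel

variable {n : Type} [Fintype n] [DecidableEq n] (S : RealModel n)
variable {m : Type} [Fintype m] [DecidableEq m]

/-- A complex structure in the Lie algebra which is positive for the form. -/
structure IsPositive (J : Matrix n n ℝ) : Prop where
  mem : J ∈ S.skew ℝ
  sq : J * J = -1
  pos : ∀ v, v ≠ 0 → 0 < v ⬝ᵥ (S.form ℝ *ᵥ (J *ᵥ v))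

/-- A linear map on matrices which restricts to a representation of the Lie algebra `skew`. -/
def IsLieRep (ρ : Matrix n n ℝ →ₗ[ℝ] Matrix m m ℝ) : Prop :=
  ∀ X ∈ S.skew ℝ, ∀ Y ∈ S.skew ℝ, ρ (X * Y - Y * X) = ρ X * ρ Y - ρ Y * ρ X

variable {S} {J : Matrix n n ℝ} {ρ : Matrix n n ℝ →ₗ[ℝ] Matrix m m ℝ}

lemma IsPositive.blockForm_pos (hJ : S.IsPositive J) {c : Fin S.blocks} {w : n → ℝ}
    (hw : S.unit ℝ c (S.base c) (S.base c) *ᵥ w ≠ 0) : 0 < S.blockForm ℝ c w (J *ᵥ w) := by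
  rw [blockForm_eq, S.unit_mulVec_mulVec hJ.mem.1]
  exact hJ.pos _ hw

lemma IsPositive.blockForm_symm (hJ : S.IsPositive J) (c : Fin S.blocks) (v w : n → ℝ) :
    S.blockForm ℝ c v (J *ᵥ w) = S.blockForm ℝ c w (J *ᵥ v) := by
  rw [blockForm_eq, blockForm_eq, S.unit_mulVec_mulVec hJ.mem.1, S.unit_mulVec_mulVec hJ.mem.1,
    S.form_mulVec_skew hJ.mem]

/-- The operators `ρ (x J x)` for `x² = 0` have square zero; hence so do the `ρ (eps c w w)`. -/
lemma rho_eps_sq (hJ : S.IsPositive J)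
    (hsq : ∀ x ∈ S.skew ℝ, x * x = 0 → ρ (x * J * x) * ρ (x * J * x) = 0) (c) (w : n → ℝ) :
    ρ (S.eps ℝ c w w) * ρ (S.eps ℝ c w w) = 0 := by
  by_cases hw : S.unit ℝ c (S.base c) (S.base c) *ᵥ w = 0
  · rw [S.eps_eq_zero_left hw]; simp
  · have h := hsq _ (S.eps_self_mem_skew c w) (S.eps_self_mul_self c w)
    rw [mul_assoc, S.mul_eps hJ.mem.1, eps_mul_eps] at h
    simp only [map_smul, smul_mul_assoc, mul_smul_comm, smul_smul, smul_eq_zero] at h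
    have := (hJ.blockForm_pos hw).ne'
    simpa [this] using h

/-- If `x = eps c w w` and `y = eps d v v` are orthogonal, also for the Hermitian form of `J`, then
the quadratic relation for `x + y` gives `ρ x * ρ y = 0`. -/
lemma rho_eps_mul_eq_zero (hJ : S.IsPositive J) (hρ : S.IsLieRep ρ)
    (hsq : ∀ x ∈ S.skew ℝ, x * x = 0 → ρ (x * J * x) * ρ (x * J * x) = 0) {c d} {w v : n → ℝ}
    (h1 : S.eps ℝ c w w * S.eps ℝ d v v = 0) (h2 : S.eps ℝ d v v * S.eps ℝ c w w = 0)
    (h3 : S.eps ℝ c w w * J * S.eps ℝ d v v = 0) (h4 : S.eps ℝ d v v * J * S.eps ℝ c w w = 0) :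
    ρ (S.eps ℝ c w w) * ρ (S.eps ℝ d v v) = 0 := by
  by_cases hw : S.unit ℝ c (S.base c) (S.base c) *ᵥ w = 0
  · rw [S.eps_eq_zero_left hw]; simp
  by_cases hv : S.unit ℝ d (S.base d) (S.base d) *ᵥ v = 0
  · rw [S.eps_eq_zero_left hv]; simp
  have hx := S.eps_self_mem_skew c w
  have hy := S.eps_self_mem_skew d v
  have h := hsq (S.eps ℝ c w w + S.eps ℝ d v v) (add_mem hx hy) (by
    rw [add_mul, mul_add, mul_add, h1, h2, eps_self_mul_self, eps_self_mul_self]; simp)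
  have e1 : S.eps ℝ c w w * J * S.eps ℝ c w w = S.blockForm ℝ c w (J *ᵥ w) • S.eps ℝ c w w := by
    rw [mul_assoc, S.mul_eps hJ.mem.1, eps_mul_eps]
  have e2 : S.eps ℝ d v v * J * S.eps ℝ d v v = S.blockForm ℝ d v (J *ᵥ v) • S.eps ℝ d v v := by
    rw [mul_assoc, S.mul_eps hJ.mem.1, eps_mul_eps]
  simp only [add_mul, mul_add, h3, h4, e1, e2, add_zero, zero_add, map_add, map_smul,
    smul_mul_assoc, mul_smul_comm, rho_eps_sq hJ hsq, smul_zero] at h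
  have hc := hρ _ hx _ hy
  rw [h1, h2, sub_zero, map_zero] at hc
  rw [← sub_eq_zero.mp hc.symm, smul_smul, smul_smul, mul_comm, ← two_smul ℝ, smul_smul,
    smul_eq_zero] at h
  refine h.resolve_left (mul_ne_zero two_ne_zero (mul_ne_zero ?_ ?_))
  · exact (hJ.blockForm_pos hv).ne'
  · exact (hJ.blockForm_pos hw).ne'

/-- The bracket of `𝔰𝔭 = Sym²` in the representation `ρ`. -/
lemma bracketRel_rho_symOp (hρ : S.IsLieRep ρ) (c) :
    BracketRel (S.blockForm ℝ c) ((S.symOp ℝ c).compr₂ ρ) := by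
  intro z w u
  simp only [LinearMap.compr₂_apply]
  rw [← hρ _ (S.symOp_mem_skew c z z) _ (S.symOp_mem_skew c w u), ← ρ.map_smul, ← ρ.map_smul,
    ← ρ.map_add]
  congr 1
  rw [symOp_self, symOp_apply, symOp_apply, symOp_apply]
  simp only [mul_add, add_mul, smul_mul_assoc, mul_smul_comm, eps_mul_eps]
  rw [S.blockForm_swap c u z, S.blockForm_swap c w z]
  module

/-- The operators attached to orthogonal vectors annihilate each other. -/
lemma rho_symOp_mul_eq_zero (hJ : S.IsPositive J) (hρ : S.IsLieRep ρ)
    (hsq : ∀ x ∈ S.skew ℝ, x * x = 0 → ρ (x * J * x) * ρ (x * J * x) = 0) (c) (z v : n → ℝ)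
    (h : S.blockForm ℝ c z v = 0) : ρ (S.symOp ℝ c z z) * ρ (S.symOp ℝ c v v) = 0 := by
  by_cases hz : S.unit ℝ c (S.base c) (S.base c) *ᵥ z = 0
  · rw [symOp_self, S.eps_eq_zero_left hz]; simp
  have hN (z : n → ℝ) : (S.symOp ℝ c).compr₂ ρ z z * (S.symOp ℝ c).compr₂ ρ z z = 0 := by
    simp [symOp_self, rho_eps_sq hJ hsq]
  have hs (a b : n → ℝ) : (S.symOp ℝ c).compr₂ ρ a b = (S.symOp ℝ c).compr₂ ρ b a := by
    simp [symOp_apply, add_comm]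
  -- subtracting a multiple of `z` makes `v` orthogonal to `z` for the Hermitian form of `J`
  set α := S.blockForm ℝ c z (J *ᵥ v) / S.blockForm ℝ c z (J *ᵥ z) with hα
  set v' := v - α • z with hv'
  have hz' : S.blockForm ℝ c z v' = 0 := by
    rw [hv', map_sub, map_smul, h, S.blockForm_isAlt c z]; simp
  have hzJ : S.blockForm ℝ c z (J *ᵥ v') = 0 := by
    rw [hv', mulVec_sub, mulVec_smul, map_sub, map_smul, hα, smul_eq_mul,
      div_mul_cancel₀ _ (hJ.blockForm_pos hz).ne', sub_self]
  have hv : v = v' + α • z := by rw [hv']; simp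
  have h1 : ρ (S.symOp ℝ c z z) * ρ (S.symOp ℝ c v' v') = 0 := by
    rw [symOp_self, symOp_self, map_smul, map_smul, smul_mul_assoc, mul_smul_comm,
      rho_eps_mul_eq_zero hJ hρ hsq, smul_zero, smul_zero]
    · rw [eps_mul_eps, hz', zero_smul]
    · rw [eps_mul_eps, S.blockForm_swap, hz', neg_zero, zero_smul]
    · rw [mul_assoc, S.mul_eps hJ.mem.1, eps_mul_eps, hzJ, zero_smul]
    · rw [mul_assoc, S.mul_eps hJ.mem.1, eps_mul_eps, hJ.blockForm_symm, hzJ, zero_smul]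
  have h2 := mul_polar hN hs (S.blockForm_isAlt c) (bracketRel_rho_symOp hρ c) z v'
  have h3 := hN z
  have h4 := hs v' z
  simp only [LinearMap.compr₂_apply, hz', zero_smul] at h2 h3 h4
  rw [hv]
  simp only [map_add, map_smul, LinearMap.add_apply, LinearMap.smul_apply, mul_add, mul_smul_comm,
    h1, h4, h2, h3, smul_zero, add_zero]

/-- If a representation of the Lie algebra satisfies the quadratic relations `ρ (x J x) ^ 2 = 0` and
`ρ J` is a complex structure, then the images of the intertwiners from the standard representation
span: a linear form `l` vanishing on them is zero. Indeed these images contain the images of all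
`ρ X`, in particular that of `ρ J`. -/
theorem eq_zero_of_forall_intertwiner (hJ : S.IsPositive J) (hρ : S.IsLieRep ρ)
    (hsq : ∀ x ∈ S.skew ℝ, x * x = 0 → ρ (x * J * x) * ρ (x * J * x) = 0)
    (hK : ρ J * ρ J = -1) (l : m → ℝ)
    (hl : ∀ T : Matrix m n ℝ, (∀ X ∈ S.skew ℝ, T * X = ρ X * T) → l ᵥ* T = 0) : l = 0 := by
  have key (c) (u' : n → ℝ) : l ᵥ* ρ (S.eps ℝ c u' u') = 0 := by
    by_cases hu : ∃ u, S.blockForm ℝ c u u' ≠ 0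
    swap
    · push Not at hu
      have : S.unit ℝ c (S.base c) (S.base c) *ᵥ u' = 0 := by
        by_contra h
        exact (hJ.blockForm_pos h).ne' (by
          rw [S.blockForm_swap, hu, neg_zero])
      rw [S.eps_eq_zero_left this]; simp
    obtain ⟨u, hu⟩ := hu
    set N := (S.symOp ℝ c).compr₂ ρ with hN
    set a := (S.blockForm ℝ c u u')⁻¹ • u with ha
    have hau : S.blockForm ℝ c a u' = 1 := by simp [ha, hu]
    have hs (a b : n → ℝ) : N a b = N b a := by
      simp [N, symOp_apply, add_comm]
    have h0 := fun z v => rho_symOp_mul_eq_zero hJ hρ hsq c z v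
    have hb := bracketRel_rho_symOp hρ c
    have hmul := mul_rankOneOp (N := N) hs (S.blockForm_isAlt c) hb h0 hau
    have hself := rankOneOp_self (N := N) hs (S.blockForm_isAlt c) hb h0 hau
    have hNz (z : n → ℝ) : N z z = (2 : ℝ) • ρ (S.eps ℝ c z z) := by
      simp [N, symOp_self]
    set F := rankOneOp (S.blockForm ℝ c) N a u' with hF
    -- the intertwiner attached to `u'` and a column vector `x`
    have hT (x : m → ℝ) : l ⬝ᵥ (F u' *ᵥ x) = 0 := by
      let τ : (n → ℝ) →ₗ[ℝ] (m → ℝ) := (Matrix.mulVecBilin ℝ ℝ).flip x ∘ₗ F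
      have hτ (y) : τ y = F y *ᵥ x := rfl
      have h := hl (LinearMap.toMatrix' τ) ?_
      · have := congrArg (· ⬝ᵥ u') h
        simpa [← dotProduct_mulVec, ← toLin'_apply, hτ] using this
      let p : Submodule ℝ (Matrix n n ℝ) :=
        LinearMap.ker (mulLeftLinearMap n ℝ (LinearMap.toMatrix' τ) -
          mulRightLinearMap m ℝ (LinearMap.toMatrix' τ) ∘ₗ ρ)
      have hp (X) : X ∈ p ↔ LinearMap.toMatrix' τ * X = ρ X * LinearMap.toMatrix' τ := by
        simp [p, sub_eq_zero]
      intro X hX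
      rw [← hp]
      refine S.skew_le (p := p) (fun d z => ?_) hX
      rw [hp]
      apply Matrix.toLin'.injective
      refine LinearMap.ext fun y => ?_
      suffices h : F (S.eps ℝ d z z *ᵥ y) = ρ (S.eps ℝ d z z) * F y by
        rw [toLin'_mul, toLin'_mul, toLin'_toMatrix']
        change F (S.eps ℝ d z z *ᵥ y) *ᵥ x = ρ (S.eps ℝ d z z) *ᵥ (F y *ᵥ x)
        rw [h, mulVec_mulVec]
      by_cases hd : d = c
      · subst hd
        have h1 : F (S.eps ℝ d z z *ᵥ y) = S.blockForm ℝ d z y • F z := by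
          have e : N (S.eps ℝ d z z *ᵥ y) a = S.blockForm ℝ d z y • N z a := by
            simp [N, symOp_eps_mulVec]
          rw [hF, rankOneOp_apply, rankOneOp_apply, e, S.blockForm_swap d _ u', blockForm_eps,
            S.blockForm_swap d u' z, smul_comm, mul_neg, neg_neg, mul_smul, ← smul_sub,
            smul_mul_assoc]
        have h2 := hmul z y
        rw [hNz, smul_mul_assoc, mul_smul] at h2
        rw [h1, smul_right_injective _ (two_ne_zero (α := ℝ)) h2]
      · have e (w u) : ρ (S.eps ℝ d z z) * N w u = 0 := by
          have h (v) : ρ (S.eps ℝ d z z) * ρ (S.eps ℝ c v v) = 0 :=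
            rho_eps_mul_eq_zero hJ hρ hsq (S.eps_mul_eps_ne hd _ _ _ _)
              (S.eps_mul_eps_ne (Ne.symm hd) _ _ _ _)
              (by rw [mul_assoc, S.mul_eps hJ.mem.1, S.eps_mul_eps_ne hd])
              (by rw [mul_assoc, S.mul_eps hJ.mem.1, S.eps_mul_eps_ne (Ne.symm hd)])
          simp [N, symOp_eq, mul_sub, h]
        have e' : N (S.eps ℝ d z z *ᵥ y) a = 0 := by
          simp [N, S.symOp_eps_mulVec_ne hd]
        rw [hF, rankOneOp_apply, rankOneOp_apply, e', S.blockForm_swap c _ u',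
          S.blockForm_eps_ne (Ne.symm hd), ← mul_assoc, mul_sub, mul_smul_comm, mul_smul_comm, e, e]
        simp
    ext j
    have h := hT (Pi.single j 1)
    rw [hself, hNz, smul_smul, smul_mulVec, dotProduct_smul, dotProduct_mulVec] at h
    simpa using h
  let p : Submodule ℝ (Matrix n n ℝ) := LinearMap.ker (Matrix.vecMulBilin ℝ ℝ l ∘ₗ ρ)
  have hp (X) : X ∈ p ↔ l ᵥ* ρ X = 0 := Iff.rfl
  have h1 : l ᵥ* ρ J = 0 := S.skew_le (p := p) (fun c w => key c w) hJ.mem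
  have h2 : l ᵥ* (ρ J * ρ J) = 0 := by rw [← vecMul_vecMul, h1, zero_vecMul]
  rw [hK, vecMul_neg, vecMul_one] at h2
  exact neg_eq_zero.mp h2

end RealModel
end PEL

/-! ### Differentials of representations of the similitude group -/

namespace PEL

open Matrix

section ToAlg

variable {a b c : Type} (R : Type) [CommRing R] [Algebra ℝ R] {R' : Type} [CommRing R']
  [Algebra ℝ R']

/-- A real matrix, regarded as a matrix over the real algebra `R`. -/
def toAlg (M : Matrix a b ℝ) : Matrix a b R := M.map (algebraMap ℝ R)

variable {R}

lemma toAlg_map (M : Matrix a b ℝ) (φ : R →ₐ[ℝ] R') : (toAlg R M).map φ = toAlg R' M := by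
  ext i j; simp [toAlg]

lemma toAlg_real (M : Matrix a b ℝ) : toAlg ℝ M = M := by
  ext i j; simp [toAlg]

lemma toAlg_mul [Fintype b] (M : Matrix a b ℝ) (N : Matrix b c ℝ) :
    toAlg R (M * N) = toAlg R M * toAlg R N := Matrix.map_mul

lemma toAlg_add (M N : Matrix a b ℝ) : toAlg R (M + N) = toAlg R M + toAlg R N := by
  ext i j; simp [toAlg]

lemma toAlg_sub (M N : Matrix a b ℝ) : toAlg R (M - N) = toAlg R M - toAlg R N := by
  ext i j; simp [toAlg]

lemma toAlg_smul (r : ℝ) (M : Matrix a b ℝ) : toAlg R (r • M) = algebraMap ℝ R r • toAlg R M := by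
  ext i j; simp [toAlg]

lemma toAlg_one [DecidableEq a] : toAlg R (1 : Matrix a a ℝ) = 1 :=
  Matrix.map_one _ (map_zero _) (map_one _)

lemma toAlg_neg (M : Matrix a b ℝ) : toAlg R (-M) = -toAlg R M := by
  ext i j; simp [toAlg]

end ToAlg

namespace RealModel

variable {n : Type} [Fintype n] [DecidableEq n] (S : RealModel n)
variable (m : Type) [Fintype m] [DecidableEq m]

lemma toAlg_mem_skew {S : RealModel n} {R : Type} [CommRing R] [Algebra ℝ R] {X : Matrix n n ℝ}
    (hX : X ∈ S.skew ℝ) : toAlg R X ∈ S.skew R :=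
  S.map_mem_skew hX (Algebra.ofId ℝ R)

/-- A matrix representation, functorial in real algebras, of the group of similitudes commuting
with the matrix units. It is encoded by its graph: `rel R g k` says that `g` acts by `k`. (A
relation needs no choice of a structure of `ℚ`-algebra on `R`, in contrast to a function on the
points of an algebraic group over `ℚ`.) -/
structure RepGraph where
  rel : ∀ (R : Type) [CommRing R] [Algebra ℝ R], Matrix n n R → Matrix m m R → Prop
  exists_rel : ∀ {R : Type} [CommRing R] [Algebra ℝ R] {μ : R} {g : Matrix n n R},
    S.IsSimilitude R μ g → IsUnit μ → ∃ k, rel R g k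
  isSimilitude : ∀ {R : Type} [CommRing R] [Algebra ℝ R] {g : Matrix n n R} {k : Matrix m m R},
    rel R g k → ∃ μ, IsUnit μ ∧ S.IsSimilitude R μ g
  unique : ∀ {R : Type} [CommRing R] [Algebra ℝ R] {g : Matrix n n R} {k k' : Matrix m m R},
    rel R g k → rel R g k' → k = k'
  one : ∀ {R : Type} [CommRing R] [Algebra ℝ R], rel R 1 1
  mul : ∀ {R : Type} [CommRing R] [Algebra ℝ R] {g g' : Matrix n n R} {k k' : Matrix m m R},
    rel R g k → rel R g' k' → rel R (g * g') (k * k')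
  map : ∀ {R R' : Type} [CommRing R] [Algebra ℝ R] [CommRing R'] [Algebra ℝ R'] (φ : R →ₐ[ℝ] R')
    {g : Matrix n n R} {k : Matrix m m R}, rel R g k → rel R' (g.map φ) (k.map φ)

namespace RepGraph

variable {S m} (F : S.RepGraph m)

lemma exists_inv {R : Type} [CommRing R] [Algebra ℝ R] {g : Matrix n n R} {k : Matrix m m R}
    (h : F.rel R g k) : ∃ g' k', F.rel R g' k' ∧ g * g' = 1 ∧ k * k' = 1 := by
  obtain ⟨μ, hμ, hg⟩ := F.isSimilitude h
  obtain ⟨ν, hν⟩ := hμ.exists_left_inv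
  have hgg := mul_nonsing_inv g (hg.isUnit_det S hμ)
  obtain ⟨k', hk'⟩ := F.exists_rel (hg.inv S hgg hν) (IsUnit.of_mul_eq_one _ hν)
  refine ⟨_, k', hk', hgg, ?_⟩
  have := F.mul h hk'
  rw [hgg] at this
  exact F.unique this F.one

/-- `Y` is the differential of the representation at `X`. -/
def HasDiff (X : Matrix n n ℝ) (Y : Matrix m m ℝ) : Prop :=
  F.rel (DualNumber ℝ) (1 + (DualNumber.eps : DualNumber ℝ) • toAlg _ X)
    (1 + (DualNumber.eps : DualNumber ℝ) • toAlg _ Y)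

lemma one_add_smul_map {a : Type} [DecidableEq a] {R R' : Type} [CommRing R] [Algebra ℝ R]
    [CommRing R'] [Algebra ℝ R']
    (φ : R →ₐ[ℝ] R') (x : R) (X : Matrix a a ℝ) :
    (1 + x • toAlg R X).map φ = 1 + φ x • toAlg R' X := by
  ext i j
  simp [toAlg, Matrix.one_apply, apply_ite]

lemma HasDiff.rel {F : S.RepGraph m} {X : Matrix n n ℝ} {Y : Matrix m m ℝ} (h : F.HasDiff X Y)
    {R : Type} [CommRing R] [Algebra ℝ R] {x : R} (hx : x * x = 0) :
    F.rel R (1 + x • toAlg R X) (1 + x • toAlg R Y) := by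
  let φ : DualNumber ℝ →ₐ[ℝ] R :=
    DualNumber.lift ⟨(Algebra.ofId ℝ R, x), hx, fun _ => Commute.all _ _⟩
  have hφ : φ DualNumber.eps = x := by simp [φ]
  have := F.map φ h
  rwa [one_add_smul_map, one_add_smul_map, hφ] at this

lemma fst_algebraMap_dualNumber {R : Type} [CommRing R] [Algebra ℝ R] (r : ℝ) :
    TrivSqZeroExt.fst (algebraMap ℝ (DualNumber R) r) = algebraMap ℝ R r := rfl

lemma eps_smul_injective {a b : Type} {M N : Matrix a b ℝ}
    (h : (DualNumber.eps : DualNumber ℝ) • toAlg (DualNumber ℝ) M =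
      (DualNumber.eps : DualNumber ℝ) • toAlg _ N) : M = N := by
  ext i j
  have := congrArg TrivSqZeroExt.snd (congrFun (congrFun h i) j)
  simpa [toAlg, fst_algebraMap_dualNumber] using this

lemma exists_hasDiff {X : Matrix n n ℝ} (hX : X ∈ S.skew ℝ) : ∃ Y, F.HasDiff X Y := by
  obtain ⟨k, hk⟩ := F.exists_rel (S.isSimilitude_one_add (R := DualNumber ℝ)
    DualNumber.eps_mul_eps (toAlg_mem_skew hX)) isUnit_one
  refine ⟨k.map TrivSqZeroExt.snd, ?_⟩
  have h1 := F.map (TrivSqZeroExt.fstHom ℝ ℝ ℝ) hk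
  rw [one_add_smul_map] at h1
  simp only [TrivSqZeroExt.fstHom_apply, DualNumber.fst_eps, zero_smul, add_zero] at h1
  have h2 := F.unique h1 F.one
  unfold HasDiff
  convert hk using 1
  ext i j
  · have := congrFun (congrFun h2 i) j
    simp only [map_apply, TrivSqZeroExt.fstHom_apply] at this
    simp [toAlg, this, Matrix.one_apply, apply_ite]
  · simp [toAlg, Matrix.one_apply, apply_ite, fst_algebraMap_dualNumber]

lemma HasDiff.unique {F : S.RepGraph m} {X : Matrix n n ℝ} {Y Y' : Matrix m m ℝ}
    (h : F.HasDiff X Y) (h' : F.HasDiff X Y') : Y = Y' :=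
  eps_smul_injective (add_left_cancel (F.unique h h'))

lemma HasDiff.add {F : S.RepGraph m} {X X' : Matrix n n ℝ} {Y Y' : Matrix m m ℝ}
    (h : F.HasDiff X Y) (h' : F.HasDiff X' Y') : F.HasDiff (X + X') (Y + Y') := by
  have e {a : Type} [Fintype a] [DecidableEq a] (X X' : Matrix a a ℝ) :
      (1 + (DualNumber.eps : DualNumber ℝ) • toAlg (DualNumber ℝ) X) *
      (1 + (DualNumber.eps : DualNumber ℝ) • toAlg (DualNumber ℝ) X') =
      1 + (DualNumber.eps : DualNumber ℝ) • toAlg (DualNumber ℝ) (X + X') := by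
    simp only [mul_add, add_mul, smul_mul_assoc, mul_smul_comm, smul_smul,
      DualNumber.eps_mul_eps, toAlg_add, mul_one, one_mul, zero_smul, add_zero, smul_add, add_assoc]
  unfold HasDiff
  rw [← e, ← e]
  exact F.mul h h'

lemma HasDiff.smul {F : S.RepGraph m} {X : Matrix n n ℝ} {Y : Matrix m m ℝ}
    (h : F.HasDiff X Y) (r : ℝ) : F.HasDiff (r • X) (r • Y) := by
  have := h.rel (R := DualNumber ℝ) (x := DualNumber.eps * algebraMap ℝ _ r) (by
    rw [mul_mul_mul_comm, DualNumber.eps_mul_eps, zero_mul])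
  rw [mul_smul, mul_smul, ← toAlg_smul, ← toAlg_smul] at this
  exact this

lemma HasDiff.conj {F : S.RepGraph m} {X X' : Matrix n n ℝ} {Y Y' : Matrix m m ℝ}
    (h : F.HasDiff X Y) (h' : F.HasDiff X' Y') {g : Matrix n n ℝ} {k : Matrix m m ℝ}
    (hg : F.rel ℝ g k) (e : g * X = X' * g) : k * Y = Y' * k := by
  have hg' : F.rel (DualNumber ℝ) (toAlg _ g) (toAlg _ k) := F.map (Algebra.ofId ℝ _) hg
  have h1 := F.mul hg' h
  have h2 := F.mul h' hg'
  have e' : toAlg (DualNumber ℝ) g * (1 + (DualNumber.eps : DualNumber ℝ) • toAlg _ X) =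
      (1 + (DualNumber.eps : DualNumber ℝ) • toAlg _ X') * toAlg (DualNumber ℝ) g := by
    rw [mul_add, add_mul, mul_smul_comm, smul_mul_assoc, ← toAlg_mul, ← toAlg_mul, e, mul_one,
      one_mul]
  rw [e'] at h1
  have h3 := F.unique h1 h2
  rw [mul_add, add_mul, mul_smul_comm, smul_mul_assoc, ← toAlg_mul, ← toAlg_mul, mul_one,
      one_mul] at h3
  exact eps_smul_injective (add_left_cancel h3)

/-- The commutator of `1 + x X` and `1 + y X'` is `1 + x y [X, X']`, for `x² = y² = 0`. -/
lemma HasDiff.smul_lie {F : S.RepGraph m} {X X' : Matrix n n ℝ} {Y Y' Z : Matrix m m ℝ}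
    (h : F.HasDiff X Y) (h' : F.HasDiff X' Y') (h'' : F.HasDiff (X * X' - X' * X) Z)
    {D : Type} [CommRing D] [Algebra ℝ D] {x y : D} (hx : x * x = 0) (hy : y * y = 0) :
    (x * y) • toAlg D Z = (x * y) • toAlg D (Y * Y' - Y' * Y) := by
  have hxy : (x * y) * (x * y) = 0 := by rw [mul_mul_mul_comm, hx, zero_mul]
  have h1 : x * y * x = 0 := by rw [mul_comm x y, mul_assoc, hx, mul_zero]
  have h2 : x * y * y = 0 := by rw [mul_assoc, hy, mul_zero]
  have e {a : Type} [Fintype a] [DecidableEq a] (X X' Z : Matrix a a ℝ) :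
      (1 + y • toAlg D X') * (1 + x • toAlg D X) * (1 + (x * y) • toAlg D Z) =
      (1 + x • toAlg D X) * (1 + y • toAlg D X') +
        (x * y) • (toAlg D Z - toAlg D (X * X' - X' * X)) := by
    simp only [mul_add, add_mul, smul_mul_assoc, mul_smul_comm, toAlg_sub, toAlg_mul,
      mul_one, one_mul, smul_sub, mul_assoc]
    linear_combination (norm := module) h2 • (toAlg D X' * toAlg D Z) +
      h1 • (toAlg D X * toAlg D Z) + hxy • (toAlg D X' * (toAlg D X * toAlg D Z))
  have h3 := F.mul (F.mul (h'.rel hy) (h.rel hx)) (h''.rel hxy)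
  rw [e, sub_self, smul_zero, add_zero] at h3
  have h4 := F.unique h3 (F.mul (h.rel hx) (h'.rel hy))
  rwa [e, add_eq_left, smul_sub, sub_eq_zero] at h4

lemma HasDiff.lie {F : S.RepGraph m} {X X' : Matrix n n ℝ} {Y Y' Z : Matrix m m ℝ}
    (h : F.HasDiff X Y) (h' : F.HasDiff X' Y') (h'' : F.HasDiff (X * X' - X' * X) Z) :
    Z = Y * Y' - Y' * Y := by
  -- the product of the two infinitesimals `ε`, `ε'` of `ℝ[ε][ε']` detects the bracket
  have hx : (TrivSqZeroExt.inl DualNumber.eps * TrivSqZeroExt.inl DualNumber.eps :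
      DualNumber (DualNumber ℝ)) = 0 := by
    rw [← TrivSqZeroExt.inl_mul, DualNumber.eps_mul_eps, TrivSqZeroExt.inl_zero]
  have h1 := HasDiff.smul_lie (D := DualNumber (DualNumber ℝ)) h h' h'' hx DualNumber.eps_mul_eps
  ext i j
  have h4 := congrArg (fun z : DualNumber (DualNumber ℝ) => z.snd.snd)
    (congrFun (congrFun h1 i) j)
  simpa [toAlg, fst_algebraMap_dualNumber] using h4

/-- The differential of a representation: a representation of the Lie algebra. -/
lemma exists_differential : ∃ ρ : Matrix n n ℝ →ₗ[ℝ] Matrix m m ℝ,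
    S.IsLieRep ρ ∧ ∀ X ∈ S.skew ℝ, F.HasDiff X (ρ X) := by
  choose f hf using fun X : S.skew ℝ => F.exists_hasDiff X.2
  let f' : S.skew ℝ →ₗ[ℝ] Matrix m m ℝ :=
    { toFun := f
      map_add' := fun X Y => (hf _).unique ((hf X).add (hf Y))
      map_smul' := fun r X => (hf _).unique ((hf X).smul r) }
  obtain ⟨ρ, hρ⟩ := LinearMap.exists_extend f'
  have h (X) (hX : X ∈ S.skew ℝ) : F.HasDiff X (ρ X) := by
    have := LinearMap.congr_fun hρ ⟨X, hX⟩
    simp only [LinearMap.comp_apply, Submodule.subtype_apply] at this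
    rw [this]
    exact hf ⟨X, hX⟩
  exact ⟨ρ, fun X hX Y hY => (h X hX).lie (h Y hY) (h _ (S.lie_mem_skew hX hY)), h⟩

end RepGraph

section Family

/-- A complex structure in the Lie algebra gives similitudes `a + b J`. -/
lemma IsPositive.isSimilitude {S : RealModel n} {J : Matrix n n ℝ} (hJ : S.IsPositive J)
    {R : Type} [CommRing R] [Algebra ℝ R] (a b : R) :
    S.IsSimilitude R (a * a + b * b) (a • 1 + b • toAlg R J) := by
  have hm := toAlg_mem_skew (R := R) hJ.mem
  refine ⟨fun c p q => ?_, ?_⟩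
  · rw [add_mul, mul_add, smul_mul_assoc, smul_mul_assoc, mul_smul_comm, mul_smul_comm, hm.1,
      one_mul, mul_one]
  · have hsq : toAlg R J * toAlg R J = -1 := by rw [← toAlg_mul, hJ.sq, toAlg_neg, toAlg_one]
    rw [transpose_add, transpose_smul, transpose_smul, transpose_one, add_mul, smul_mul_assoc,
      smul_mul_assoc, hm.2, one_mul]
    simp only [mul_add, add_mul, smul_mul_assoc, mul_smul_comm, neg_mul, mul_assoc,
      hsq, mul_neg, mul_one, smul_neg]
    module

variable {S m} (F : S.RepGraph m) {J : Matrix n n ℝ} {K : Matrix m m ℝ}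

/-- Evaluation at a point of the localization of `ℝ[X]` away from `d`. -/
noncomputable def evalAway (d : Polynomial ℝ) {R : Type} [CommRing R] [Algebra ℝ R] (x : R)
    (hx : IsUnit (Polynomial.aeval x d)) : Localization.Away d →ₐ[ℝ] R :=
  IsLocalization.liftAlgHom (M := Submonoid.powers d) (f := Polynomial.aeval x) (by
    rintro ⟨_, k, rfl⟩
    simpa using hx.pow k)

lemma evalAway_algebraMap (d : Polynomial ℝ) {R : Type} [CommRing R] [Algebra ℝ R] (x : R)
    (hx : IsUnit (Polynomial.aeval x d)) (p : Polynomial ℝ) :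
    evalAway d x hx (algebraMap _ _ p) = Polynomial.aeval x p :=
  IsLocalization.lift_eq _ _

/-- Real points are dense: an element of `ℝ[X]_d` is determined by its real values. -/
lemma eq_of_evalAway_eq {d : Polynomial ℝ} (hd : d ≠ 0) {z z' : Localization.Away d}
    (h : ∀ (t : ℝ) (ht : IsUnit (Polynomial.aeval t d)), evalAway d t ht z = evalAway d t ht z') :
    z = z' := by
  obtain ⟨⟨p, s⟩, hp⟩ := IsLocalization.surj (Submonoid.powers d) (z - z')
  have hs : (s : Polynomial ℝ) ≠ 0 := by
    obtain ⟨_, k, rfl⟩ := s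
    exact pow_ne_zero _ hd
  have hp0 : p * d = 0 := by
    refine Polynomial.funext fun t => ?_
    by_cases ht : Polynomial.eval t d = 0
    · simp [ht]
    · have ht' : IsUnit (Polynomial.aeval t d) := by
        rw [Polynomial.coe_aeval_eq_eval]; exact isUnit_iff_ne_zero.mpr ht
      have := congrArg (evalAway d t ht') hp
      rw [map_mul, map_sub, h t ht', sub_self, zero_mul, evalAway_algebraMap,
        Polynomial.coe_aeval_eq_eval] at this
      simp [← this]
  have hp' : p = 0 := (mul_eq_zero.mp hp0).resolve_right hd
  simp only [hp', map_zero] at hp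
  have hu : IsUnit (algebraMap (Polynomial ℝ) (Localization.Away d) s) :=
    IsLocalization.map_units _ s
  exact sub_eq_zero.mp ((hu.mul_left_eq_zero).mp hp)

/-- If `a + b J` acts by `a + b K` for real `a`, `b`, then the same holds for the values of
real polynomials at points of real algebras. -/
lemma RepGraph.rel_of_real (hJ : S.IsPositive J)
    (h : ∀ a b : ℝ, a * a + b * b ≠ 0 → F.rel ℝ (a • 1 + b • J) (a • 1 + b • K))
    (a b : Polynomial ℝ) (hab : a * a + b * b ≠ 0) {R : Type} [CommRing R] [Algebra ℝ R] (x : R)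
    (hx : IsUnit (Polynomial.aeval x (a * a + b * b))) :
    F.rel R (Polynomial.aeval x a • 1 + Polynomial.aeval x b • toAlg R J)
      (Polynomial.aeval x a • 1 + Polynomial.aeval x b • toAlg R K) := by
  set d := a * a + b * b with hd
  let ι := algebraMap (Polynomial ℝ) (Localization.Away d)
  have hu : IsUnit (ι a * ι a + ι b * ι b) := by
    rw [← map_mul, ← map_mul, ← map_add]
    exact IsLocalization.map_units _ (⟨d, Submonoid.mem_powers d⟩ : Submonoid.powers d)
  obtain ⟨k, hk⟩ := F.exists_rel (hJ.isSimilitude (ι a) (ι b)) hu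
  have key {l : Type} [DecidableEq l] (X : Matrix l l ℝ) {R : Type} [CommRing R] [Algebra ℝ R]
      (x : R) (hx : IsUnit (Polynomial.aeval x d)) :
      (ι a • (1 : Matrix l l (Localization.Away d)) + ι b • toAlg _ X).map (evalAway d x hx) =
        (Polynomial.aeval x a • 1 + Polynomial.aeval x b • toAlg R X) := by
    ext i j
    simp only [toAlg, map_apply, Matrix.add_apply, Matrix.smul_apply, smul_eq_mul, map_add,
      map_mul, ι, evalAway_algebraMap, AlgHom.commutes, one_apply]
    split_ifs <;> simp
  have hk' : k = ι a • 1 + ι b • toAlg _ K := by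
    ext i j
    refine eq_of_evalAway_eq hab fun t ht => ?_
    have h1 := F.map (evalAway d t ht) hk
    rw [key] at h1
    have h2 := h (Polynomial.aeval t a) (Polynomial.aeval t b) (by simpa [hd] using ht.ne_zero)
    rw [toAlg_real] at h1
    have h3 := congrFun (congrFun (F.unique h1 h2) i) j
    have h4 := congrFun (congrFun (key K t ht) i) j
    rw [toAlg_real] at h4
    rw [map_apply] at h3 h4
    rw [h3, h4]
  have := F.map (evalAway d x hx) hk
  rwa [hk', key, key] at this

/-- The differential at `J` of the representation. -/
lemma RepGraph.hasDiff_of_real (hJ : S.IsPositive J)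
    (h : ∀ a b : ℝ, a * a + b * b ≠ 0 → F.rel ℝ (a • 1 + b • J) (a • 1 + b • K)) :
    F.HasDiff J K := by
  have := F.rel_of_real hJ h 1 Polynomial.X (by
    intro h0
    have := congrArg (Polynomial.eval 0) h0
    simp at this) (DualNumber.eps : DualNumber ℝ) (by simp)
  simpa [HasDiff] using this

/-- Scalars act by scalars. -/
lemma RepGraph.rel_smul_one (hJ : S.IsPositive J)
    (h : ∀ a b : ℝ, a * a + b * b ≠ 0 → F.rel ℝ (a • 1 + b • J) (a • 1 + b • K))
    {R : Type} [CommRing R] [Algebra ℝ R] {x : R} (hx : IsUnit x) :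
    F.rel R (x • 1) (x • 1) := by
  have := F.rel_of_real hJ h Polynomial.X 0 (by simp) x (by simpa using hx)
  simpa using this

/-- The quadratic relations satisfied by the differential: all conjugates of `J` act by complex
structures, in particular those by `1 + t x` with `x² = 0`; compare the coefficients of `t⁴`. -/
lemma RepGraph.rho_mul_self_eq_zero (hJ : S.IsPositive J) {ρ : Matrix n n ℝ →ₗ[ℝ] Matrix m m ℝ}
    (hρ : ∀ X ∈ S.skew ℝ, F.HasDiff X (ρ X)) (hK : ρ J * ρ J = -1) {x : Matrix n n ℝ}
    (hx : x ∈ S.skew ℝ) (hxx : x * x = 0) : ρ (x * J * x) * ρ (x * J * x) = 0 := by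
  have key (t : ℝ) : (ρ J + t • ρ (x * J - J * x) - (t * t) • ρ (x * J * x)) *
      (ρ J + t • ρ (x * J - J * x) - (t * t) • ρ (x * J * x)) = -1 := by
    have hmem : t • x ∈ S.skew ℝ := Submodule.smul_mem _ _ hx
    have hsq : (t • x) * (t • x) = 0 := by simp [hxx]
    have hg := S.isSimilitude_one_add_of_sq hmem hsq
    have hinv : (1 + t • x) * (1 - t • x) = 1 := by
      rw [mul_sub, add_mul, add_mul, hsq]; simp
    obtain ⟨k, hk⟩ := F.exists_rel hg isUnit_one
    have hX := S.conj_mem_skew hg isUnit_one hinv hJ.mem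
    have e : (1 + t • x) * J * (1 - t • x) =
        J + t • (x * J - J * x) - (t * t) • (x * J * x) := by
      simp only [add_mul, mul_sub, smul_mul_assoc, mul_smul_comm, mul_one, one_mul]
      module
    have h1 := (hρ J hJ.mem).conj (hρ _ hX) hk (by
      rw [mul_assoc, mul_eq_one_comm.mp hinv, mul_one])
    rw [e, map_sub, map_add, map_smul, map_smul] at h1
    set A := ρ J + t • ρ (x * J - J * x) - (t * t) • ρ (x * J * x)
    obtain ⟨g', k', -, -, hkk⟩ := F.exists_inv hk
    calc A * A = A * (A * k) * k' := by rw [mul_assoc, mul_assoc, hkk, mul_one]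
      _ = k * (ρ J * ρ J) * k' := by rw [← h1, ← mul_assoc, ← h1, mul_assoc k]
      _ = -1 := by rw [hK, mul_neg, mul_one, neg_mul, hkk]
  -- the left side of `key` is a polynomial of degree four in `t`, with leading coefficient
  -- `ρ (x J x) ^ 2`, which is a combination of the values at `0`, `±1` and `±2`
  have h0 := key 0
  have h1 := key 1
  have h2 := key (-1)
  have h3 := key 2
  have h4 := key (-2)
  simp only [sub_mul, mul_sub, add_mul, mul_add, smul_mul_assoc, mul_smul_comm] at h0 h1 h2 h3 h4
  linear_combination (norm := module) (1 / 24 : ℝ) • h3 + (1 / 24 : ℝ) • h4 - (1 / 6 : ℝ) • h1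
    - (1 / 6 : ℝ) • h2 + (1 / 4 : ℝ) • h0

end Family

end RealModel
end PEL

/-! ### Integration along formal paths -/

namespace PEL

open Matrix

namespace RealModel

variable {n : Type} [Fintype n] [DecidableEq n] {S : RealModel n}
variable {m : Type} [Fintype m] [DecidableEq m]

lemma eps_map {R R' : Type} [CommRing R] [Algebra ℝ R] [CommRing R'] [Algebra ℝ R']
    (φ : R →ₐ[ℝ] R') (c) (w v : n → R) :
    (S.eps R c w v).map φ = S.eps R' c (φ ∘ w) (φ ∘ v) := by
  have h : (vecMulVec w (v ᵥ* S.form R)).map φ = vecMulVec (φ ∘ w) ((φ ∘ v) ᵥ* S.form R') := by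
    ext i j
    rw [← S.form_map R φ]
    simp [vecMulVec_apply, vecMul, dotProduct]
  rw [eps, eps, ← h]
  change φ.toRingHom.mapMatrix _ = _
  rw [map_sum]
  refine Finset.sum_congr rfl fun r _ => ?_
  rw [map_mul, map_mul]
  simp only [← S.unit_map R φ]
  rfl

/-- The Lie algebra over `R` is spanned by real elements. -/
lemma skew_le_of_real {R : Type} [CommRing R] [Algebra ℝ R] {p : Submodule R (Matrix n n R)}
    (h : ∀ X ∈ S.skew ℝ, toAlg R X ∈ p) : S.skew R ≤ p := by
  have h0 (c) : (S.symOp R c).compr₂ p.mkQ = 0 := by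
    ext i j : 4
    simp only [LinearMap.comp_apply, LinearMap.compr₂_apply, LinearMap.single_apply,
      LinearMap.zero_apply, Submodule.mkQ_apply, Submodule.Quotient.mk_eq_zero]
    have h1 := h _ (S.symOp_mem_skew (R := ℝ) c (Pi.single i 1) (Pi.single j 1))
    have e (i : n) : (Algebra.ofId ℝ R) ∘ (Pi.single i (1 : ℝ)) = Pi.single i (1 : R) := by
      ext k; simp only [Function.comp, Pi.single_apply]; split_ifs <;> simp
    have h2 : toAlg R (S.symOp ℝ c (Pi.single i 1) (Pi.single j 1)) =
        S.symOp R c (Pi.single i 1) (Pi.single j 1) := by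
      rw [symOp_apply, symOp_apply, toAlg_add, ← e i, ← e j, ← eps_map, ← eps_map]
      rfl
    rwa [h2] at h1
  refine S.skew_le fun c w => ?_
  have h1 := LinearMap.congr_fun₂ (h0 c) w w
  simp only [LinearMap.compr₂_apply, LinearMap.zero_apply, Submodule.mkQ_apply,
    Submodule.Quotient.mk_eq_zero] at h1
  have h2 := p.smul_mem (algebraMap ℝ R (1 / 2)) h1
  rw [symOp_apply, ← two_smul R, smul_smul, ← map_ofNat (algebraMap ℝ R) 2, ← map_mul] at h2
  norm_num at h2
  exact h2

namespace RepGraph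

variable (F : S.RepGraph m)

/-- The real matrix `T` intertwines the standard representation and the given one, over the
real algebra `R` and at the element `g`. -/
def IntertwinesAt (T : Matrix m n ℝ) {R : Type} [CommRing R] [Algebra ℝ R] (g : Matrix n n R) :
    Prop :=
  ∀ k, F.rel R g k → toAlg R T * g = k * toAlg R T

variable {F} {T : Matrix m n ℝ}

lemma IntertwinesAt.map {R R' : Type} [CommRing R] [Algebra ℝ R] [CommRing R']
    [Algebra ℝ R'] {g : Matrix n n R} (hg : F.IntertwinesAt T g) (φ : R →ₐ[ℝ] R') {μ : R}
    (hμ : IsUnit μ) (h : S.IsSimilitude R μ g) : F.IntertwinesAt T (g.map φ) := by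
  obtain ⟨k, hk⟩ := F.exists_rel h hμ
  intro k' hk'
  rw [F.unique hk' (F.map φ hk), ← toAlg_map (R := R) T φ, ← Matrix.map_mul, ← Matrix.map_mul,
    hg k hk]

lemma IntertwinesAt.of_map {R R' : Type} [CommRing R] [Algebra ℝ R] [CommRing R']
    [Algebra ℝ R'] {g : Matrix n n R} (φ : R →ₐ[ℝ] R') (hφ : Function.Injective φ)
    (h : F.IntertwinesAt T (g.map φ)) : F.IntertwinesAt T g := by
  intro k hk
  have := h _ (F.map φ hk)
  rw [← toAlg_map (R := R) T φ, ← Matrix.map_mul, ← Matrix.map_mul] at this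
  exact Matrix.map_injective hφ this

lemma IntertwinesAt.mul_right_cancel {R : Type} [CommRing R] [Algebra ℝ R] {g u : Matrix n n R}
    (h : F.IntertwinesAt T (g * u)) (hu : F.IntertwinesAt T u) {μ : R} (hμ : IsUnit μ)
    (hs : S.IsSimilitude R μ u) : F.IntertwinesAt T g := by
  obtain ⟨l, hl⟩ := F.exists_rel hs hμ
  obtain ⟨u', l', -, huu, -⟩ := F.exists_inv hl
  intro k hk
  have h1 := h _ (F.mul hk hl)
  rw [Matrix.mul_assoc, ← hu l hl, ← Matrix.mul_assoc, ← Matrix.mul_assoc] at h1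
  have := congrArg (· * u') h1
  simpa only [Matrix.mul_assoc, huu, Matrix.mul_one] using this

section Path

lemma one_add_eps_smul_map {a : Type} [DecidableEq a] {R : Type} [CommRing R] [Algebra ℝ R]
    (φ : DualNumber R →ₐ[R] DualNumber R) (X : Matrix a a R) :
    (1 + (DualNumber.eps : DualNumber R) • X.map (algebraMap R (DualNumber R))).map φ =
      1 + φ DualNumber.eps • X.map (algebraMap R (DualNumber R)) := by
  ext1 i j
  simp only [map_apply, Matrix.add_apply, Matrix.smul_apply, smul_eq_mul, map_add, map_mul,
    AlgHom.commutes, one_apply]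
  split_ifs <;> simp

/-- An intertwiner for real elements of the Lie algebra intertwines the infinitesimal actions of
all elements of the Lie algebra over `R`: this condition is `R`-linear. -/
lemma exists_rel_dualNumber (hT : ∀ X ∈ S.skew ℝ, ∃ Y, F.HasDiff X Y ∧ T * X = Y * T)
    {R : Type} [CommRing R] [Algebra ℝ R] {X : Matrix n n R} (hX : X ∈ S.skew R) :
    ∃ Y : Matrix m m R, F.rel (DualNumber R)
      (1 + (DualNumber.eps : DualNumber R) • X.map (algebraMap R (DualNumber R)))
      (1 + (DualNumber.eps : DualNumber R) • Y.map (algebraMap R (DualNumber R))) ∧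
      toAlg R T * X = Y * toAlg R T := by
  let p : Submodule R (Matrix n n R) :=
    { carrier := {X | ∃ Y : Matrix m m R, F.rel (DualNumber R)
        (1 + (DualNumber.eps : DualNumber R) • X.map (algebraMap R (DualNumber R)))
        (1 + (DualNumber.eps : DualNumber R) • Y.map (algebraMap R (DualNumber R))) ∧
        toAlg R T * X = Y * toAlg R T}
      zero_mem' := ⟨0, by simpa using F.one, by simp⟩
      add_mem' := by
        rintro X X' ⟨Y, h, e⟩ ⟨Y', h', e'⟩
        refine ⟨Y + Y', ?_, by rw [Matrix.mul_add, Matrix.add_mul, e, e']⟩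
        have key {a : Type} [Fintype a] [DecidableEq a] (X X' : Matrix a a R) :
            (1 + (DualNumber.eps : DualNumber R) • X.map (algebraMap R (DualNumber R))) *
            (1 + (DualNumber.eps : DualNumber R) • X'.map (algebraMap R (DualNumber R))) =
            1 + (DualNumber.eps : DualNumber R) • (X + X').map (algebraMap R (DualNumber R)) := by
          rw [Matrix.map_add _ (map_add _)]
          simp only [mul_add, add_mul, smul_mul_assoc, mul_smul_comm, smul_smul,
            DualNumber.eps_mul_eps, mul_one, one_mul, zero_smul, add_zero, smul_add, add_assoc]
        have := F.mul h h'
        rwa [key, key] at this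
      smul_mem' := by
        rintro r X ⟨Y, h, e⟩
        refine ⟨r • Y, ?_, by rw [Matrix.mul_smul, Matrix.smul_mul, e]⟩
        let φ : DualNumber R →ₐ[R] DualNumber R :=
          DualNumber.lift ⟨(Algebra.ofId R _, algebraMap R _ r * DualNumber.eps),
            by dsimp only; rw [mul_mul_mul_comm, DualNumber.eps_mul_eps, mul_zero],
            fun _ => Commute.all _ _⟩
        have hφ : φ DualNumber.eps = DualNumber.eps * algebraMap R _ r := by simp [φ, mul_comm]
        have := F.map (φ.restrictScalars ℝ) h
        have key {a : Type} [Fintype a] [DecidableEq a] (X : Matrix a a R) :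
            (algebraMap R (DualNumber R) r) • X.map (algebraMap R (DualNumber R)) =
            (r • X).map (algebraMap R (DualNumber R)) := by
          ext1 i j; simp [Matrix.map_apply]
        rw [AlgHom.coe_restrictScalars', one_add_eps_smul_map, one_add_eps_smul_map, hφ, mul_smul,
          mul_smul, key, key] at this
        exact this }
  refine skew_le_of_real (p := p) (fun X hX => ?_) hX
  obtain ⟨Y, hY, e⟩ := hT X hX
  refine ⟨toAlg R Y, ?_, by rw [← toAlg_mul, e, toAlg_mul]⟩
  have h := hY.rel (DualNumber.eps_mul_eps (R := R))
  have key {a : Type} (X : Matrix a a ℝ) :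
      (toAlg R X).map (algebraMap R (DualNumber R)) = toAlg (DualNumber R) X := rfl
  rwa [key, key]

open PowerSeries in
/-- The homomorphism `p ↦ p + ε p'`. -/
noncomputable def taylor (R : Type) [CommRing R] [Algebra ℝ R] : R⟦X⟧ →ₐ[ℝ] DualNumber R⟦X⟧ where
  toFun p := algebraMap _ (DualNumber R⟦X⟧) p +
    (DualNumber.eps : DualNumber R⟦X⟧) * algebraMap _ (DualNumber R⟦X⟧) (derivative R p)
  map_one' := by simp
  map_zero' := by simp
  map_mul' p q := by
    rw [Derivation.leibniz]
    simp only [map_add, map_mul, smul_eq_mul]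
    linear_combination (-1 : DualNumber R⟦X⟧) * algebraMap _ (DualNumber R⟦X⟧) (derivative R p) *
      algebraMap _ (DualNumber R⟦X⟧) (derivative R q) * DualNumber.eps_mul_eps (R := R⟦X⟧)
  map_add' p q := by simp only [map_add]; ring
  commutes' r := by
    have h : derivative R (algebraMap ℝ R⟦X⟧ r) = 0 := by
      rw [IsScalarTower.algebraMap_apply ℝ R R⟦X⟧]; exact Derivation.map_algebraMap _ _
    rw [h, map_zero, mul_zero, add_zero]; rfl

open PowerSeries in
lemma derivative_mul {R : Type} [CommRing R] {a b c : Type} [Fintype b] (M : Matrix a b R⟦X⟧)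
    (N : Matrix b c R⟦X⟧) :
    (M * N).map (derivative R) = M.map (derivative R) * N + M * N.map (derivative R) := by
  ext1 i j
  simp only [map_apply, mul_apply, map_sum, Matrix.add_apply, ← Finset.sum_add_distrib]
  refine Finset.sum_congr rfl fun l _ => ?_
  rw [Derivation.leibniz, smul_eq_mul, smul_eq_mul]
  ring

open PowerSeries in
lemma derivative_toAlg {R : Type} [CommRing R] [Algebra ℝ R] {a b : Type} (M : Matrix a b ℝ) :
    (toAlg R⟦X⟧ M).map (derivative R) = 0 := by
  ext1 i j
  simp only [toAlg, map_apply]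
  rw [IsScalarTower.algebraMap_apply ℝ R R⟦X⟧]
  exact Derivation.map_algebraMap _ _

open PowerSeries in
/-- In characteristic zero, a power series with zero derivative is constant. -/
lemma eq_toAlg_of_derivative_eq_zero {R : Type} [CommRing R] [Algebra ℝ R] {a b : Type}
    {M : Matrix a b R⟦X⟧} {N : Matrix a b ℝ} (h : M.map (derivative R) = 0)
    (h0 : M.map (constantCoeff (R := R)) = toAlg R N) : M = toAlg R⟦X⟧ N := by
  have : IsAddTorsionFree R := by
    let _ : Module ℚ R := Module.compHom R (algebraMap ℚ ℝ)
    exact IsAddTorsionFree.of_module_rat R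
  ext1 i j
  refine derivative.ext ?_ ?_
  · have h1 := congrFun (congrFun h i) j
    have h2 := congrFun (congrFun (derivative_toAlg (R := R) N) i) j
    exact h1.trans h2.symm
  · have h1 := congrFun (congrFun h0 i) j
    rw [map_apply] at h1
    rw [h1]
    simp only [toAlg, map_apply]
    rw [IsScalarTower.algebraMap_apply ℝ R R⟦X⟧]
    simp

open PowerSeries in
lemma constantCoeff_toAlg {R : Type} [CommRing R] [Algebra ℝ R] {a b : Type}
    (N : Matrix a b ℝ) : (toAlg R⟦X⟧ N).map (constantCoeff (R := R)) = toAlg R N := by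
  ext1 i j
  simp only [toAlg, map_apply]
  rw [IsScalarTower.algebraMap_apply ℝ R R⟦X⟧]
  simp

open PowerSeries in
/-- A formal path of isometries starting at `1` is intertwined, by uniqueness of the solution
of the differential equation `G' = ω G`. -/
lemma intertwinesAt_of_powerSeries (hT : ∀ X ∈ S.skew ℝ, ∃ Y, F.HasDiff X Y ∧ T * X = Y * T)
    {R : Type} [CommRing R] [Algebra ℝ R] {G : Matrix n n R⟦X⟧} (hG : S.IsSimilitude R⟦X⟧ 1 G)
    (hG0 : G.map (constantCoeff (R := R)) = 1) : F.IntertwinesAt T G := by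
  intro k hk
  obtain ⟨H, q, hHq, hGH, hkq⟩ := F.exists_inv hk
  -- `G' = ω G` with `ω = G' G⁻¹` in the Lie algebra over `R⟦t⟧`; the same equation, with the action
  -- of `ω`, holds for the image `k` of `G`, by functoriality for `p ↦ p + ε p'`
  set G' := G.map (derivative R) with hG'
  set k' := k.map (derivative R) with hk'
  have hHG : H * G = 1 := mul_eq_one_comm.mp hGH
  have hqk : q * k = 1 := mul_eq_one_comm.mp hkq
  have hω : G' * H ∈ S.skew R⟦X⟧ := by
    constructor
    · intro c p r
      have h1 := congrArg (·.map (derivative R)) (hG.1 c p r)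
      have h0 : (S.unit R⟦X⟧ c p r).map (derivative R) = 0 := derivative_toAlg _
      simp only [derivative_mul, h0, mul_zero, add_zero, zero_mul, zero_add, ← hG'] at h1
      have h2 := (hG.inv S hGH (one_mul 1)).1 c p r
      rw [mul_assoc, h2, ← mul_assoc, h1, mul_assoc]
    · have h1 := congrArg (·.map (derivative R)) hG.2
      have h0 : (S.form R⟦X⟧).map (derivative R) = 0 := derivative_toAlg _
      simp only [derivative_mul, one_smul, h0, mul_zero, add_zero, ← hG'] at h1
      rw [transpose_map, ← hG'] at h1
      have h2 : Gᵀ * S.form R⟦X⟧ = S.form R⟦X⟧ * H := by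
        have := congrArg (· * H) hG.2
        simpa only [mul_assoc, hGH, mul_one, one_smul] using this
      have h3 := (hG.inv S hGH (one_mul 1)).2
      calc (G' * H)ᵀ * S.form R⟦X⟧ = Hᵀ * (G'ᵀ * S.form R⟦X⟧ * G) * H := by
            rw [transpose_mul]; simp only [mul_assoc, hGH, mul_one]
        _ = -(Hᵀ * (Gᵀ * S.form R⟦X⟧) * (G' * H)) := by
            rw [eq_neg_of_add_eq_zero_left h1]; simp only [mul_neg, neg_mul, mul_assoc]
        _ = _ := by rw [h2, ← mul_assoc Hᵀ, h3, one_smul]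
  obtain ⟨Y, hY, hYT⟩ := exists_rel_dualNumber hT hω
  have hkY : k' = Y * k := by
    have h1 := F.map (taylor R) hk
    have h2 := F.mul hY (F.map (IsScalarTower.toAlgHom ℝ R⟦X⟧ (DualNumber R⟦X⟧)) hk)
    have e : (1 + (DualNumber.eps : DualNumber R⟦X⟧) •
        (G' * H).map (algebraMap R⟦X⟧ (DualNumber R⟦X⟧))) *
        G.map (IsScalarTower.toAlgHom ℝ R⟦X⟧ (DualNumber R⟦X⟧)) = G.map (taylor R) := by
      change _ * G.map (algebraMap R⟦X⟧ (DualNumber R⟦X⟧)) = _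
      rw [add_mul, one_mul, smul_mul_assoc, ← Matrix.map_mul, mul_assoc, hHG, mul_one]
      rfl
    rw [e] at h2
    have h3 := F.unique h1 h2
    have e' : k.map (taylor R) = k.map (algebraMap R⟦X⟧ (DualNumber R⟦X⟧)) +
      (DualNumber.eps : DualNumber R⟦X⟧) • k'.map (algebraMap R⟦X⟧ (DualNumber R⟦X⟧)) := rfl
    change _ = _ * k.map (algebraMap R⟦X⟧ (DualNumber R⟦X⟧)) at h3
    rw [e', add_mul, one_mul, smul_mul_assoc, ← Matrix.map_mul] at h3
    have h4 := add_left_cancel h3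
    ext1 i j
    have := congrArg TrivSqZeroExt.snd (congrFun (congrFun h4 i) j)
    simp only [Matrix.smul_apply, map_apply, smul_eq_mul, TrivSqZeroExt.snd_mul, DualNumber.fst_eps,
      DualNumber.snd_eps] at this
    have e0 (x : R⟦X⟧) : TrivSqZeroExt.fst (algebraMap R⟦X⟧ (DualNumber R⟦X⟧) x) = x := rfl
    simpa only [e0, op_smul_eq_smul, smul_eq_mul, mul_one, zero_mul, zero_add] using this
  have hq' : q.map (derivative R) = -(q * Y) := by
    have h1 := congrArg (·.map (derivative R)) hqk
    have h0 : (1 : Matrix m m R⟦X⟧).map (derivative R) = 0 := by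
      rw [← toAlg_one (R := R⟦X⟧)]; exact derivative_toAlg _
    simp only [derivative_mul, h0, ← hk'] at h1
    have := congrArg (· * q) h1
    simp only [add_mul, mul_assoc, hkq, mul_one, zero_mul] at this
    rw [eq_neg_iff_add_eq_zero]
    rwa [hkY, mul_assoc Y, hkq, mul_one] at this
  have hG'' : G' = G' * H * G := by rw [mul_assoc, hHG, mul_one]
  -- hence `k⁻¹ T G` is constant
  have hD : q * (toAlg R⟦X⟧ T * G) = toAlg R⟦X⟧ T := by
    refine eq_toAlg_of_derivative_eq_zero ?_ ?_
    · rw [derivative_mul, derivative_mul, derivative_toAlg, Matrix.zero_mul, zero_add, hq', ← hG',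
        hG'', ← Matrix.mul_assoc (toAlg _ T), hYT]
      simp only [Matrix.neg_mul, Matrix.mul_assoc]
      exact neg_add_cancel _
    · let φ : R⟦X⟧ →ₐ[ℝ] R := { constantCoeff (R := R) with
        commutes' := fun r => by
          change constantCoeff (R := R) _ = _
          rw [IsScalarTower.algebraMap_apply ℝ R R⟦X⟧]; simp }
      have h1 := F.map φ hk
      have h2 := F.map φ hHq
      have e1 : k.map φ = 1 := by
        have e : G.map φ = 1 := hG0
        rw [e] at h1
        exact F.unique h1 F.one
      have e2 : q.map φ = 1 := by
        have := congrArg (·.map φ) hqk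
        simpa [Matrix.map_mul, e1] using this
      change (q * (toAlg R⟦X⟧ T * G)).map φ = _
      rw [Matrix.map_mul, Matrix.map_mul, e2, Matrix.one_mul]
      change (toAlg R⟦X⟧ T).map (constantCoeff (R := R)) * G.map (constantCoeff (R := R)) = _
      rw [hG0, Matrix.mul_one, constantCoeff_toAlg]
  have := congrArg (k * ·) hD
  simpa only [← Matrix.mul_assoc, hkq, Matrix.one_mul] using this

end Path

end RepGraph

end RealModel
end PEL

/-! ### Intertwiners of the group -/

namespace PEL

open Matrix

namespace RealModel

variable {n : Type} [Fintype n] [DecidableEq n] {S : RealModel n}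
variable {m : Type} [Fintype m] [DecidableEq m]

section Cayley

variable {R : Type} [CommRing R] [Algebra ℝ R]

lemma Commutes.inv {g k : Matrix n n R} (hg : S.Commutes R g) (h : g * k = 1) :
    S.Commutes R k := fun c p q => by
  have h' : k * g = 1 := mul_eq_one_comm.mp h
  calc k * S.unit R c p q = k * (S.unit R c p q * g) * k := by
        simp only [mul_assoc, h, mul_one]
    _ = k * g * S.unit R c p q * k := by rw [← hg]; simp only [mul_assoc]
    _ = S.unit R c p q * k := by rw [h', one_mul]

lemma commutes_one : S.Commutes R (1 : Matrix n n R) := fun _ _ _ => by simp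

lemma Commutes.add {X Y : Matrix n n R} (hX : S.Commutes R X) (hY : S.Commutes R Y) :
    S.Commutes R (X + Y) := fun c p q => by rw [add_mul, mul_add, hX, hY]

lemma Commutes.sub {X Y : Matrix n n R} (hX : S.Commutes R X) (hY : S.Commutes R Y) :
    S.Commutes R (X - Y) := fun c p q => by rw [sub_mul, mul_sub, hX, hY]

/-- The Cayley transform of an element of the Lie algebra is an isometry. -/
lemma isSimilitude_cayley {X N : Matrix n n R} (hX : X ∈ S.skew R) (hN : (1 - X) * N = 1) :
    S.IsSimilitude R 1 ((1 + X) * N) := by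
  have hc : S.Commutes R N := (commutes_one.sub hX.1).inv hN
  refine ⟨(commutes_one.add hX.1).mul S hc, ?_⟩
  have h1 : (1 + X)ᵀ * S.form R = S.form R * (1 - X) := by
    rw [transpose_add, transpose_one, add_mul, hX.2, mul_sub]; simp [sub_eq_add_neg]
  have h2 : (1 - X)ᵀ * S.form R = S.form R * (1 + X) := by
    rw [transpose_sub, transpose_one, sub_mul, hX.2, mul_add]; simp
  have h3 : (1 - X) * (1 + X) = (1 + X) * (1 - X) := by noncomm_ring
  calc ((1 + X) * N)ᵀ * S.form R * ((1 + X) * N)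
      = Nᵀ * ((1 + X)ᵀ * S.form R) * (1 + X) * N := by
        rw [transpose_mul]; simp only [mul_assoc]
    _ = Nᵀ * S.form R * ((1 - X) * (1 + X)) * N := by rw [h1]; simp only [mul_assoc]
    _ = Nᵀ * (S.form R * (1 + X)) * ((1 - X) * N) := by rw [h3]; simp only [mul_assoc]
    _ = ((1 - X) * N)ᵀ * S.form R := by
        rw [← h2, hN, mul_one, ← mul_assoc, ← transpose_mul, hN]
    _ = _ := by rw [hN]; simp

/-- An isometry not having the eigenvalue `-1` is a Cayley transform. -/
lemma exists_cayley {g P : Matrix n n R} (hg : S.IsSimilitude R 1 g) (hP : (1 + g) * P = 1) :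
    ∃ X ∈ S.skew R, ∃ N, (1 - X) * N = 1 ∧ (1 + X) * N = g := by
  have hP' : P * (1 + g) = 1 := mul_eq_one_comm.mp hP
  have half (M : Matrix n n R) : (2⁻¹ : ℝ) • (M + M) = M := by
    rw [← two_smul ℝ, smul_smul]; norm_num
  refine ⟨(g - 1) * P, ⟨?_, ?_⟩, (2⁻¹ : ℝ) • (1 + g), ?_, ?_⟩
  · exact (hg.1.sub commutes_one).mul S ((commutes_one.add hg.1).inv hP)
  · have h1 : (g - 1)ᵀ * S.form R * (1 + g) = -((1 + g)ᵀ * S.form R * (g - 1)) := by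
      have h2 := hg.2
      rw [one_smul] at h2
      simp only [transpose_add, transpose_sub, transpose_one, add_mul, sub_mul, mul_add, mul_sub,
        one_mul, mul_one, h2]
      abel
    have h2 : Pᵀ * (1 + g)ᵀ = 1 := by rw [← transpose_mul, hP, transpose_one]
    calc ((g - 1) * P)ᵀ * S.form R = Pᵀ * ((g - 1)ᵀ * S.form R * (1 + g)) * P := by
          simp only [transpose_mul, mul_assoc, hP, mul_one]
      _ = -(Pᵀ * (1 + g)ᵀ * (S.form R * ((g - 1) * P))) := by
          rw [h1]; simp only [mul_neg, neg_mul, mul_assoc]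
      _ = _ := by rw [h2, one_mul]
  · have e : (1 + g) + (1 + g) = 2 * (1 + g) := by noncomm_ring
    have : (1 - (g - 1) * P) * (1 + g) = 1 + 1 := by
      rw [sub_mul, mul_assoc, hP']; noncomm_ring
    rw [mul_smul_comm, this, half]
  · have : (1 + (g - 1) * P) * (1 + g) = g + g := by
      rw [add_mul, mul_assoc, hP']; noncomm_ring
    rw [mul_smul_comm, this, half]

end Cayley

namespace RepGraph

variable {F : S.RepGraph m} {T : Matrix m n ℝ}

open Polynomial in
/-- Isometries not having the eigenvalue `-1`: these are the endpoints of the rational paths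
`(1 + t X) (1 - t X)⁻¹`. The path is defined over `R[t]_d` with `d = det (1 - t X)`, and this ring
embeds into `R⟦t⟧`. -/
lemma intertwinesAt_cayley (hT : ∀ X ∈ S.skew ℝ, ∃ Y, F.HasDiff X Y ∧ T * X = Y * T)
    {R : Type} [CommRing R] [Algebra ℝ R] {X N : Matrix n n R} (hX : X ∈ S.skew R)
    (hN : (1 - X) * N = 1) : F.IntertwinesAt T ((1 + X) * N) := by
  let Y : Matrix n n R[X] := (Polynomial.X : R[X]) • X.map (Algebra.ofId R R[X])
  have hY : Y ∈ S.skew R[X] :=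
    (S.skew _).smul_mem _ (S.map_mem_skew hX ((Algebra.ofId R R[X]).restrictScalars ℝ))
  let d : R[X] := (1 - Y).det
  have hYmap {A : Type} [CommRing A] [Algebra R A] (φ : R[X] →ₐ[R] A) :
      Y.map φ = φ Polynomial.X • X.map (algebraMap R A) := by
    ext i j
    simp only [Y, map_apply, Matrix.smul_apply, smul_eq_mul, map_mul, Algebra.ofId_apply,
      φ.commutes]
  have hmap {A : Type} [CommRing A] [Algebra R A] (φ : R[X] →ₐ[R] A) :
      φ d = (1 - φ Polynomial.X • X.map (algebraMap R A)).det := by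
    change φ.toRingHom (1 - Y).det = _
    rw [RingHom.map_det, map_sub, map_one, ← hYmap]
    rfl
  let L := Localization.Away d
  let ev : R[X] →ₐ[R] R := Polynomial.aeval 1
  let ps : R[X] →ₐ[R] PowerSeries R := Polynomial.coeToPowerSeries.algHom R
  have hev : IsUnit (ev d) := by
    have e : ev d = (1 - X).det := by
      rw [hmap, Polynomial.aeval_X, one_smul]
      congr 2
    rw [e]
    exact (Matrix.isUnit_iff_isUnit_det _).mp (IsUnit.of_mul_eq_one _ hN)
  have hX0 : ps Polynomial.X = PowerSeries.X := by simp [ps]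
  have hps : IsUnit (ps d) := by
    have e : PowerSeries.constantCoeff (ps d) = 1 := by
      rw [hmap, RingHom.map_det, hX0, map_sub, map_one]
      have : (PowerSeries.constantCoeff (R := R)).mapMatrix
          ((PowerSeries.X : PowerSeries R) • X.map (algebraMap R (PowerSeries R))) = 0 := by
        ext i j; simp
      rw [this, sub_zero, det_one]
    rw [PowerSeries.isUnit_iff_constantCoeff, e]; exact isUnit_one
  -- the values of the path at `t = 1` and its expansion at `t = 0`
  let evL : L →ₐ[R] R := IsLocalization.Away.liftAlgHom d (f := ev) hev
  let psL : L →ₐ[R] PowerSeries R := IsLocalization.Away.liftAlgHom d (f := ps) hps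
  have hevL (p) : evL (algebraMap _ L p) = ev p := IsLocalization.Away.lift_eq d hev p
  have hpsL (p) : psL (algebraMap _ L p) = ps p := IsLocalization.Away.lift_eq d hps p
  have hinj : Function.Injective psL := by
    rw [injective_iff_map_eq_zero]
    intro z hz
    obtain ⟨⟨p, s⟩, hp⟩ := IsLocalization.surj (Submonoid.powers d) z
    have h0 := congrArg psL hp
    rw [map_mul, hz, zero_mul, hpsL] at h0
    have hp0 : p = 0 := Polynomial.coe_injective R (by simpa [ps] using h0.symm)
    simp only [hp0, map_zero] at hp
    exact ((IsLocalization.map_units L s).mul_left_eq_zero).mp hp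
  let YL : Matrix n n L := Y.map (algebraMap R[X] L)
  have hYL : YL ∈ S.skew L := S.map_mem_skew hY (IsScalarTower.toAlgHom ℝ R[X] L)
  have hdet : IsUnit (1 - YL).det := by
    have : (1 - YL).det = algebraMap R[X] L d := by
      rw [RingHom.map_det, map_sub, map_one]; rfl
    rw [this]
    exact IsLocalization.Away.algebraMap_isUnit d
  have hNL := mul_nonsing_inv (1 - YL) hdet
  set NL := (1 - YL)⁻¹
  have key {A : Type} [CommRing A] [Algebra R A] (φ : L →ₐ[R] A) (a : A)
      (ha : φ (algebraMap R[X] L Polynomial.X) = a) :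
      (1 - a • X.map (algebraMap R A)) * NL.map φ = 1 ∧
      ((1 + YL) * NL).map φ = (1 + a • X.map (algebraMap R A)) * NL.map φ := by
    have h1 : YL.map φ = a • X.map (algebraMap R A) := by
      rw [← ha]; exact hYmap (φ.comp (IsScalarTower.toAlgHom R R[X] L))
    have h2 := congrArg (φ : L →+* A).mapMatrix hNL
    rw [map_mul, map_sub, map_one] at h2
    have h3 : (φ : L →+* A).mapMatrix YL = a • X.map (algebraMap R A) := h1
    rw [h3] at h2
    refine ⟨h2, ?_⟩
    change (φ : L →+* A).mapMatrix _ = _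
    rw [map_mul, map_add, map_one, h3]
    rfl
  have hG := isSimilitude_cayley hYL hNL
  have hps1 := key psL PowerSeries.X (by rw [hpsL, hX0])
  have hev1 := key evL 1 (by rw [hevL]; simp [ev])
  have hXid : X.map (algebraMap R R) = X := by ext i j; simp
  rw [one_smul, hXid] at hev1
  have hNev : NL.map evL = N := by
    calc NL.map evL = N * (1 - X) * NL.map evL := by rw [mul_eq_one_comm.mp hN, one_mul]
      _ = N := by rw [mul_assoc, hev1.1, mul_one]
  rw [hNev] at hev1
  rw [← hev1.2]
  refine IntertwinesAt.map (φ := evL.restrictScalars ℝ) ?_ isUnit_one hG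
  refine IntertwinesAt.of_map (psL.restrictScalars ℝ) hinj ?_
  refine intertwinesAt_of_powerSeries hT ?_ ?_
  · have := hG.map S (psL.restrictScalars ℝ)
    rwa [map_one] at this
  · change (((1 + YL) * NL).map psL).map _ = 1
    have hc : (PowerSeries.constantCoeff (R := R)).mapMatrix
          ((PowerSeries.X : PowerSeries R) • X.map (algebraMap R (PowerSeries R))) = 0 := by
      ext i j; simp
    have h1 := congrArg (PowerSeries.constantCoeff (R := R)).mapMatrix hps1.1
    rw [map_mul, map_sub, hc, map_one, sub_zero, one_mul] at h1
    rw [hps1.2]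
    change (PowerSeries.constantCoeff (R := R)).mapMatrix _ = 1
    rw [map_mul, map_add, hc, h1, map_one, add_zero, one_mul]

/-- Isometries over a local ring. The eigenvalue `-1` of the reduction is removed by multiplying
by finitely many unipotent elements `1 + eps c w w`. -/
lemma intertwinesAt_of_isLocalRing (hT : ∀ X ∈ S.skew ℝ, ∃ Y, F.HasDiff X Y ∧ T * X = Y * T)
    {R : Type} [CommRing R] [Algebra ℝ R] [IsLocalRing R] {g : Matrix n n R}
    (hg : S.IsSimilitude R 1 g) : F.IntertwinesAt T g := by
  have hcay {g : Matrix n n R} (hg : S.IsSimilitude R 1 g) (hu : IsUnit (1 + g).det) :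
      F.IntertwinesAt T g := by
    obtain ⟨X, hX, N, hN, e⟩ := exists_cayley hg (mul_nonsing_inv _ hu)
    rw [← e]
    exact intertwinesAt_cayley hT hX hN
  let K := IsLocalRing.ResidueField R
  let π : R →ₐ[ℝ] K := IsScalarTower.toAlgHom ℝ R K
  induction hd : Module.finrank K (LinearMap.ker (1 + g.map π).mulVecLin) using
    Nat.strong_induction_on generalizing g with
  | _ d ih =>
  by_cases hker : LinearMap.ker (1 + g.map π).mulVecLin = ⊥
  · refine hcay hg ?_
    rw [← IsLocalRing.residue_ne_zero_iff_isUnit]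
    have e : IsLocalRing.residue R (1 + g).det = (1 + g.map π).det := by
      rw [RingHom.map_det, map_add, map_one]; rfl
    rw [e]
    intro h0
    obtain ⟨v, hv, hv'⟩ := Matrix.exists_mulVec_eq_zero_iff.mpr h0
    exact hv (by simpa using hker.le (show v ∈ LinearMap.ker (1 + g.map π).mulVecLin from hv'))
  -- choose a real basis vector `w` which is not orthogonal to an eigenvector `y₁` of the reduction
  -- `g'` for the eigenvalue `-1`; then `g' (1 + eps c w w)` has a smaller eigenspace
  · set g' := g.map π with hg'
    have hs : S.IsSimilitude K 1 g' := by
      have := hg.map S π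
      rwa [map_one] at this
    obtain ⟨z, hz, hz0⟩ := Submodule.exists_mem_ne_zero_of_ne_bot hker
    have memker (M : Matrix n n K) (y : n → K) :
        y ∈ LinearMap.ker (1 + M).mulVecLin ↔ M *ᵥ y = -y := by
      rw [LinearMap.mem_ker, mulVecLin_apply, add_mulVec, one_mulVec, add_comm,
        add_eq_zero_iff_eq_neg]
    rw [memker] at hz
    obtain ⟨c, r, hr⟩ : ∃ c r, S.unit K c (S.base c) r *ᵥ z ≠ 0 := by
      by_contra! h
      refine hz0 ?_
      rw [← one_mulVec z, ← S.unit_sum K, sum_mulVec]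
      refine Finset.sum_eq_zero fun c _ => ?_
      rw [sum_mulVec]
      refine Finset.sum_eq_zero fun r _ => ?_
      rw [← S.unit_mul_same K c r (S.base c) r, ← mulVec_mulVec, h, mulVec_zero]
    set y₁ := S.unit K c (S.base c) r *ᵥ z with hy₁
    have hy₁g : g' *ᵥ y₁ = -y₁ := by
      rw [hy₁, ← S.unit_mulVec_mulVec hs.1, hz, mulVec_neg]
    have hy₁u : S.unit K c (S.base c) (S.base c) *ᵥ y₁ = y₁ := by
      rw [hy₁, mulVec_mulVec, unit_mul_same]
    obtain ⟨a, ha⟩ : ∃ a, (Pi.single a 1 : n → K) ⬝ᵥ (S.form K *ᵥ y₁) ≠ 0 := by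
      by_contra! h
      simp only [single_one_dotProduct] at h
      refine hr ?_
      have : S.form K *ᵥ y₁ = 0 := funext h
      rw [← one_mulVec y₁, ← nonsing_inv_mul _ (S.form_det K), ← mulVec_mulVec, this, mulVec_zero]
    set w : n → K := Pi.single a 1 with hw
    let x : Matrix n n R := S.eps R c (Pi.single a 1) (Pi.single a 1)
    have hx : x ∈ S.skew R := S.eps_self_mem_skew c _
    have hxx : x * x = 0 := S.eps_self_mul_self c _
    have hxm : x.map π = S.eps K c w w := by
      have e : π ∘ (Pi.single a (1 : R)) = w := by
        ext k; simp only [Function.comp, hw, Pi.single_apply]; split_ifs <;> simp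
      rw [eps_map, e]
    have hu : S.IsSimilitude R 1 (1 + x) := S.isSimilitude_one_add_of_sq hx hxx
    have huT : F.IntertwinesAt T (1 + x) := by
      refine hcay hu ((Matrix.isUnit_iff_isUnit_det _).mp ?_)
      -- `(2 + x) (2 - x) = 4`
      refine IsUnit.of_mul_eq_one ((4⁻¹ : ℝ) • (1 + 1 - x)) ?_
      have : (1 + (1 + x)) * (1 + 1 - x) = (4 : ℝ) • (1 : Matrix n n R) := by
        have e : (1 + (1 + x)) * (1 + 1 - x) = 1 + 1 + 1 + 1 - x * x := by noncomm_ring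
        rw [e, hxx]; module
      rw [mul_smul_comm, this, smul_smul]; norm_num
    set x' := S.eps K c w w with hx'
    have hmap : (g * (1 + x)).map π = g' * (1 + x') := by
      rw [← hxm]
      change π.toRingHom.mapMatrix _ = _
      rw [map_mul, map_add, map_one]; rfl
    refine IntertwinesAt.mul_right_cancel (u := 1 + x) ?_ huT isUnit_one hu
    have hgu := hg.mul S hu
    rw [one_mul] at hgu
    refine ih _ ?_ hgu rfl
    rw [← hd, hmap]
    have hiso (p q : n → K) : (g' *ᵥ p) ⬝ᵥ (S.form K *ᵥ (g' *ᵥ q)) = p ⬝ᵥ (S.form K *ᵥ q) := by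
      have h2 := hs.2
      rw [one_smul] at h2
      conv_rhs => rw [← h2]
      rw [← mulVec_mulVec, ← mulVec_mulVec, dotProduct_mulVec p, vecMul_transpose]
    have hwy : w ⬝ᵥ (S.form K *ᵥ (S.unit K c (S.base c) (S.base c) *ᵥ y₁)) ≠ 0 := by rwa [hy₁u]
    have hwy' : (S.unit K c (S.base c) (S.base c) *ᵥ w) ⬝ᵥ (S.form K *ᵥ y₁) ≠ 0 := by
      rwa [← form_unit, hy₁u]
    refine Submodule.finrank_lt_finrank_of_lt (lt_of_le_of_ne ?_ ?_)
    · intro y hy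
      rw [memker] at hy ⊢
      have hxy : x' *ᵥ y = 0 := by
        refine S.eps_mulVec_eq_zero c w w y fun p => ?_
        have hzp : g' *ᵥ (S.unit K c p (S.base c) *ᵥ y₁) = -(S.unit K c p (S.base c) *ᵥ y₁) := by
          rw [← S.unit_mulVec_mulVec hs.1, hy₁g, mulVec_neg]
        have h1 := hiso ((1 + x') *ᵥ y) (S.unit K c p (S.base c) *ᵥ y₁)
        rw [mulVec_mulVec, hy, hzp, mulVec_neg, neg_dotProduct_neg, add_mulVec, one_mulVec,
          add_dotProduct, left_eq_add, form_unit, hx', unit_mulVec_eps_mulVec, smul_dotProduct,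
          smul_eq_mul] at h1
        exact (mul_eq_zero.mp h1).resolve_right hwy'
      rwa [← mulVec_mulVec, add_mulVec, one_mulVec, hxy, add_zero] at hy
    · intro h
      have h1 : y₁ ∈ LinearMap.ker (1 + g' * (1 + x')).mulVecLin := by
        rw [h, memker, hy₁g]
      rw [memker, ← mulVec_mulVec, add_mulVec, one_mulVec, mulVec_add, hy₁g, add_eq_left] at h1
      have hxy : x' *ᵥ y₁ = 0 := by
        obtain ⟨u, hu⟩ := (Matrix.isUnit_iff_isUnit_det _).mpr (hs.isUnit_det S isUnit_one)
        rw [← one_mulVec (x' *ᵥ y₁), ← Units.inv_mul u, hu, ← mulVec_mulVec, h1, mulVec_zero]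
      have h2 := congrArg (S.unit K c (S.base c) (S.base c) *ᵥ ·) hxy
      simp only [hx', unit_mulVec_eps_mulVec, mulVec_zero] at h2
      have h3 := congrArg (· ⬝ᵥ (S.form K *ᵥ y₁)) h2
      simp only [smul_dotProduct, zero_dotProduct, smul_eq_mul] at h3
      exact (mul_ne_zero hwy hwy') h3

/-- Isometries over an arbitrary ring: check the matrix entries in the local rings. -/
lemma intertwinesAt_of_isometry (hT : ∀ X ∈ S.skew ℝ, ∃ Y, F.HasDiff X Y ∧ T * X = Y * T)
    {R : Type} [CommRing R] [Algebra ℝ R] {g : Matrix n n R}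
    (hg : S.IsSimilitude R 1 g) : F.IntertwinesAt T g := by
  intro k hk
  ext i j
  rw [← sub_eq_zero]
  refine eq_zero_of_localization _ fun I hI => ?_
  let φ : R →ₐ[ℝ] Localization.AtPrime I := IsScalarTower.toAlgHom ℝ R _
  have hs := hg.map S φ
  rw [map_one] at hs
  have h1 := intertwinesAt_of_isLocalRing hT hs _ (F.map φ hk)
  rw [← toAlg_map (R := R) T φ, ← Matrix.map_mul, ← Matrix.map_mul] at h1
  rw [map_sub, sub_eq_zero]
  exact congrFun (congrFun h1 i) j

/-- Similitudes: after adjoining a square root of the multiplier, a similitude is the product of a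
scalar and an isometry. -/
lemma intertwinesAt_of_isSimilitude (hT : ∀ X ∈ S.skew ℝ, ∃ Y, F.HasDiff X Y ∧ T * X = Y * T)
    (hc : ∀ {R : Type} [CommRing R] [Algebra ℝ R] {x : R}, IsUnit x → F.rel R (x • 1) (x • 1))
    {R : Type} [CommRing R] [Algebra ℝ R] (g : Matrix n n R) : F.IntertwinesAt T g := by
  intro k hk
  obtain ⟨μ, hμ, hg⟩ := F.isSimilitude hk
  revert k
  change F.IntertwinesAt T g
  cases subsingleton_or_nontrivial R with
  | inl h => intro k _; ext i j; exact Subsingleton.elim _ _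
  | inr h =>
  let p : Polynomial R := Polynomial.X ^ 2 - Polynomial.C μ
  have hp : p.Monic := Polynomial.monic_X_pow_sub_C μ two_ne_zero
  let A := AdjoinRoot p
  let φ : R →ₐ[ℝ] A := IsScalarTower.toAlgHom ℝ R A
  have hinj : Function.Injective φ := by
    rw [injective_iff_map_eq_zero]
    intro r hr
    have h0 : AdjoinRoot.mk p (Polynomial.C r) = 0 := hr
    by_contra hr0
    refine hp.not_dvd_of_degree_lt (by simpa using hr0) ?_ (AdjoinRoot.mk_eq_zero.mp h0)
    refine Polynomial.degree_C_le.trans_lt ?_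
    rw [Polynomial.degree_X_pow_sub_C two_pos]
    norm_num
  let s : A := AdjoinRoot.root p
  have hs : s * s = φ μ := by
    have := AdjoinRoot.eval₂_root p
    rw [Polynomial.eval₂_sub, Polynomial.eval₂_C, Polynomial.eval₂_X_pow, sub_eq_zero, sq] at this
    exact this
  obtain ⟨t, ht⟩ : ∃ t, t * s = 1 := by
    obtain ⟨ν, hν⟩ := (hμ.map φ).exists_left_inv
    exact ⟨ν * s, by rw [mul_assoc, hs, hν]⟩
  refine IntertwinesAt.of_map φ hinj ?_
  have h1 := S.isSimilitude_smul (a := t) (hg.map S φ)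
  have e : t * t * φ μ = 1 := by rw [← hs, mul_mul_mul_comm, ht, one_mul]
  rw [e] at h1
  have hsu : IsUnit s := IsUnit.of_mul_eq_one t (by rw [mul_comm, ht])
  have h2 := intertwinesAt_of_isometry hT h1
  obtain ⟨l, hl⟩ := F.exists_rel h1 isUnit_one
  intro k hk
  have h3 := F.mul (hc hsu) hl
  rw [smul_mul_smul_comm, mul_comm s t, ht, one_smul, one_mul] at h3
  rw [F.unique hk h3, smul_one_mul, Matrix.smul_mul, ← h2 l hl, Matrix.mul_smul, smul_smul,
    mul_comm s t, ht, one_smul]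

/-- The images of the intertwiners span: a linear form vanishing on all of them is zero. -/
theorem eq_zero_of_forall_intertwinesAt {J : Matrix n n ℝ} {K : Matrix m m ℝ}
    (hJ : S.IsPositive J) (hK : K * K = -1)
    (h : ∀ a b : ℝ, a * a + b * b ≠ 0 → F.rel ℝ (a • 1 + b • J) (a • 1 + b • K)) (l : m → ℝ)
    (hl : ∀ T : Matrix m n ℝ, (∀ (R : Type) [CommRing R] [Algebra ℝ R] (g : Matrix n n R),
      F.IntertwinesAt T g) → l ᵥ* T = 0) : l = 0 := by
  obtain ⟨ρ, hρ, hd⟩ := F.exists_differential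
  have hJK : ρ J = K := (hd J hJ.mem).unique (F.hasDiff_of_real hJ h)
  have hK' : ρ J * ρ J = -1 := by rw [hJK, hK]
  refine S.eq_zero_of_forall_intertwiner hJ hρ
    (fun x hx hxx => F.rho_mul_self_eq_zero hJ hd hK' hx hxx) hK' l fun T hT => hl T ?_
  intro R _ _ g
  exact intertwinesAt_of_isSimilitude (fun X hX => ⟨ρ X, hd X hX, hT X hX⟩)
    (fun hx => F.rel_smul_one hJ h hx) g

end RepGraph

end RealModel
end PEL

/-! ### Coordinates on scalar extensions -/

namespace PEL

open Matrix

lemma eq_of_forall_dotProduct {ι R : Type} [Fintype ι] [DecidableEq ι] [CommRing R]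
    {M N : Matrix ι ι R}
    (h : ∀ x y : ι → R, x ⬝ᵥ (M *ᵥ y) = x ⬝ᵥ (N *ᵥ y)) : M = N := by
  ext i j
  simpa using h (Pi.single i 1) (Pi.single j 1)

section Coordinates

variable {W : Type v} [AddCommGroup W] [Module ℚ W] {ι : Type} [Fintype ι] [DecidableEq ι]
  (b : Module.Basis ι ℚ W)
variable {W' : Type v} [AddCommGroup W'] [Module ℚ W'] {ι' : Type} [Fintype ι']
  (b' : Module.Basis ι' ℚ W')
variable (R : Type) [CommRing R] [Algebra ℚ R] {S : Type} [CommRing S] [Algebra ℚ S]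

/-- The coordinates on `R ⊗ W` with respect to a basis of `W`. -/
noncomputable def coords : R ⊗[ℚ] W ≃ₗ[R] (ι → R) := (Algebra.TensorProduct.basis R b).equivFun

omit [DecidableEq ι] in
lemma coords_tmul (r : R) (x : W) (i : ι) :
    coords b R (r ⊗ₜ x) i = r * algebraMap ℚ R (b.repr x i) := by
  simp [coords]

/-- The matrix of an endomorphism of `R ⊗ W` with respect to a basis of `W`. -/
noncomputable def opMatrix : Module.End R (R ⊗[ℚ] W) ≃ₐ[R] Matrix ι ι R :=
  LinearMap.toMatrixAlgEquiv (Algebra.TensorProduct.basis R b)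

lemma coords_apply (a : Module.End R (R ⊗[ℚ] W)) (x : R ⊗[ℚ] W) :
    coords b R (a x) = opMatrix b R a *ᵥ coords b R x :=
  (LinearMap.toMatrix_mulVec_repr (Algebra.TensorProduct.basis R b)
    (Algebra.TensorProduct.basis R b) a x).symm

lemma coords_baseChange (t : W →ₗ[ℚ] W') (x : R ⊗[ℚ] W) :
    coords b' R (t.baseChange R x) =
      (LinearMap.toMatrix b b' t).map (algebraMap ℚ R) *ᵥ coords b R x := by
  rw [← LinearMap.toMatrix_baseChange (R := ℚ) (A := R) t b b']
  exact (LinearMap.toMatrix_mulVec_repr (Algebra.TensorProduct.basis R b)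
    (Algebra.TensorProduct.basis R b') (t.baseChange R) x).symm

lemma opMatrix_baseChange (t : W →ₗ[ℚ] W) :
    opMatrix b R (t.baseChange R) = (LinearMap.toMatrix b b t).map (algebraMap ℚ R) :=
  LinearMap.toMatrix_baseChange (R := ℚ) (A := R) t b b

lemma coords_form (B : LinearMap.BilinForm ℚ W) (x y : R ⊗[ℚ] W) :
    B.baseChange R x y = coords b R x ⬝ᵥ
      ((LinearMap.BilinForm.toMatrix b B).map (algebraMap ℚ R) *ᵥ coords b R y) := by
  have h : LinearMap.BilinForm.toMatrix (Algebra.TensorProduct.basis R b) (B.baseChange R) =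
      (LinearMap.BilinForm.toMatrix b B).map (algebraMap ℚ R) := by
    ext i j
    simp [LinearMap.BilinForm.toMatrix_apply, Algebra.algebraMap_eq_smul_one]
  rw [← h]
  exact LinearMap.BilinForm.apply_eq_dotProduct_toMatrix_mulVec
    (Algebra.TensorProduct.basis R b) _ _ _

variable {R}

omit [DecidableEq ι] in
lemma coords_changeScalars (φ : R →ₐ[ℚ] S) (x : R ⊗[ℚ] W) :
    coords b S (changeScalars W φ x) = φ ∘ coords b R x := by
  induction x with
  | zero => ext; simp
  | tmul r x => ext i; simp [coords_tmul]
  | add x y hx hy => ext i; simp [hx, hy]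

lemma opMatrix_extendEnd (φ : R →ₐ[ℚ] S) (a : Module.End R (R ⊗[ℚ] W)) :
    opMatrix b S (extendEnd φ a) = (opMatrix b R a).map φ := by
  have hb (A : Type) [CommRing A] [Algebra ℚ A] (c : Module.End A (A ⊗[ℚ] W)) (i j : ι) :
      opMatrix b A c i j = coords b A (c (1 ⊗ₜ b j)) i := by
    rw [coords_apply]
    have : coords b A (1 ⊗ₜ b j) = Pi.single j 1 := by
      ext k; rw [coords_tmul]; simp [Finsupp.single_apply, Pi.single_apply, eq_comm]
    rw [this]; simp
  ext i j
  have h := extendEnd_changeScalars φ a (1 ⊗ₜ b j)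
  rw [changeScalars_tmul, map_one] at h
  rw [hb, map_apply, hb, h, coords_changeScalars]
  rfl

end Coordinates

end PEL

/-! ### The real model of a PEL-datum of symplectic type -/

namespace PEL

open Matrix

lemma map_algebraMap_rat {a c R : Type} [CommRing R] [Algebra ℚ R] [Algebra ℝ R]
    (M : Matrix a c ℚ) : toAlg R (M.map (algebraMap ℚ ℝ)) = M.map (algebraMap ℚ R) := by
  ext i j
  exact RingHom.map_rat_algebraMap (algebraMap ℝ R) _

namespace PELDatum

variable (D : PELDatum.{u, v}) {ι : Type} [Fintype ι] [DecidableEq ι] (b : Module.Basis ι ℚ D.V)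

/-- The Gram matrix of the pairing. -/
noncomputable def gram : Matrix ι ι ℚ := LinearMap.BilinForm.toMatrix b D.form

/-- The action of `B_ℝ` on `V_ℝ` in terms of matrices. -/
noncomputable def actMatrix : ℝ ⊗[ℚ] D.B →ₐ[ℝ] Matrix ι ι ℝ :=
  Algebra.TensorProduct.lift (Algebra.ofId ℝ _)
    ((Algebra.ofId ℚ ℝ).mapMatrix.comp
      ((LinearMap.toMatrixAlgEquiv b).toAlgHom.comp (Algebra.lsmul ℚ ℚ D.V)))
    (fun r M => by rw [Algebra.ofId_apply]; exact Algebra.commute_algebraMap_left _ _)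

lemma actMatrix_tmul (r : ℝ) (x : D.B) :
    D.actMatrix b (r ⊗ₜ x) = r • (LinearMap.toMatrix b b (actBy x)).map (algebraMap ℚ ℝ) := by
  rw [actMatrix, Algebra.TensorProduct.lift_tmul, Algebra.ofId_apply, ← Algebra.smul_def]
  rfl

lemma gram_transpose : (D.gram b)ᵀ = -D.gram b := by
  ext i j
  simp only [gram, transpose_apply, LinearMap.BilinForm.toMatrix_apply]
  rw [Matrix.neg_apply, LinearMap.BilinForm.toMatrix_apply, D.form_alt.neg_eq]

lemma gram_det : IsUnit (D.gram b).det :=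
  isUnit_iff_ne_zero.mpr
    ((LinearMap.BilinForm.nondegenerate_iff_det_ne_zero b).mp D.form_nondegenerate)

lemma actBy_transpose (x : D.B) :
    (LinearMap.toMatrix b b (actBy x))ᵀ * D.gram b =
      D.gram b * LinearMap.toMatrix b b (actBy (D.inv x)) := by
  rw [gram, ← LinearMap.BilinForm.toMatrix_compLeft, ← LinearMap.BilinForm.toMatrix_compRight]
  congr 1
  ext y z
  exact D.form_smul x y z

lemma actMatrix_transpose (y : ℝ ⊗[ℚ] D.B) :
    (D.actMatrix b y)ᵀ * (D.gram b).map (algebraMap ℚ ℝ) =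
      (D.gram b).map (algebraMap ℚ ℝ) * D.actMatrix b (D.inv.baseChange ℝ y) := by
  induction y with
  | zero => simp
  | tmul r x =>
    rw [LinearMap.baseChange_tmul, actMatrix_tmul, actMatrix_tmul, transpose_smul, smul_mul_assoc,
      mul_smul_comm, ← transpose_map, ← Matrix.map_mul, ← Matrix.map_mul, actBy_transpose]
  | add x y hx hy => rw [map_add, map_add, map_add, transpose_add, add_mul, mul_add, hx, hy]

section Split

variable {k : ℕ} {n : Fin k → ℕ} (hn : ∀ i, 0 < n i)
  (e : (ℝ ⊗[ℚ] D.B) ≃ₐ[ℝ] (∀ i, Matrix (Fin (n i)) (Fin (n i)) ℝ))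
  (he : ∀ b i, e (D.inv.baseChange ℝ b) i = (e b i).transpose)

/-- The matrix units in the product of the matrix algebras. -/
def prodUnit (n : Fin k → ℕ) (c : Fin k) (p q : Fin (n c)) :
    ∀ i, Matrix (Fin (n i)) (Fin (n i)) ℝ :=
  Pi.single c (Matrix.single p q 1)

lemma prodUnit_mul (c : Fin k) (p q r s : Fin (n c)) :
    prodUnit n c p q * prodUnit n c r s = if q = r then prodUnit n c p s else 0 := by
  rw [prodUnit, prodUnit, ← Pi.single_mul]
  split_ifs with h
  · subst h; rw [single_mul_single_same, mul_one]; rfl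
  · rw [single_mul_single_of_ne _ _ _ _ h, Pi.single_zero]

lemma prodUnit_mul_ne {c d : Fin k} (h : c ≠ d) (p q : Fin (n c)) (r s : Fin (n d)) :
    prodUnit n c p q * prodUnit n d r s = 0 := by
  ext i : 1
  rw [Pi.mul_apply, Pi.zero_apply, prodUnit, prodUnit]
  by_cases hi : i = c
  · subst hi; rw [Pi.single_eq_of_ne h, mul_zero]
  · rw [Pi.single_eq_of_ne hi, zero_mul]

lemma eq_sum_prodUnit (x : ∀ i, Matrix (Fin (n i)) (Fin (n i)) ℝ) :
    x = ∑ c, ∑ p, ∑ q, x c p q • prodUnit n c p q := by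
  conv_lhs => rw [← Finset.univ_sum_single x]
  refine Finset.sum_congr rfl fun c _ => ?_
  conv_lhs => rw [matrix_eq_sum_single (x c)]
  have h := map_sum (AddMonoidHom.single (fun i => Matrix (Fin (n i)) (Fin (n i)) ℝ) c)
    (fun p => ∑ q, single p q (x c p q)) Finset.univ
  refine h.trans (Finset.sum_congr rfl fun p _ => ?_)
  rw [map_sum]
  refine Finset.sum_congr rfl fun q _ => ?_
  rw [prodUnit, ← Pi.single_smul, smul_single, smul_eq_mul, mul_one]
  rfl

lemma sum_prodUnit : ∑ c, ∑ p, prodUnit n c p p = 1 := by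
  conv_rhs => rw [eq_sum_prodUnit 1]
  refine Finset.sum_congr rfl fun c _ => Finset.sum_congr rfl fun p _ => ?_
  rw [Finset.sum_eq_single p]
  · simp
  · intro q _ hq; simp [one_apply_ne hq.symm]
  · simp

/-- The matrices of a PEL-datum of symplectic type. -/
noncomputable def realModel : RealModel ι where
  blocks := k
  size := n
  size_pos := hn
  Ω := (D.gram b).map (algebraMap ℚ ℝ)
  E c p q := D.actMatrix b (e.symm (prodUnit n c p q))
  Ω_transpose := by
    rw [← transpose_map, gram_transpose]; ext i j; simp
  Ω_det := by
    have h : ((D.gram b).map (algebraMap ℚ ℝ)).det = algebraMap ℚ ℝ (D.gram b).det := by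
      rw [RingHom.map_det]; rfl
    rw [h]; exact (D.gram_det b).map _
  E_mul c p q r s := by
    rw [← map_mul, ← map_mul, prodUnit_mul]
    split_ifs
    · rfl
    · rw [map_zero, map_zero]
  E_mul_ne c d p q r s h := by
    rw [← map_mul, ← map_mul, prodUnit_mul_ne h, map_zero, map_zero]
  E_sum := by
    simp only [← map_sum]
    rw [sum_prodUnit, map_one, map_one]
  E_transpose c p q := by
    rw [actMatrix_transpose]
    congr 2
    rw [AlgEquiv.eq_symm_apply]
    ext1 i
    rw [he, AlgEquiv.apply_symm_apply]
    by_cases hi : i = c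
    · subst hi
      simp [prodUnit, transpose_single]
    · simp [prodUnit, Pi.single_eq_of_ne hi]

variable (R : Type) [CommRing R] [Algebra ℚ R] [Algebra ℝ R]

lemma form_realModel : (D.realModel b hn e he).form R = (D.gram b).map (algebraMap ℚ R) :=
  map_algebraMap_rat (R := R) _

/-- Commuting with the matrix units amounts to commuting with the action of `B`. -/
lemma commutes_realModel_iff (X : Matrix ι ι R) : (D.realModel b hn e he).Commutes R X ↔
    ∀ x : D.B, X * (LinearMap.toMatrix b b (actBy x)).map (algebraMap ℚ R) =
      (LinearMap.toMatrix b b (actBy x)).map (algebraMap ℚ R) * X := by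
  constructor
  · intro h x
    have h1 : (LinearMap.toMatrix b b (actBy x)).map (algebraMap ℚ R) =
        ∑ c, ∑ p, ∑ q, algebraMap ℝ R (e (1 ⊗ₜ x) c p q) •
          (D.realModel b hn e he).unit R c p q := by
      have h2 := D.actMatrix_tmul b 1 x
      rw [one_smul] at h2
      have h3 : D.actMatrix b (1 ⊗ₜ x) = D.actMatrix b (e.symm (e (1 ⊗ₜ x))) := by
        rw [AlgEquiv.symm_apply_apply]
      rw [eq_sum_prodUnit (e (1 ⊗ₜ x))] at h3
      rw [← map_algebraMap_rat, ← h2, h3]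
      simp only [map_sum, map_smul]
      change (algebraMap ℝ R).mapMatrix _ = _
      simp only [map_sum]
      refine Finset.sum_congr rfl fun c _ => Finset.sum_congr rfl fun p _ =>
        Finset.sum_congr rfl fun q _ => ?_
      ext i j
      simp [realModel, RealModel.unit]
    rw [h1]
    simp only [Finset.mul_sum, Finset.sum_mul, mul_smul_comm, smul_mul_assoc]
    exact Finset.sum_congr rfl fun c _ => Finset.sum_congr rfl fun p _ =>
      Finset.sum_congr rfl fun q _ => congrArg _ (h c p q)
  · intro h c p q
    -- the elements `y` of `B_ℝ` whose action commutes with `X` form a real subspace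
    have key (y : ℝ ⊗[ℚ] D.B) : X * toAlg R (D.actMatrix b y) =
        toAlg R (D.actMatrix b y) * X := by
      induction y with
      | zero => simp [toAlg]
      | tmul r x =>
        rw [actMatrix_tmul, toAlg_smul, map_algebraMap_rat, mul_smul_comm, h,
          smul_mul_assoc]
      | add x y hx hy => rw [map_add, toAlg_add, mul_add, add_mul, hx, hy]
    exact key _

/-- The points of `G` over real algebras are the similitudes of the real model. -/
lemma mem_points_iff (g : (Module.End R (R ⊗[ℚ] D.V))ˣ) : g ∈ D.points R ↔
    ∃ μ, IsUnit μ ∧ (D.realModel b hn e he).IsSimilitude R μ (opMatrix b R g.val) := by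
  have h1 : (∀ (x : D.B) (y : R ⊗[ℚ] D.V),
      g.val ((actBy x).baseChange R y) = (actBy x).baseChange R (g.val y)) ↔
      (D.realModel b hn e he).Commutes R (opMatrix b R g.val) := by
    rw [commutes_realModel_iff]
    refine forall_congr' fun x => ?_
    rw [← opMatrix_baseChange, ← map_mul, ← map_mul, (opMatrix b R).injective.eq_iff,
      LinearMap.ext_iff]
    rfl
  have h2 (μ : R) : (∀ x y : R ⊗[ℚ] D.V,
      D.form.baseChange R (g.val x) (g.val y) = μ * D.form.baseChange R x y) ↔
      (opMatrix b R g.val)ᵀ * (D.realModel b hn e he).form R * opMatrix b R g.val =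
        μ • (D.realModel b hn e he).form R := by
    have e1 (x y : R ⊗[ℚ] D.V) : D.form.baseChange R (g.val x) (g.val y) =
        coords b R x ⬝ᵥ (((opMatrix b R g.val)ᵀ * (D.realModel b hn e he).form R *
          opMatrix b R g.val) *ᵥ coords b R y) := by
      rw [coords_form b, coords_apply, coords_apply, form_realModel, ← mulVec_mulVec,
        ← mulVec_mulVec, dotProduct_mulVec (coords b R x), vecMul_transpose]
      rfl
    have e2 (x y : R ⊗[ℚ] D.V) : μ * D.form.baseChange R x y =
        coords b R x ⬝ᵥ ((μ • (D.realModel b hn e he).form R) *ᵥ coords b R y) := by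
      rw [coords_form b, form_realModel, smul_mulVec, dotProduct_smul]
      rfl
    constructor
    · intro h
      refine eq_of_forall_dotProduct fun x y => ?_
      have := h ((coords b R).symm x) ((coords b R).symm y)
      rwa [e1, e2, LinearEquiv.apply_symm_apply, LinearEquiv.apply_symm_apply] at this
    · intro h x y
      rw [e1, e2, h]
  constructor
  · rintro ⟨hg, μ, hμ⟩
    exact ⟨μ, μ.isUnit, h1.mp hg, (h2 _).mp hμ⟩
  · rintro ⟨_, ⟨μ, rfl⟩, hg, hμ⟩
    exact ⟨h1.mpr hg, μ, (h2 _).mpr hμ⟩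

end Split

end PELDatum

end PEL

/-! ### Rational intertwiners -/

namespace PEL

open Matrix

/-- The morphisms between two representations. -/
def AlgRep.homs {G : GroupFunctor.{v}} {W W' : Type v} [AddCommGroup W] [Module ℚ W]
    [AddCommGroup W'] [Module ℚ W'] (ρ : AlgRep G W) (ρ' : AlgRep G W') :
    Submodule ℚ (W →ₗ[ℚ] W') where
  carrier := {l | AlgRep.IsHom ρ ρ' l}
  zero_mem' R g x := by simp
  add_mem' {l l'} hl hl' R g x := by
    simp only [LinearMap.baseChange_add, LinearMap.add_apply, map_add, hl R g x, hl' R g x]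
  smul_mem' c l hl R g x := by
    have h (y : R ⊗[ℚ] W) : (c • l).baseChange R y = algebraMap ℚ R c • l.baseChange R y := by
      rw [LinearMap.baseChange_smul, LinearMap.smul_apply, algebraMap_smul]
    rw [h, h, hl R g x, map_smul]

namespace PELDatum

variable {D' : PELDatum.{w, v}} {D : PELDatum.{u, v}} {ι' ι : Type} [Fintype ι'] [DecidableEq ι']
  [Fintype ι] [DecidableEq ι] (b' : Module.Basis ι' ℚ D'.V) (b : Module.Basis ι ℚ D.V)

lemma standard_act_injective (R : CommAlgCat.{0} ℚ) : Function.Injective (D.standard.act R) :=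
  fun _ _ h => Subtype.ext (Units.ext h)

variable {k : ℕ} {n : Fin k → ℕ} (hn : ∀ i, 0 < n i)
  (e : (ℝ ⊗[ℚ] D'.B) ≃ₐ[ℝ] (∀ i, Matrix (Fin (n i)) (Fin (n i)) ℝ))
  (he : ∀ b i, e (D'.inv.baseChange ℝ b) i = (e b i).transpose)

/-- The action of `G'` on `V` through a morphism `f : G' → G`, on points over real algebras and in
terms of matrices. -/
def repGraph (f : D'.G ⟶ D.G) : (D'.realModel b' hn e he).RepGraph ι where
  rel R _ _ g l := ∃ (_ : Algebra ℚ R) (x : D'.G.obj (CommAlgCat.of ℚ R)),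
    opMatrix b' R (D'.standard.act (CommAlgCat.of ℚ R) x) = g ∧
    opMatrix b R ((D.standard.pullback f).act (CommAlgCat.of ℚ R) x) = l
  exists_rel {R} _ _ {μ g} hg hμ := by
    let _ : Algebra ℚ R := Algebra.compHom R (algebraMap ℚ ℝ)
    obtain ⟨gu, rfl⟩ := (Matrix.isUnit_iff_isUnit_det _).mpr (hg.isUnit_det _ hμ)
    let y : (Module.End R (R ⊗[ℚ] D'.V))ˣ :=
      Units.map ((opMatrix b' R).symm : Matrix ι' ι' R →* Module.End R (R ⊗[ℚ] D'.V)) gu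
    have hy' : opMatrix b' R y.val = gu.val := (opMatrix b' R).apply_symm_apply _
    have hy : y ∈ D'.points R := by
      rw [D'.mem_points_iff b' hn e he, hy']
      exact ⟨μ, hμ, hg⟩
    exact ⟨_, inferInstance, ⟨y, hy⟩, hy', rfl⟩
  isSimilitude {R} _ _ {g l} := by
    rintro ⟨_, x, rfl, rfl⟩
    exact (D'.mem_points_iff b' hn e he R x.val).mp x.property
  unique {R} _ _ {g l l'} := by
    rintro ⟨i, x, hx, rfl⟩ ⟨i', x', rfl, rfl⟩
    obtain rfl := Subsingleton.elim i i'
    rw [standard_act_injective _ ((opMatrix b' R).injective hx)]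
  one {R} _ _ := by
    let _ : Algebra ℚ R := Algebra.compHom R (algebraMap ℚ ℝ)
    refine ⟨inferInstance, 1, ?_, ?_⟩ <;> rw [map_one, map_one]
  mul {R} _ _ {g g' l l'} := by
    rintro ⟨i, x, rfl, rfl⟩ ⟨i', x', rfl, rfl⟩
    obtain rfl := Subsingleton.elim i i'
    refine ⟨i, x * x', ?_, ?_⟩ <;> rw [map_mul, map_mul]
  map {R R'} _ _ _ _ φ {g l} := by
    rintro ⟨i, x, rfl, rfl⟩
    -- structures of `ℚ`-algebra are unique; this one makes `φ` a `ℚ`-algebra homomorphism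
    let _ : Algebra ℚ R' := ((φ : R →+* R').comp (algebraMap ℚ R)).toAlgebra
    let ψ : R →ₐ[ℚ] R' := { (φ : R →+* R') with commutes' := fun _ => rfl }
    refine ⟨inferInstance, (D'.G.map (CommAlgCat.ofHom ψ)).hom x, ?_, ?_⟩
    · rw [AlgRep.act_map]; exact opMatrix_extendEnd b' ψ _
    · rw [AlgRep.act_map]; exact opMatrix_extendEnd b ψ _

lemma h_apply (D : PELDatum.{u, v}) (a c : ℝ) :
    D.h (a + c * Complex.I) = a • 1 + c • D.h Complex.I := by
  have : (a + c * Complex.I : ℂ) = a • 1 + c • Complex.I := by simp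
  rw [this, map_add, map_smul, map_smul, map_one]

/-- `h'(i)` is a positive complex structure. -/
lemma isPositive_realModel :
    (D'.realModel b' hn e he).IsPositive (opMatrix b' ℝ (D'.h Complex.I)) where
  mem := by
    constructor
    · rw [commutes_realModel_iff]
      intro x
      rw [← opMatrix_baseChange, ← map_mul, ← map_mul]
      congr 1
      exact LinearMap.ext (D'.h_comm Complex.I x)
    · rw [form_realModel]
      refine eq_of_forall_dotProduct fun x y => ?_
      have h := D'.h_adjoint Complex.I ((coords b' ℝ).symm x) ((coords b' ℝ).symm y)
      rw [Complex.conj_I, map_neg, LinearMap.neg_apply, map_neg, coords_form b', coords_form b',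
        coords_apply, coords_apply, LinearEquiv.apply_symm_apply,
        LinearEquiv.apply_symm_apply] at h
      rw [neg_mulVec, dotProduct_neg, ← mulVec_mulVec, ← mulVec_mulVec, dotProduct_mulVec x,
        vecMul_transpose]
      exact h
  sq := by
    rw [← map_mul, ← map_mul, Complex.I_mul_I, map_neg, map_one, map_neg, map_one]
  pos x hx := by
    have h := D'.h_pos ((coords b' ℝ).symm x) (by simpa using hx)
    rw [coords_form b', coords_apply, LinearEquiv.apply_symm_apply] at h
    rw [form_realModel]
    exact h

/-- As `f` is a morphism of Shimura data, it maps `a + b h'(i)` to `a + b K`, where `K` is a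
conjugate of `h(i)`. -/
lemma exists_complexStructure {f : D'.G ⟶ D.G} (hf : IsShimuraMorphism f) :
    ∃ K : Matrix ι ι ℝ, K * K = -1 ∧ ∀ a c : ℝ, a * a + c * c ≠ 0 →
      (repGraph b' b hn e he f).rel ℝ (a • 1 + c • opMatrix b' ℝ (D'.h Complex.I))
        (a • 1 + c • K) := by
  obtain ⟨g, hg⟩ := hf D'.hReal ⟨1, fun z => by simp⟩
  let ρ : D.realPoints →* Module.End ℝ (ℝ ⊗[ℚ] D.V) := D.standard.act (CommAlgCat.of ℚ ℝ)
  have hinv : ρ g⁻¹ * ρ g = 1 := by rw [← map_mul, inv_mul_cancel, map_one]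
  have hinv' : ρ g * ρ g⁻¹ = 1 := by rw [← map_mul, mul_inv_cancel, map_one]
  refine ⟨opMatrix b ℝ (ρ g * D.h Complex.I * ρ g⁻¹), ?_, fun a c hac => ?_⟩
  · rw [← map_mul]
    have : ρ g * D.h Complex.I * ρ g⁻¹ * (ρ g * D.h Complex.I * ρ g⁻¹) =
        (-1 : ℝ) • 1 := by
      calc _ = ρ g * D.h Complex.I * (ρ g⁻¹ * ρ g) * D.h Complex.I * ρ g⁻¹ := by
            simp only [mul_assoc]
        _ = ρ g * D.h (Complex.I * Complex.I) * ρ g⁻¹ := by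
            rw [hinv, mul_one, map_mul]; simp only [mul_assoc]
        _ = _ := by
            have h1 : Complex.I * Complex.I = (-1 : ℝ) • 1 := by simp
            rw [h1, map_smul, map_one, mul_smul_comm, mul_one, smul_mul_assoc, hinv']
    rw [this, map_smul, map_one, neg_one_smul]
  · have hz : (a + c * Complex.I : ℂ) ≠ 0 := by
      intro h0
      have h1 := congrArg Complex.re h0
      have h2 := congrArg Complex.im h0
      simp at h1 h2
      simp [h1, h2] at hac
    refine ⟨inferInstance, D'.hReal (Units.mk0 _ hz), ?_, ?_⟩
    · change opMatrix b' ℝ (D'.h (a + c * Complex.I)) = _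
      rw [h_apply, map_add, map_smul, map_smul, map_one]
    · have h1 : (D.standard.pullback f).act (CommAlgCat.of ℚ ℝ) (D'.hReal (Units.mk0 _ hz)) =
          ρ g * D.h (a + c * Complex.I) * ρ g⁻¹ := by
        change ρ ((f.app (CommAlgCat.of ℚ ℝ)).hom.comp D'.hReal (Units.mk0 _ hz)) = _
        rw [hg, map_mul, map_mul]
        rfl
      rw [h1, h_apply, mul_add, add_mul, mul_smul_comm, smul_mul_assoc, mul_one, hinv',
        mul_smul_comm, smul_mul_assoc, map_add, map_smul, map_smul, map_one]

/-- Applying a `ℚ`-linear map `c : ℝ → ℚ` to the entries of a real intertwiner gives a morphism of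
representations over `ℚ`: for `g ∈ G'(R)`, apply `c ⊗ id` to the intertwining relation over
`ℝ ⊗ R`. -/
lemma toLin_mem_homs {f : D'.G ⟶ D.G} {T : Matrix ι ι' ℝ}
    (hT : ∀ (R : Type) [CommRing R] [Algebra ℝ R] (g : Matrix ι' ι' R),
      (repGraph b' b hn e he f).IntertwinesAt T g) (c : ℝ →ₗ[ℚ] ℚ) :
    Matrix.toLin b' b (T.map c) ∈ AlgRep.homs D'.standard (D.standard.pullback f) := by
  intro R g x
  let φ : R →ₐ[ℚ] ℝ ⊗[ℚ] R := Algebra.TensorProduct.includeRight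
  let Λ : ℝ ⊗[ℚ] R →ₗ[ℚ] R :=
    (TensorProduct.lid ℚ R).toLinearMap ∘ₗ TensorProduct.map c LinearMap.id
  have hΛ (r : ℝ) (a : R) : Λ (algebraMap ℝ (ℝ ⊗[ℚ] R) r * φ a) = algebraMap ℚ R (c r) * a := by
    simp [Λ, φ, Algebra.TensorProduct.algebraMap_apply, Algebra.smul_def]
  have h1 := hT (ℝ ⊗[ℚ] R) ((opMatrix b' R (D'.standard.act R g)).map φ)
    ((opMatrix b R ((D.standard.pullback f).act R g)).map φ)
    ⟨inferInstance, (D'.G.map (CommAlgCat.ofHom φ)).hom g,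
      by rw [AlgRep.act_map]; exact opMatrix_extendEnd b' φ _,
      by rw [AlgRep.act_map]; exact opMatrix_extendEnd b φ _⟩
  have h2 : (T.map c).map (algebraMap ℚ R) * opMatrix b' R (D'.standard.act R g) =
      opMatrix b R ((D.standard.pullback f).act R g) * (T.map c).map (algebraMap ℚ R) := by
    ext i j
    have := congrArg Λ (congrFun (congrFun h1 i) j)
    simp only [mul_apply, toAlg, map_apply, map_sum, hΛ] at this
    simp only [mul_comm (φ _), hΛ] at this
    simpa only [mul_apply, map_apply, mul_comm] using this
  apply (coords b R).injective
  rw [coords_baseChange b', coords_apply, coords_apply, coords_baseChange b',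
    LinearMap.toMatrix_toLin, mulVec_mulVec, mulVec_mulVec, h2]

omit b b' hn e he in
/-- The images of the morphisms of representations `V' → f^* V` span `V`. -/
theorem eq_zero_of_forall_homs (hD' : D'.IsSymplectic) {f : D'.G ⟶ D.G} (hf : IsShimuraMorphism f)
    (l : Module.Dual ℚ D.V)
    (hl : ∀ t ∈ AlgRep.homs D'.standard (D.standard.pullback f), l ∘ₗ t = 0) : l = 0 := by
  obtain ⟨k, n, hn, e, he⟩ := hD'
  let b' := Module.finBasis ℚ D'.V
  let b := Module.finBasis ℚ D.V
  obtain ⟨K, hK, hJK⟩ := exists_complexStructure b' b hn e he hf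
  have key := RealModel.RepGraph.eq_zero_of_forall_intertwinesAt (isPositive_realModel b' hn e he)
    hK hJK (fun i => (l (b i) : ℝ)) ?_
  · refine b.ext fun i => ?_
    simpa using congrFun key i
  intro T hT
  ext j
  refine (Module.forall_dual_apply_eq_zero_iff ℚ _).mp fun c => ?_
  have h1 := LinearMap.congr_fun (hl _ (toLin_mem_homs b' b hn e he hT c)) (b' j)
  rw [LinearMap.comp_apply, Matrix.toLin_self, map_sum] at h1
  simp only [map_smul, map_apply, LinearMap.zero_apply, smul_eq_mul] at h1
  rw [← h1, vecMul, dotProduct, map_sum]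
  refine Finset.sum_congr rfl fun i _ => ?_
  rw [← Rat.smul_def, map_smul, smul_eq_mul, mul_comm]

end PELDatum

end PEL

/-! ### Powers of the standard representation -/

namespace PEL

open Matrix

lemma proj_single_baseChange {W : Type v} [AddCommGroup W] [Module ℚ W] {k : ℕ} (R : Type)
    [CommRing R] [Algebra ℚ R] (i j : Fin k) (x : R ⊗[ℚ] W) :
    (LinearMap.proj (R := ℚ) (φ := fun _ : Fin k => W) i).baseChange R
      ((LinearMap.single ℚ (fun _ : Fin k => W) j).baseChange R x) = if i = j then x else 0 := by
  rw [← LinearMap.comp_apply, ← LinearMap.baseChange_comp]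
  split_ifs with hij
  · subst hij
    rw [LinearMap.proj_comp_single_same, LinearMap.baseChange_id]
    rfl
  · rw [LinearMap.proj_comp_single_ne _ _ _ _ hij]
    simp

namespace AlgRep

variable {G : GroupFunctor.{v}} {W W' : Type v} [AddCommGroup W] [Module ℚ W]
    [AddCommGroup W'] [Module ℚ W']

lemma proj_power_act (ρ : AlgRep G W) (k : ℕ) (R : CommAlgCat.{0} ℚ) (g : G.obj R)
    (x : R ⊗[ℚ] (Fin k → W)) (i : Fin k) :
    (LinearMap.proj (R := ℚ) (φ := fun _ : Fin k => W) i).baseChange R ((ρ.power k).act R g x) =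
      ρ.act R g ((LinearMap.proj (R := ℚ) (φ := fun _ : Fin k => W) i).baseChange R x) := by
  simp [power, LinearMap.sum_apply, proj_single_baseChange]

/-- A family of morphisms `ρ → ρ'` defines a morphism `ρ^k → ρ'`. -/
lemma isHom_sum {ρ : AlgRep G W} {ρ' : AlgRep G W'} {k : ℕ} {t : Fin k → W →ₗ[ℚ] W'}
    (ht : ∀ i, IsHom ρ ρ' (t i)) :
    IsHom (ρ.power k) ρ' (∑ i, t i ∘ₗ LinearMap.proj (R := ℚ) (φ := fun _ : Fin k => W) i) := by
  intro R g x
  have h (y : R ⊗[ℚ] (Fin k → W)) :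
      (∑ i, t i ∘ₗ LinearMap.proj (R := ℚ) (φ := fun _ : Fin k => W) i).baseChange R y =
      ∑ i, (t i).baseChange R
        ((LinearMap.proj (R := ℚ) (φ := fun _ : Fin k => W) i).baseChange R y) := by
    change (LinearMap.baseChangeHom ℚ (R : Type) _ _) _ y = _
    rw [map_sum, LinearMap.sum_apply]
    exact Finset.sum_congr rfl fun i _ => by
      rw [← LinearMap.comp_apply, ← LinearMap.baseChange_comp]; rfl
  rw [h, h, map_sum]
  exact Finset.sum_congr rfl fun i _ => by rw [proj_power_act, ht i R g]

end AlgRep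

namespace PELDatum

variable (D : PELDatum.{u, v}) (k : ℕ)

/-- The orthogonal sum of `k` copies of the pairing. -/
noncomputable def powForm : LinearMap.BilinForm ℚ (Fin k → D.V) :=
  ∑ i, D.form.compl₁₂ (LinearMap.proj i) (LinearMap.proj i)

lemma powForm_apply (x y : Fin k → D.V) : D.powForm k x y = ∑ i, D.form (x i) (y i) := by
  simp [powForm, LinearMap.sum_apply]

lemma powForm_isAlt : (D.powForm k).IsAlt := fun x => by
  rw [powForm_apply]
  exact Finset.sum_eq_zero fun i _ => D.form_alt (x i)

variable (R : Type) [CommRing R] [Algebra ℚ R]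

lemma powForm_baseChange (x y : R ⊗[ℚ] (Fin k → D.V)) : (D.powForm k).baseChange R x y =
    ∑ i, D.form.baseChange R
      ((LinearMap.proj (R := ℚ) (φ := fun _ : Fin k => D.V) i).baseChange R x)
      ((LinearMap.proj (R := ℚ) (φ := fun _ : Fin k => D.V) i).baseChange R y) := by
  induction x with
  | zero => simp
  | tmul r x =>
    induction y with
    | zero => simp
    | tmul s y => simp [powForm_apply, Finset.sum_smul]
    | add y z hy hz => simp only [map_add, hy, hz, Finset.sum_add_distrib]
  | add x z hx hz => simp only [map_add, LinearMap.add_apply, hx, hz, Finset.sum_add_distrib]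

lemma powForm_baseChange_swap (x y : R ⊗[ℚ] (Fin k → D.V)) :
    (D.powForm k).baseChange R x y = -(D.powForm k).baseChange R y x := by
  induction x with
  | zero => simp
  | tmul r x =>
    induction y with
    | zero => simp
    | tmul s y =>
      rw [LinearMap.BilinForm.baseChange_tmul, LinearMap.BilinForm.baseChange_tmul,
        ← (D.powForm_isAlt k).neg_eq y x, mul_comm, neg_smul]
    | add y z hy hz => simp only [map_add, LinearMap.add_apply, hy, hz, neg_add]
  | add x z hx hz => simp only [map_add, LinearMap.add_apply, hx, hz, neg_add]

/-- Elements of `G(R)` act by similitudes. -/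
lemma exists_powForm_act (R : CommAlgCat.{0} ℚ) (g : D.G.obj R) :
    ∃ μ : R, ∀ x y, (D.powForm k).baseChange R ((D.standard.power k).act R g x)
      ((D.standard.power k).act R g y) = μ * (D.powForm k).baseChange R x y := by
  obtain ⟨-, μ, hμ⟩ := g.property
  refine ⟨μ, fun x y => ?_⟩
  rw [powForm_baseChange, powForm_baseChange, Finset.mul_sum]
  refine Finset.sum_congr rfl fun i _ => ?_
  rw [AlgRep.proj_power_act, AlgRep.proj_power_act]
  exact hμ _ _

lemma eq_zero_of_form {y : R ⊗[ℚ] D.V} (h : ∀ x, D.form.baseChange R x y = 0) : y = 0 := by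
  let b := Module.finBasis ℚ D.V
  have hdet : IsUnit ((D.gram b).map (algebraMap ℚ R)).det := by
    have h : ((D.gram b).map (algebraMap ℚ R)).det = algebraMap ℚ R (D.gram b).det := by
      rw [RingHom.map_det]; rfl
    rw [h]; exact (D.gram_det b).map _
  have h1 : (D.gram b).map (algebraMap ℚ R) *ᵥ coords b R y = 0 := by
    ext i
    have := h ((coords b R).symm (Pi.single i 1))
    rwa [coords_form b, LinearEquiv.apply_symm_apply, single_one_dotProduct] at this
  apply (coords b R).injective
  rw [map_zero, ← one_mulVec (coords b R y), ← nonsing_inv_mul _ hdet, ← mulVec_mulVec, h1,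
    mulVec_zero]

lemma eq_zero_of_powForm {y : R ⊗[ℚ] (Fin k → D.V)}
    (h : ∀ x, (D.powForm k).baseChange R x y = 0) : y = 0 := by
  have h1 (i : Fin k) :
      (LinearMap.proj (R := ℚ) (φ := fun _ : Fin k => D.V) i).baseChange R y = 0 := by
    refine D.eq_zero_of_form R fun x => ?_
    have := h ((LinearMap.single ℚ (fun _ : Fin k => D.V) i).baseChange R x)
    rw [powForm_baseChange, Finset.sum_eq_single i] at this
    · rwa [proj_single_baseChange, if_pos rfl] at this
    · intro j _ hj; rw [proj_single_baseChange, if_neg hj]; simp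
    · simp
  have h2 : ∑ i, (LinearMap.single ℚ (fun _ : Fin k => D.V) i) ∘ₗ
      (LinearMap.proj (R := ℚ) (φ := fun _ : Fin k => D.V) i) = LinearMap.id := by
    ext i x j
    simp [Pi.single_apply]
  have h3 := congrArg (fun l => LinearMap.baseChangeHom ℚ R _ _ l y) h2
  simp only [map_sum, LinearMap.sum_apply, LinearMap.baseChangeHom_apply,
    LinearMap.baseChange_comp, LinearMap.comp_apply, h1, map_zero, LinearMap.baseChange_id,
    Finset.sum_const_zero] at h3
  exact h3.symm

end PELDatum

end PEL

/-! ### Semisimplicity and admissibility -/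

namespace PEL

open Matrix

/-- Base change of `t ∘ s = id` on elements. -/
lemma baseChange_rightInverse {W W' : Type v} [AddCommGroup W] [Module ℚ W] [AddCommGroup W']
    [Module ℚ W'] {t : W →ₗ[ℚ] W'} {s : W' →ₗ[ℚ] W} (h : t ∘ₗ s = LinearMap.id) (R : Type)
    [CommRing R] [Algebra ℚ R] (x : R ⊗[ℚ] W') : t.baseChange R (s.baseChange R x) = x := by
  rw [← LinearMap.comp_apply, ← LinearMap.baseChange_comp, h, LinearMap.baseChange_id]; rfl

/-- A bilinear form vanishing on `ker t × range c` also does so after extension of scalars, if `t`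
has a section. -/
lemma baseChange_eq_zero {W W' : Type v} {U : Type*} [AddCommGroup W] [Module ℚ W] [AddCommGroup W']
    [Module ℚ W'] [AddCommGroup U] [Module ℚ U] (B : LinearMap.BilinForm ℚ W) {t : W →ₗ[ℚ] W'}
    {s : W' →ₗ[ℚ] W} (h : t ∘ₗ s = LinearMap.id) {c : U →ₗ[ℚ] W}
    (hB : ∀ z, t z = 0 → ∀ y, B z (c y) = 0) (R : Type) [CommRing R] [Algebra ℚ R]
    {z : R ⊗[ℚ] W} (hz : t.baseChange R z = 0) (y : R ⊗[ℚ] U) :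
    B.baseChange R z (c.baseChange R y) = 0 := by
  have key (z : R ⊗[ℚ] W) (y : R ⊗[ℚ] U) :
      B.baseChange R ((LinearMap.id - s ∘ₗ t).baseChange R z) (c.baseChange R y) = 0 := by
    induction z with
    | zero => simp
    | tmul r z =>
      induction y with
      | zero => simp
      | tmul q y =>
        rw [LinearMap.baseChange_tmul, LinearMap.baseChange_tmul,
          LinearMap.BilinForm.baseChange_tmul, hB, zero_smul]
        have := LinearMap.congr_fun h (t z)
        simpa [sub_eq_zero] using this.symm
      | add y x hy hx => rw [map_add, map_add, hy, hx, add_zero]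
    | add z x hz hx => rw [map_add, map_add, LinearMap.add_apply, hz, hx, add_zero]
  have h1 : (LinearMap.id - s ∘ₗ t).baseChange R z = z := by
    rw [LinearMap.baseChange_sub, LinearMap.sub_apply, LinearMap.baseChange_comp,
      LinearMap.comp_apply, hz, map_zero, sub_zero, LinearMap.baseChange_id]; rfl
  rw [← h1, key]

namespace PELDatum

variable {D : PELDatum.{u, v}} {k : ℕ} {W : Type v} [AddCommGroup W] [Module ℚ W]

/-- The kernel of a morphism from `V^k` is stable under `h(i)`, so that the pairing is
nondegenerate on it, by positivity. -/
lemma eq_zero_of_powForm_ker {ρ : AlgRep D.G W} {t : (Fin k → D.V) →ₗ[ℚ] W}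
    (ht : AlgRep.IsHom (D.standard.power k) ρ t) {s : W →ₗ[ℚ] (Fin k → D.V)}
    (hs : t ∘ₗ s = LinearMap.id) {x : Fin k → D.V} (hx : t x = 0)
    (h : ∀ z, t z = 0 → D.powForm k z x = 0) : x = 0 := by
  have hI : Complex.I ≠ 0 := Complex.I_ne_zero
  let j : D.realPoints := D.hReal (Units.mk0 _ hI)
  let X : ℝ ⊗[ℚ] (Fin k → D.V) := 1 ⊗ₜ x
  let Y := (D.standard.power k).act (CommAlgCat.of ℚ ℝ) j X
  have hY : t.baseChange ℝ Y = 0 := by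
    have := ht (CommAlgCat.of ℚ ℝ) j X
    have h0 : t.baseChange ℝ X = 0 := by simp [X, hx]
    refine this.trans ?_
    exact (congrArg _ h0).trans (map_zero _)
  have h1 : (D.powForm k).baseChange ℝ Y X = 0 := by
    have := baseChange_eq_zero (D.powForm k) hs (c := LinearMap.toSpanSingleton ℚ _ x)
      (fun z hz q => by rw [LinearMap.toSpanSingleton_apply, map_smul, h z hz, smul_zero]) ℝ hY
      (1 ⊗ₜ 1)
    simpa [X] using this
  rw [powForm_baseChange_swap, neg_eq_zero, powForm_baseChange] at h1
  have hYi (i : Fin k) : (LinearMap.proj (R := ℚ) (φ := fun _ : Fin k => D.V) i).baseChange ℝ Y =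
      D.h Complex.I ((1 : ℝ) ⊗ₜ x i) := by
    refine (AlgRep.proj_power_act D.standard k (CommAlgCat.of ℚ ℝ) j X i).trans ?_
    simp only [X]
    rfl
  have hXi (i : Fin k) : (LinearMap.proj (R := ℚ) (φ := fun _ : Fin k => D.V) i).baseChange ℝ X =
      (1 : ℝ) ⊗ₜ x i := by simp [X]
  simp only [hYi, hXi] at h1
  have hnonneg (y : ℝ ⊗[ℚ] D.V) : 0 ≤ D.form.baseChange ℝ y (D.h Complex.I y) := by
    by_cases hy : y = 0
    · simp [hy]
    · exact (D.h_pos y hy).le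
  ext i
  have h2 := (Finset.sum_eq_zero_iff_of_nonneg fun i _ => hnonneg _).mp h1 i (Finset.mem_univ i)
  have h3 : (1 : ℝ) ⊗ₜ[ℚ] x i = 0 := by
    by_contra h0
    exact (D.h_pos _ h0).ne' h2
  refine Module.FaithfullyFlat.tensorProduct_mk_injective (A := ℚ) (B := ℝ) D.V ?_
  simpa using h3

/-- A quotient of `V^k` has an equivariant section, with image the orthogonal complement of the
kernel. -/
theorem exists_equivariant_section {ρ : AlgRep D.G W} {t : (Fin k → D.V) →ₗ[ℚ] W}
    (ht : AlgRep.IsHom (D.standard.power k) ρ t) (hsurj : Function.Surjective t) :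
    ∃ s : W →ₗ[ℚ] (Fin k → D.V), t ∘ₗ s = LinearMap.id ∧
      AlgRep.IsHom ρ (D.standard.power k) s := by
  let N := LinearMap.ker t
  let Φ := D.powForm k
  have hrefl : Φ.IsRefl := (D.powForm_isAlt k).isRefl
  obtain ⟨s₀, hs₀⟩ :=
    LinearMap.exists_rightInverse_of_surjective t (LinearMap.range_eq_top.mpr hsurj)
  have hN : IsCompl N (Φ.orthogonal N) := by
    refine LinearMap.BilinForm.isCompl_orthogonal_of_restrict_nondegenerate hrefl ?_
    have hr : (Φ.restrict N).IsRefl := hrefl.domRestrict N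
    refine hr.nondegenerate_iff_separatingRight.mpr ?_
    rintro ⟨x, hx⟩ h
    exact Subtype.ext (eq_zero_of_powForm_ker ht hs₀ hx fun z hz => h ⟨z, hz⟩)
  obtain ⟨s₁, hs₁⟩ := LinearMap.exists_rightInverse_of_surjective (t.domRestrict (Φ.orthogonal N))
    (LinearMap.range_eq_top.mpr fun w => by
      obtain ⟨y, rfl⟩ := hsurj w
      obtain ⟨a, ha, c, hc, rfl⟩ :=
        Submodule.mem_sup.mp (hN.sup_eq_top ▸ Submodule.mem_top (x := y))
      refine ⟨⟨c, hc⟩, ?_⟩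
      rw [map_add, LinearMap.mem_ker.mp ha, zero_add]
      rfl)
  let s : W →ₗ[ℚ] (Fin k → D.V) := (Φ.orthogonal N).subtype ∘ₗ s₁
  have hs : t ∘ₗ s = LinearMap.id := hs₁
  have hΦs (z) (hz : t z = 0) (y) : Φ z (s y) = 0 := (s₁ y).property z hz
  refine ⟨s, hs, fun R g x => ?_⟩
  -- the defect `y` of equivariance lies in the kernel of `t` and is orthogonal to this kernel
  -- and to the image of `s`
  set y := s.baseChange R (ρ.act R g x) - (D.standard.power k).act R g (s.baseChange R x) with hy
  have hty : t.baseChange R y = 0 := by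
    rw [hy, map_sub, baseChange_rightInverse hs, ht R g, baseChange_rightInverse hs, sub_self]
  have hker (z) (hz : t.baseChange R z = 0) : Φ.baseChange R z y = 0 := by
    obtain ⟨μ, hμ⟩ := D.exists_powForm_act k R g
    set z' := (D.standard.power k).act R g⁻¹ z with hz'
    have hzz : (D.standard.power k).act R g z' = z := by
      rw [hz', ← Module.End.mul_apply, ← map_mul, mul_inv_cancel, map_one]; rfl
    have htz : t.baseChange R z' = 0 := by rw [hz', ht R, hz, map_zero]
    rw [hy, map_sub, baseChange_eq_zero Φ hs hΦs R hz, ← hzz, hμ,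
      baseChange_eq_zero Φ hs hΦs R htz, mul_zero, sub_zero]
  rw [← sub_eq_zero]
  refine D.eq_zero_of_powForm k R fun z => ?_
  have hz : z = (z - s.baseChange R (t.baseChange R z)) + s.baseChange R (t.baseChange R z) := by
    abel
  rw [hz, map_add, LinearMap.add_apply,
    hker _ (by rw [map_sub, baseChange_rightInverse hs, sub_self]), powForm_baseChange_swap,
    baseChange_eq_zero Φ hs hΦs R hty, neg_zero, add_zero]

variable {D' : PELDatum.{w, v}}

/-- A quotient of a power of the standard representation is a direct summand. -/
lemma isAdmissible_of_surjective {f : D'.G ⟶ D.G} {t : (Fin k → D'.V) →ₗ[ℚ] D.V}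
    (ht : AlgRep.IsHom (D'.standard.power k) (D.standard.pullback f) t)
    (hsurj : Function.Surjective t) : IsAdmissible f := by
  obtain ⟨s, hs, hsG⟩ := exists_equivariant_section ht hsurj
  have hts (x) : t (s x) = x := LinearMap.congr_fun hs x
  let e : Module.End ℚ (Fin k → D'.V) := s ∘ₗ t
  have heG : AlgRep.IsHom (D'.standard.power k) (D'.standard.power k) e := fun R g x => by
    simp only [e, LinearMap.baseChange_comp, LinearMap.comp_apply, ht R g, hsG R g]
  have he : IsIdempotentElem e := LinearMap.ext fun x => by
    change s (t (s (t x))) = s (t x)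
    rw [hts]
  have hmem (x) : e (s x) = s x := congrArg s (hts x)
  let l : D.V →ₗ[ℚ] LinearMap.range e := s.codRestrict _ fun x => ⟨s x, hmem x⟩
  have hl : Function.Bijective l := by
    constructor
    · intro x y h
      rw [← hts x, ← hts y]
      exact congrArg t (congrArg Subtype.val h)
    · rintro ⟨_, y, rfl⟩
      exact ⟨t y, rfl⟩
  refine ⟨k, e, heG, he, LinearEquiv.ofBijective l hl, fun R g x => ?_⟩
  have h1 : e.rangeRestrict ∘ₗ s = l := LinearMap.ext fun x => Subtype.ext (hmem x)
  have h2 : (LinearMap.range e).subtype ∘ₗ l = s := rfl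
  change l.baseChange R _ = e.rangeRestrict.baseChange R ((D'.standard.power k).act R g
    ((LinearMap.range e).subtype.baseChange R (l.baseChange R x)))
  have h3 : (LinearMap.range e).subtype.baseChange R (l.baseChange R x) = s.baseChange R x := by
    rw [← LinearMap.comp_apply, ← LinearMap.baseChange_comp, h2]
  rw [h3, ← hsG R g, ← LinearMap.comp_apply (e.rangeRestrict.baseChange R),
    ← LinearMap.baseChange_comp, h1]

/-- The images of the morphisms of representations `V' → f^* V` span `V`, so finitely many of them
define a surjection. -/
lemma exists_surjective (hD' : D'.IsSymplectic) {f : D'.G ⟶ D.G} (hf : IsShimuraMorphism f) :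
    ∃ (k : ℕ) (t : (Fin k → D'.V) →ₗ[ℚ] D.V),
      AlgRep.IsHom (D'.standard.power k) (D.standard.pullback f) t ∧ Function.Surjective t := by
  let H := AlgRep.homs D'.standard (D.standard.pullback f)
  let τ := Module.finBasis ℚ H
  refine ⟨_, _, AlgRep.isHom_sum fun i => (τ i).property, ?_⟩
  rw [← LinearMap.range_eq_top]
  by_contra hne
  obtain ⟨l, hl0, hl⟩ := Submodule.exists_le_ker_of_lt_top _ (lt_top_iff_ne_top.mpr hne)
  refine hl0 (eq_zero_of_forall_homs hD' hf l ?_)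
  have h1 (i) : l ∘ₗ (τ i : D'.V →ₗ[ℚ] D.V) = 0 := by
    ext x
    have := hl ⟨Pi.single i x, rfl⟩
    simpa [LinearMap.sum_apply, Pi.single_apply, apply_ite] using this
  intro t ht
  have h2 := τ.sum_repr ⟨t, ht⟩
  have h3 := congrArg Subtype.val h2
  simp only [AddSubmonoidClass.coe_finsetSum, SetLike.val_smul] at h3
  ext x
  rw [← h3, LinearMap.comp_apply, LinearMap.sum_apply, map_sum]
  exact Finset.sum_eq_zero fun i _ => by
    rw [LinearMap.smul_apply, map_smul, ← LinearMap.comp_apply, h1, LinearMap.zero_apply,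
      smul_zero]

end PELDatum

end PEL

/-- If all factors of `B'_ℝ` are of symplectic type, every morphism of Shimura data
`f : (G', 𝔛') → (G, 𝔛)` between the data attached to PEL-data is admissible. -/
theorem corollary11p3 (D' : PEL.PELDatum.{w, v}) (D : PEL.PELDatum.{u, v})
    (hD' : D'.IsSymplectic) (f : D'.G ⟶ D.G) (hf : PEL.PELDatum.IsShimuraMorphism f) :
    PEL.PELDatum.IsAdmissible f := by
  obtain ⟨k, t, ht, hsurj⟩ := PEL.PELDatum.exists_surjective hD' hf
  exact PEL.PELDatum.isAdmissible_of_surjective ht hsurj
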